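/- Let $\mathbb{F}_q$ be a finite field, $A=\mathbb{F}_q[\theta]$ with fraction field $K$, $A_+\subset A$ the set of monic polynomials, and let \[ \phi_t=\theta+\kappa_1\tau+\cdots+\kappa_r\tau^r,\qquad \psi_t=\theta+\eta_1\tau+\cdots+\eta_r\tau^r\qquad(\kappa_i,\eta_i\in A,\ \kappa_r,\eta_r\in\mathbb{F}_q^{\times}) \] define two Drinfeld modules over $A$ of the same rank $r\ge 2$ with everywhere good reduction, where $\tau$ is the $q$-th power Frobenius. For $a\in A_+$ put $\chi_\phi(a)=((-1)^{r+1}\kappa_r)^{\deg a}$, $\overline{\chi}_\phi=\chi_\phi^{-1}$, and similarly for $\psi$; let $z$ be a second variable and $a(z)$ the image of $a\in A$ under $\theta\mapsto z$. For $f\in A_+$ irreducible of degree $d$, let $P_{\phi,f}(X)\in A[X]$ be the characteristic polynomial (with $t=\theta$) of $\tau^d$ acting on the Tate module $T_\lambda(\overline{\phi})$ of the reduction $\overline\phi$ of $\phi$ modulo $f$, and $P^\vee_{\phi,f}(X)\in K[X]$ that of $\tau^d$ acting on the dual $T_\lambda(\overline\phi)^\vee$; here $\lambda\in\mathbb{F}_q[t]$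 is any monic irreducible with $\lambda(\theta)\ne f$, and the polynomials do not depend on it. Write $P_{\psi,f(z)}=P_{\psi,f}|_{\theta=z}$. Let $\mathbf{P}_f^\vee=P_{\phi,f}^\vee\otimes P_{\psi,f(z)}$, where $\prod_i(X-x_i)\otimes\prod_j(X-y_j)=\prod_{i,j}(X-x_iy_j)$, let $\mathbf{Q}_f^\vee$ be the reciprocal polynomial of $\mathbf{P}_f^\vee$, and for integers $s\ge 0$ let \[ L(\mathbb{E}(\phi\times\psi)^\vee,s)=\prod_f \mathbf{Q}_f^\vee(f^{-s})^{-1}, \] the product being over all irreducible $f\in A_+$. If $\alpha_1,\dots,\alpha_r\in\overline K$ are the roots of $P^\vee_{\phi,f}$, let for $k_1,\dots,k_{r-1}\ge 0$ \[ \boldsymbol{\mu}_{\phi,\theta}(f^{k_1},\dots,f^{k_{r-1}})=S_{k_1,\dots,k_{r-1}}(\alpha_1,\dots,\alpha_r)\,f^{k_1+\cdots+k_{r-1}},\qquad \boldsymbol{\nu}_{\phi,\theta}(f^{k_1},\dots,f^{k_{r-1}})=S_{k_1,\dots,k_{r-1}}(\alpha_1^{-1},\dots,\alpha_r^{-1}),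 \] where $S_{k_1,\dots,k_{r-1}}(x_1,\dots,x_r)=\prod_{i<j}(x_i-x_j)^{-1}\det\bigl(x_j^{k_i+\cdots+k_{r-1}+r-i}\bigr)_{i,j=1}^{r}$ is the Schur polynomial. These values lie in $A$. Extend both to functions $(A_+)^{r-1}\to A$ by requiring $F(a_1b_1,\dots,a_{r-1}b_{r-1})=F(a_1,\dots,a_{r-1})F(b_1,\dots,b_{r-1})$ whenever $\gcd(a_1\cdots a_{r-1},b_1\cdots b_{r-1})=1$; define $\boldsymbol{\nu}_{\psi,\theta}$ in the same way from $\psi$, and set $\boldsymbol{\nu}_{\psi,z}=\boldsymbol{\nu}_{\psi,\theta}|_{\theta=z}$. Put \[ L(\mathbb{A},\chi_\phi\overline{\chi}_\psi,n)=\sum_{a\in A_+}\frac{\chi_\phi(a)\overline{\chi}_\psi(a)a(z)}{a^n},\qquad L(\boldsymbol{\mu}_{\phi,\theta}\times\boldsymbol{\nu}_{\psi,z},s)=\sum_{a_1,\dots,a_{r-1}\in A_+}\frac{\boldsymbol{\mu}_{\phi,\theta}(a_1,\dots,a_{r-1})\,\boldsymbol{\nu}_{\psi,z}(a_1,\dots,a_{r-1})}{a_1\cdots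 a_{r-1}\,(a_1a_2^2\cdots a_{r-1}^{r-1})^s}. \] Then for every integer $s\ge 0$ the product $L(\mathbb{E}(\phi\times\psi)^\vee,s)$ and the series $L(\mathbb{A},\chi_\phi\overline{\chi}_\psi,rs+1)$ and $L(\boldsymbol{\mu}_{\phi,\theta}\times\boldsymbol{\nu}_{\psi,z},s)$ converge (unconditionally) in $\mathbb{F}_q[z]((\theta^{-1}))$, and \[ L(\mathbb{E}(\phi\times\psi)^\vee,s)=L(\mathbb{A},\chi_\phi\overline{\chi}_\psi,rs+1)\cdot L(\boldsymbol{\mu}_{\phi,\theta}\times\boldsymbol{\nu}_{\psi,z},s). \] -/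

import Mathlib

open Polynomial

noncomputable section

/-! ### The Tate module of a module over a commutative ring -/

section Tate

/-- The Tate module `T_l(M) = lim M[l ^ m]` of an `R`-module `M` at an element `l` of `R`: sequences
`(x_m)` with `l ^ m x_m = 0` and `l x_{m+1} = x_m`. -/
def tateModule (R M : Type*) [CommRing R] [AddCommGroup M] [Module R M] (l : R) :
    Submodule R (ℕ → M) where
  carrier := {x | (∀ m, l ^ m • x m = 0) ∧ ∀ m, l • x (m + 1) = x m}
  add_mem' := fun {x y} hx hy =>
    ⟨fun m => by simp [smul_add, hx.1 m, hy.1 m], fun m => by simp [smul_add, hx.2 m, hy.2 m]⟩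
  zero_mem' := ⟨fun m => by simp, fun m => by simp⟩
  smul_mem' := fun c x hx =>
    ⟨fun m => by simp [smul_comm _ c, hx.1 m], fun m => by simp [smul_comm _ c, hx.2 m]⟩

/-- The completion of `R` at the principal ideal `(l)`. -/
abbrev PrincipalCompletion (R : Type*) [CommRing R] (l : R) : Type _ := AdicCompletion (Ideal.span {l}) R

variable {R M : Type*} [CommRing R] [AddCommGroup M] [Module R M] {l : R}

/-- An element of `R` representing the `m`-th component of an element of the completion. -/
def PrincipalCompletion.rep (c : PrincipalCompletion R l) (m : ℕ) : R :=
  Function.surjInv (Submodule.mkQ_surjective (Ideal.span {l} ^ m • ⊤ : Submodule R R)) (c.val m)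

theorem PrincipalCompletion.mkQ_rep (c : PrincipalCompletion R l) (m : ℕ) :
    Submodule.mkQ (Ideal.span {l} ^ m • ⊤ : Submodule R R) (c.rep m) = c.val m :=
  Function.surjInv_eq _ _

theorem tateModule.smul_eq (x : tateModule R M l) (m : ℕ) {a b : R}
    (h : Submodule.mkQ (Ideal.span {l} ^ m • ⊤ : Submodule R R) a =
      Submodule.mkQ (Ideal.span {l} ^ m • ⊤ : Submodule R R) b) :
    a • x.1 m = b • x.1 m := by
  have h1 : a - b ∈ (Ideal.span {l} ^ m • ⊤ : Submodule R R) := by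
    simpa using (Submodule.Quotient.eq _).1 h
  have h2 : a - b ∈ Ideal.span {l ^ m} := by
    simpa [Ideal.span_singleton_pow] using h1
  obtain ⟨c, hc⟩ := Ideal.mem_span_singleton'.1 h2
  rw [← sub_eq_zero, ← sub_smul, ← hc, mul_smul, x.2.1 m, smul_zero]

theorem PrincipalCompletion.mkQ_rep_succ (c : PrincipalCompletion R l) (m : ℕ) :
    Submodule.mkQ (Ideal.span {l} ^ m • ⊤ : Submodule R R) (c.rep (m + 1)) =
      Submodule.mkQ (Ideal.span {l} ^ m • ⊤ : Submodule R R) (c.rep m) := by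
  rw [c.mkQ_rep m, ← c.2 (Nat.le_succ m)]
  have h := c.mkQ_rep (m + 1)
  change _ = AdicCompletion.transitionMap _ _ _ (c.val (m + 1))
  rw [← h]
  rfl

/-- The action of the completion: if `c` is represented by `a` modulo `l ^ m`, then the `m`-th
component of `c • x` is `a • x m`. -/
instance tateModule.instSMul : SMul (PrincipalCompletion R l) (tateModule R M l) where
  smul c x := ⟨fun m => c.rep m • x.1 m,
    fun m => by rw [smul_comm, x.2.1 m, smul_zero],
    fun m => by
      rw [smul_comm, x.2.2 m]
      exact tateModule.smul_eq x m (c.mkQ_rep_succ m)⟩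

theorem tateModule.smul_apply (c : PrincipalCompletion R l) (x : tateModule R M l) (m : ℕ) {a : R}
    (h : Submodule.mkQ (Ideal.span {l} ^ m • ⊤ : Submodule R R) a = c.val m) :
    (c • x).1 m = a • x.1 m :=
  tateModule.smul_eq x m ((c.mkQ_rep m).trans h.symm)

instance tateModule.instModule : Module (PrincipalCompletion R l) (tateModule R M l) where
  one_smul x := by
    ext m
    rw [tateModule.smul_apply (a := 1) _ _ m rfl, one_smul]
  mul_smul c d x := by
    ext m
    rw [tateModule.smul_apply (a := c.rep m * d.rep m) _ _ m, mul_smul,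
      tateModule.smul_apply (a := c.rep m) _ _ m (c.mkQ_rep m),
      tateModule.smul_apply (a := d.rep m) _ _ m (d.mkQ_rep m)]
    change _ = c.val m * d.val m
    rw [← c.mkQ_rep m, ← d.mkQ_rep m]
    rfl
  smul_zero c := by
    ext m
    rw [tateModule.smul_apply (a := c.rep m) _ _ m (c.mkQ_rep m)]
    simp
  smul_add c x y := by
    ext m
    change _ = (c • x).1 m + (c • y).1 m
    rw [tateModule.smul_apply (a := c.rep m) _ _ m (c.mkQ_rep m),
      tateModule.smul_apply (a := c.rep m) _ _ m (c.mkQ_rep m),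
      tateModule.smul_apply (a := c.rep m) _ _ m (c.mkQ_rep m), ← smul_add]
    rfl
  add_smul c d x := by
    ext m
    change _ = (c • x).1 m + (d • x).1 m
    rw [tateModule.smul_apply (a := c.rep m + d.rep m) _ _ m, add_smul,
      tateModule.smul_apply (a := c.rep m) _ _ m (c.mkQ_rep m),
      tateModule.smul_apply (a := d.rep m) _ _ m (d.mkQ_rep m)]
    rw [map_add, c.mkQ_rep m, d.mkQ_rep m]
    rfl
  zero_smul x := by
    ext m
    rw [tateModule.smul_apply (a := 0) _ _ m (map_zero _), zero_smul]
    rfl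

/-- The endomorphism of the Tate module induced by an endomorphism of `M`. -/
def tateMap (l : R) (e : M →ₗ[R] M) : tateModule R M l →ₗ[PrincipalCompletion R l] tateModule R M l where
  toFun x := ⟨fun m => e (x.1 m),
    fun m => by rw [← map_smul, x.2.1 m, map_zero],
    fun m => by rw [← map_smul, x.2.2 m]⟩
  map_add' x y := by
    ext m
    exact map_add e _ _
  map_smul' c x := by
    ext m
    rw [RingHom.id_apply, tateModule.smul_apply (a := c.rep m) _ _ m (c.mkQ_rep m)]
    change e ((c • x).1 m) = _
    rw [tateModule.smul_apply (a := c.rep m) _ _ m (c.mkQ_rep m), map_smul]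

/-- The automorphism of the Tate module induced by an automorphism of `M`. -/
def tateEquiv (l : R) (e : M ≃ₗ[R] M) : tateModule R M l ≃ₗ[PrincipalCompletion R l] tateModule R M l :=
  LinearEquiv.ofLinearMap (tateMap l e.toLinearMap) (tateMap l e.symm.toLinearMap)
    (by
      ext x m
      exact e.apply_symm_apply _)
    (by
      ext x m
      exact e.symm_apply_apply _)

end Tate

/-! ### Drinfeld modules with everywhere good reduction -/

section Drinfeld

/-- The set `A_+` of monic elements of `A = F[θ]`. -/
abbrev MonicPoly (F : Type*) [Field F] : Type _ := {a : F[X] // a.Monic}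

/-- The monic irreducible elements of `A = F[θ]`. -/
abbrev MonicIrr (F : Type*) [Field F] : Type _ := {f : F[X] // f.Monic ∧ Irreducible f}

instance MonicIrr.factIrreducible {F : Type*} [Field F] (f : MonicIrr F) :
    Fact (Irreducible f.1) := ⟨f.2.2⟩

/-- A Drinfeld module `φ_t = θ + κ_1 τ + ⋯ + κ_r τ ^ r` of rank `r` over `A = F[θ]` with everywhere
good reduction: `κ_i ∈ A` and `κ_r` is a nonzero constant. -/
structure GoodDrinfeldModule (F : Type*) [Field F] (r : ℕ) where
  /-- the coefficients of `φ_t`, starting with the constant coefficient -/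
  coeff : Fin (r + 1) → F[X]
  coeff_zero : coeff 0 = X
  /-- the leading coefficient `κ_r` -/
  lead : Fˣ
  coeff_last : coeff (Fin.last r) = C (lead : F)

variable {F : Type*} [Field F] [Fintype F]

/-- The residue field `A / fA`. -/
abbrev ResField (f : MonicIrr F) : Type _ := AdjoinRoot f.1

/-- An algebraic closure of the residue field at `f`. -/
abbrev ResClosure (f : MonicIrr F) : Type _ := AlgebraicClosure (ResField f)

instance ResField.instFinite (f : MonicIrr F) : Finite (ResField f) := by
  have : Module.Finite F (ResField f) := f.2.1.finite_adjoinRoot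
  exact Module.finite_of_finite F

instance ResField.instFintype (f : MonicIrr F) : Fintype (ResField f) := Fintype.ofFinite _

variable {r : ℕ}

/-- The reduction of `φ_t` modulo `f`, as an `F`-linear operator on the algebraic closure of the
residue field: `x ↦ ∑ κ_i x ^ (q ^ i)`. -/
def redOp (φ : GoodDrinfeldModule F r) (f : MonicIrr F) : Module.End F (ResClosure f) :=
  ∑ i : Fin (r + 1),
    LinearMap.mulLeft F (algebraMap (ResField f) (ResClosure f) (AdjoinRoot.mk f.1 (φ.coeff i))) *
      (FiniteField.frobeniusAlgHom F (ResClosure f)).toLinearMap ^ (i : ℕ)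

/-- The algebraic closure of the residue field as an `F[t]`-module through the reduction of `φ`. -/
abbrev RedModule (φ : GoodDrinfeldModule F r) (f : MonicIrr F) : Type _ :=
  Module.AEval' (redOp φ f)

/-- The Frobenius automorphism `x ↦ x ^ (q ^ d)`, `d = deg f`, of the algebraic closure of the
residue field. -/
def frobAut (f : MonicIrr F) : ResClosure f ≃ₐ[ResField f] ResClosure f :=
  FiniteField.frobeniusAlgEquivOfAlgebraic (ResField f) (ResClosure f)

theorem redOp_apply (φ : GoodDrinfeldModule F r) (f : MonicIrr F) (x : ResClosure f) :
    redOp φ f x = ∑ i : Fin (r + 1),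
      algebraMap (ResField f) (ResClosure f) (AdjoinRoot.mk f.1 (φ.coeff i)) *
        x ^ (Fintype.card F ^ (i : ℕ)) := by
  have key : ∀ (i : ℕ) (y : ResClosure f),
      ((FiniteField.frobeniusAlgHom F (ResClosure f)).toLinearMap ^ i) y =
        y ^ (Fintype.card F ^ i) := by
    intro i
    induction i with
    | zero => intro y; simp
    | succ i ih =>
      intro y
      rw [pow_succ', Module.End.mul_apply, ih]
      simp [pow_succ, pow_mul]
  simp [redOp, LinearMap.sum_apply, key]

theorem frobAut_apply (f : MonicIrr F) (x : ResClosure f) :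
    frobAut f x = x ^ (Fintype.card F ^ f.1.natDegree) := by
  have h : Fintype.card (ResField f) = Fintype.card F ^ f.1.natDegree := by
    have : Module.Finite F (ResField f) := f.2.1.finite_adjoinRoot
    rw [Module.card_eq_pow_finrank (K := F)]
    congr 1
    exact (AdjoinRoot.powerBasis f.2.1.ne_zero).finrank
  rw [← h]
  rfl

theorem frobAut_redOp (φ : GoodDrinfeldModule F r) (f : MonicIrr F) (x : ResClosure f) :
    frobAut f (redOp φ f x) = redOp φ f (frobAut f x) := by
  simp [redOp_apply, map_sum, map_mul, map_pow, AlgEquiv.commutes]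

/-- The Frobenius `τ ^ d` as an `F`-linear automorphism. -/
def frobLin (f : MonicIrr F) : ResClosure f ≃ₗ[F] ResClosure f :=
  ((frobAut f).restrictScalars F).toLinearEquiv

/-- The Frobenius `τ ^ d` as an automorphism of the `F[t]`-module defined by the reduction of `φ`. -/
def frobRed (φ : GoodDrinfeldModule F r) (f : MonicIrr F) :
    RedModule φ f ≃ₗ[F[X]] RedModule φ f :=
  LinearEquiv.ofAEval (redOp φ f) ((frobLin f).trans (Module.AEval'.of (redOp φ f))) (by
    intro x
    change Module.AEval'.of (redOp φ f) (frobAut f (redOp φ f x)) =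
      (X : F[X]) • Module.AEval'.of (redOp φ f) (frobAut f x)
    rw [frobAut_redOp, Module.AEval'.X_smul_of])

/-- The Tate module of the reduction of `φ` modulo `f` at `l`. -/
abbrev RedTate (φ : GoodDrinfeldModule F r) (f l : MonicIrr F) : Type _ :=
  tateModule F[X] (RedModule φ f) l.1

/-- The action of `τ ^ d` on the Tate module. -/
def frobTate (φ : GoodDrinfeldModule F r) (f l : MonicIrr F) :
    RedTate φ f l ≃ₗ[PrincipalCompletion F[X] l.1] RedTate φ f l :=
  tateEquiv l.1 (frobRed φ f)

/-- `P ∈ A[X]` is (with `t = θ`) the characteristic polynomial of `τ ^ d` on the `l`-adic Tate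
module of the reduction of `φ` modulo `f`. -/
def IsFrobCharpoly (φ : GoodDrinfeldModule F r) (f l : MonicIrr F) (P : F[X][X]) : Prop :=
  ∃ (_ : Module.Free (PrincipalCompletion F[X] l.1) (RedTate φ f l))
    (_ : Module.Finite (PrincipalCompletion F[X] l.1) (RedTate φ f l)),
    P.map (algebraMap F[X] (PrincipalCompletion F[X] l.1)) =
      LinearMap.charpoly (M := RedTate φ f l) (frobTate φ f l).toLinearMap

/-- The polynomial `P_{φ,f} ∈ A[X]`: the characteristic polynomial of `τ ^ d` on the `l`-adic Tate
module of the reduction of `φ` modulo `f`, for all `l ≠ f`. -/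
def frobCharpoly (φ : GoodDrinfeldModule F r) (f : MonicIrr F) : F[X][X] :=
  Classical.epsilon fun P => ∀ l : MonicIrr F, l ≠ f → IsFrobCharpoly φ f l P

/-- `P ∈ K[X]` is (with `t = θ`) the characteristic polynomial of `τ ^ d` on the dual of the `l`-adic
Tate module of the reduction of `φ` modulo `f`; the automorphism `τ ^ d` acts on a functional `g`
by `g ∘ τ ^ (-d)`. The equality takes place after multiplication by a common denominator `a`. -/
def IsDualFrobCharpoly (φ : GoodDrinfeldModule F r) (f l : MonicIrr F)
    (P : (FractionRing F[X])[X]) : Prop :=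
  ∃ (_ : Module.Free (PrincipalCompletion F[X] l.1) (RedTate φ f l))
    (_ : Module.Finite (PrincipalCompletion F[X] l.1) (RedTate φ f l)),
    ∃ (a : F[X]) (p : F[X][X]), a ≠ 0 ∧
      p.map (algebraMap F[X] (FractionRing F[X])) = C (algebraMap F[X] (FractionRing F[X]) a) * P ∧
      p.map (algebraMap F[X] (PrincipalCompletion F[X] l.1)) =
        C (algebraMap F[X] (PrincipalCompletion F[X] l.1) a) *
          ((frobTate φ f l).symm.dualMap).toLinearMap.charpoly

/-- The polynomial `P_{φ,f}^∨ ∈ K[X]`: the characteristic polynomial of `τ ^ d` on the dual of the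
`l`-adic Tate module of the reduction of `φ` modulo `f`, for all `l ≠ f`. -/
def dualFrobCharpoly (φ : GoodDrinfeldModule F r) (f : MonicIrr F) : (FractionRing F[X])[X] :=
  Classical.epsilon fun P => ∀ l : MonicIrr F, l ≠ f → IsDualFrobCharpoly φ f l P

/-- The character `χ_φ(a) = ((-1) ^ (r + 1) κ_r) ^ (deg a)` on `A_+`. -/
def chi (φ : GoodDrinfeldModule F r) (a : MonicPoly F) : Fˣ :=
  ((-1) ^ (r + 1) * φ.lead) ^ a.1.natDegree

end Drinfeld

/-! ### Schur polynomials -/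

/-- The Vandermonde determinant `∏_{i < j} (x_i - x_j)`. -/
def vandermondeProd (n : ℕ) : MvPolynomial (Fin n) ℤ :=
  ∏ i : Fin n, ∏ j ∈ Finset.Ioi i, (MvPolynomial.X i - MvPolynomial.X j)

/-- The determinant with `i`-th row `x_j ^ (k_i + ⋯ + k_{n-1} + n - i)`, for `1 ≤ i ≤ n`
(indices below start at `0`). -/
def schurNumerator (n : ℕ) (k : Fin (n - 1) → ℕ) : MvPolynomial (Fin n) ℤ :=
  (Matrix.of fun i j : Fin n => (MvPolynomial.X j : MvPolynomial (Fin n) ℤ) ^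
    ((∑ m : Fin (n - 1), if (i : ℕ) ≤ (m : ℕ) then k m else 0) + (n - 1 - (i : ℕ)))).det

/-- The Schur polynomial `S_{k_1, …, k_{n-1}}(x_1, …, x_n)`, the quotient of the determinant
`schurNumerator` by the Vandermonde determinant. -/
def schurPoly (n : ℕ) (k : Fin (n - 1) → ℕ) : MvPolynomial (Fin n) ℤ :=
  Classical.epsilon fun S => vandermondeProd n * S = schurNumerator n k

/-! ### The coefficients of the convolution -/

section MuNu

variable {F : Type*} [Field F] [Fintype F] {r : ℕ}

/-- `μ_{φ,θ}(f ^ k_1, …, f ^ k_{r-1}) = S_k(α_1, …, α_r) f ^ (k_1 + ⋯ + k_{r-1}) ∈ A`, where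
`α_1, …, α_r` are the roots of `P_{φ,f}^∨` in an algebraic closure of `K`. -/
def muPrime (φ : GoodDrinfeldModule F r) (f : MonicIrr F) (k : Fin (r - 1) → ℕ) : F[X] :=
  Classical.epsilon fun c => ∃ α : Fin r → AlgebraicClosure (FractionRing F[X]),
    (dualFrobCharpoly φ f).map (algebraMap (FractionRing F[X]) _) = ∏ i, (X - C (α i)) ∧
    algebraMap F[X] (AlgebraicClosure (FractionRing F[X])) c =
      MvPolynomial.aeval α (schurPoly r k) *
        algebraMap F[X] (AlgebraicClosure (FractionRing F[X])) f.1 ^ (∑ i, k i)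

/-- `ν_{φ,θ}(f ^ k_1, …, f ^ k_{r-1}) = S_k(α_1⁻¹, …, α_r⁻¹) ∈ A`, where `α_1, …, α_r` are the roots
of `P_{φ,f}^∨` in an algebraic closure of `K`. -/
def nuPrime (φ : GoodDrinfeldModule F r) (f : MonicIrr F) (k : Fin (r - 1) → ℕ) : F[X] :=
  Classical.epsilon fun c => ∃ α : Fin r → AlgebraicClosure (FractionRing F[X]),
    (dualFrobCharpoly φ f).map (algebraMap (FractionRing F[X]) _) = ∏ i, (X - C (α i)) ∧
    algebraMap F[X] (AlgebraicClosure (FractionRing F[X])) c =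
      MvPolynomial.aeval (fun i => (α i)⁻¹) (schurPoly r k)

/-- The multiplicative extension of `μ_{φ,θ}` to `(A_+) ^ (r-1)`. -/
def muTheta (φ : GoodDrinfeldModule F r) (a : Fin (r - 1) → MonicPoly F) : F[X] :=
  ∏ᶠ f : MonicIrr F, muPrime φ f fun i => multiplicity f.1 (a i).1

/-- The multiplicative extension of `ν_{φ,θ}` to `(A_+) ^ (r-1)`. -/
def nuTheta (φ : GoodDrinfeldModule F r) (a : Fin (r - 1) → MonicPoly F) : F[X] :=
  ∏ᶠ f : MonicIrr F, nuPrime φ f fun i => multiplicity f.1 (a i).1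

end MuNu

/-! ### The field of values -/

section Values

/-- The field `F(z)((θ⁻¹))` with its `θ⁻¹`-adic topology; the variable of the Laurent series is
`θ⁻¹`. -/
abbrev KInf (F : Type*) [Field F] : Type _ := LaurentSeries (RatFunc F)

variable {F : Type*} [Field F]

/-- The subset `F[z]((θ⁻¹))` of `F(z)((θ⁻¹))`, which is the Tate algebra in `z` over `F((θ⁻¹))`. -/
def tateAlg (F : Type*) [Field F] : Set (KInf F) :=
  {x | ∀ n : ℤ, ∃ p : F[X], x.coeff n = algebraMap F[X] (RatFunc F) p}

/-- The inclusion of the constants `F` into `F(z)((θ⁻¹))`. -/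
def constHom (F : Type*) [Field F] : F →+* KInf F :=
  (HahnSeries.C : RatFunc F →+* KInf F).comp (algebraMap F (RatFunc F))

/-- The embedding `a ↦ a(θ)` of `A` into `F(z)((θ⁻¹))`. -/
def atTheta (F : Type*) [Field F] : F[X] →+* KInf F :=
  eval₂RingHom (constHom F) (HahnSeries.single (-1 : ℤ) (1 : RatFunc F))

/-- The embedding `a ↦ a(z)` of `A` into `F(z)((θ⁻¹))`. -/
def atZ (F : Type*) [Field F] : F[X] →+* KInf F :=
  eval₂RingHom (constHom F) (HahnSeries.C (RatFunc.X : RatFunc F))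

theorem atTheta_coeff (p : F[X]) (n : ℕ) :
    (atTheta F p).coeff (-(n : ℤ)) = algebraMap F (RatFunc F) (p.coeff n) := by
  induction p using Polynomial.induction_on' with
  | add p q hp hq => rw [map_add, HahnSeries.coeff_add, hp, hq, coeff_add, map_add]
  | monomial m a =>
    rw [atTheta, coe_eval₂RingHom, eval₂_monomial, HahnSeries.single_pow, one_pow, constHom,
      RingHom.comp_apply, HahnSeries.C_apply, HahnSeries.single_mul_single,
      HahnSeries.coeff_single, coeff_monomial, zero_add, mul_one]
    by_cases h : m = n
    · subst h
      simp
    · have h2 : ¬ (-(n : ℤ) = m • (-1 : ℤ)) := by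
        intro h3
        apply h
        simp at h3
        omega
      rw [if_neg h2, if_neg h, map_zero]

theorem atTheta_injective : Function.Injective (atTheta F) := by
  rw [injective_iff_map_eq_zero]
  intro p hp
  ext n
  have h := atTheta_coeff p n
  rw [hp, HahnSeries.coeff_zero] at h
  rw [coeff_zero]
  exact (map_eq_zero _).1 h.symm

/-- The embedding of `K = F(θ)` into `F(z)((θ⁻¹))`. -/
def fracTheta (F : Type*) [Field F] : FractionRing F[X] →+* KInf F :=
  IsFractionRing.lift (g := atTheta F) atTheta_injective

end Values

/-! ### The L-functions -/

/-- The polynomial `P ⊗ Q = ∏_{i,j} (T - x_i y_j)` for monic `P = ∏_i (T - x_i)` and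
`Q = ∏_j (T - y_j)` over a field, the roots being taken in an algebraic closure. -/
def polyTensor {k : Type*} [Field k] (P Q : k[X]) : k[X] :=
  Classical.epsilon fun R =>
    R.map (algebraMap k (AlgebraicClosure k)) =
      ((P.aroots (AlgebraicClosure k) ×ˢ Q.aroots (AlgebraicClosure k)).map
        fun p => X - C (p.1 * p.2)).prod

section LFunctions

variable {F : Type*} [Field F] [Fintype F] {r ℓ : ℕ}

/-- The reciprocal polynomial `𝐐_f^∨` of `𝐏_f^∨ = P_{φ,f}^∨ ⊗ P_{ψ,f(z)}`, where `P_{ψ,f(z)}` is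
`P_{ψ,f}` with `θ = z`. -/
def dualEulerPoly (φ : GoodDrinfeldModule F r) (ψ : GoodDrinfeldModule F ℓ) (f : MonicIrr F) :
    (KInf F)[X] :=
  (polyTensor ((dualFrobCharpoly φ f).map (fracTheta F))
    ((frobCharpoly ψ f).map (atZ F))).reverse

/-- The Euler factor `𝐐_f^∨(f ^ (-s))⁻¹` of `L(𝔼(φ × ψ)^∨, s)`. -/
def eulerFactor (φ : GoodDrinfeldModule F r) (ψ : GoodDrinfeldModule F ℓ) (s : ℕ)
    (f : MonicIrr F) : KInf F :=
  ((dualEulerPoly φ ψ f).eval ((atTheta F f.1 ^ s)⁻¹))⁻¹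

/-- The L-function `L(𝔼(φ × ψ)^∨, s) = ∏_f 𝐐_f^∨(f ^ (-s))⁻¹`. -/
def LTwist (φ : GoodDrinfeldModule F r) (ψ : GoodDrinfeldModule F ℓ) (s : ℕ) : KInf F :=
  ∏' f : MonicIrr F, eulerFactor φ ψ s f

/-- The term `χ_φ(a) χ_ψ(a)⁻¹ a(z) / a ^ n` of the twisted Pellarin L-series. -/
def pellarinTerm (φ : GoodDrinfeldModule F r) (ψ : GoodDrinfeldModule F ℓ) (n : ℕ)
    (a : MonicPoly F) : KInf F :=
  constHom F ((chi φ a * (chi ψ a)⁻¹ : Fˣ) : F) * atZ F a.1 / atTheta F a.1 ^ n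

/-- The twisted Pellarin L-series `L(𝔸, χ_φ χ_ψ⁻¹, n)`. -/
def LPellarin (φ : GoodDrinfeldModule F r) (ψ : GoodDrinfeldModule F ℓ) (n : ℕ) : KInf F :=
  ∑' a : MonicPoly F, pellarinTerm φ ψ n a

/-- The term `μ_{φ,θ}(a) ν_{ψ,z}(a) / (a_1 ⋯ a_{r-1} (a_1 a_2 ^ 2 ⋯ a_{r-1} ^ (r-1)) ^ s)` of the
convolution L-series, where `ν_{ψ,z}` is `ν_{ψ,θ}` with `θ = z`. -/
def convTerm (φ ψ : GoodDrinfeldModule F r) (s : ℕ) (a : Fin (r - 1) → MonicPoly F) : KInf F :=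
  atTheta F (muTheta φ a) * atZ F (nuTheta ψ a) /
    ((∏ i, atTheta F (a i).1) * (∏ i, atTheta F (a i).1 ^ ((i : ℕ) + 1)) ^ s)

/-- The convolution L-series `L(μ_{φ,θ} × ν_{ψ,z}, s)`. -/
def LConv (φ ψ : GoodDrinfeldModule F r) (s : ℕ) : KInf F :=
  ∑' a : Fin (r - 1) → MonicPoly F, convTerm φ ψ s a

end LFunctions

end

noncomputable section

section Alternant

variable {R S : Type*} [CommRing R] [CommRing S] {n : ℕ}

/-- The alternant `det (x_j ^ m_i)`. -/
def altDet (x : Fin n → R) (m : Fin n → ℕ) : R :=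
  (Matrix.of fun i j : Fin n => x j ^ m i).det

theorem map_altDet (g : R →+* S) (x : Fin n → R) (m : Fin n → ℕ) :
    g (altDet x m) = altDet (fun i => g (x i)) m := by
  rw [altDet, RingHom.map_det, altDet]
  congr 1
  ext i j
  simp

/-- The exponents `k_i + ⋯ + k_{n-1} + n - i` of the numerator of the Schur polynomial. -/
def schurExp (k : Fin n → ℕ) (i : Fin (n + 1)) : ℕ :=
  (∑ m : Fin n, if (i : ℕ) ≤ (m : ℕ) then k m else 0) + (n - (i : ℕ))

theorem schurNumerator_eq (k : Fin n → ℕ) :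
    schurNumerator (n + 1) k = altDet MvPolynomial.X (schurExp k) := rfl

theorem altDet_staircase (x : Fin (n + 1) → R) :
    altDet x (fun i => n - (i : ℕ)) = ∏ i, ∏ j ∈ Finset.Ioi i, (x i - x j) := by
  have h := Matrix.det_projVandermonde (fun _ : Fin (n + 1) => (1 : R)) x
  simp only [one_mul] at h
  rw [← h, altDet, ← Matrix.det_transpose]
  congr 1
  ext i j
  simp [Matrix.projVandermonde_apply, Fin.val_rev]

theorem altDet_staircase_X :
    altDet (MvPolynomial.X : Fin (n + 1) → MvPolynomial (Fin (n + 1)) ℤ) (fun i => n - (i : ℕ)) =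
      vandermondeProd (n + 1) := altDet_staircase _

theorem vandermondeProd_ne_zero (n : ℕ) : vandermondeProd n ≠ 0 := by
  rw [vandermondeProd, Finset.prod_ne_zero_iff]
  intro i _
  rw [Finset.prod_ne_zero_iff]
  intro j hj h
  have := MvPolynomial.X_injective (sub_eq_zero.1 h)
  simp [this] at hj

/-- The determinant of the coefficients of the remainders of `X ^ m_i` modulo `P`. -/
def remDet (P : R[X]) (m : Fin (n + 1) → ℕ) : R :=
  (Matrix.of fun i j : Fin (n + 1) => ((X ^ m i : R[X]) %ₘ P).coeff (n - (j : ℕ))).det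

theorem map_remDet (g : R →+* S) {P : R[X]} (hP : P.Monic) (m : Fin (n + 1) → ℕ) :
    g (remDet P m) = remDet (P.map g) m := by
  rw [remDet, RingHom.map_det, remDet]
  congr 1
  ext i j
  have := Polynomial.map_modByMonic g hP (p := (X ^ m i : R[X]))
  simp only [Polynomial.map_pow, map_X] at this
  simp [← this]

theorem altDet_eq_remDet_mul (x : Fin (n + 1) → R) (m : Fin (n + 1) → ℕ) :
    altDet x m = remDet (∏ i, (X - C (x i))) m * altDet x (fun i => n - (i : ℕ)) := by
  nontriviality R
  set P : R[X] := ∏ i, (X - C (x i)) with hPdef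
  have hP : P.Monic := monic_prod_of_monic _ _ fun i _ => monic_X_sub_C _
  have hdeg : P.natDegree = n + 1 := by
    rw [hPdef, natDegree_prod_of_monic _ _ fun i _ => monic_X_sub_C _]
    simp
  rw [remDet, altDet, altDet, ← Matrix.det_mul]
  congr 1
  ext i j
  have hroot : P.eval (x j) = 0 := by
    rw [hPdef, eval_prod]
    exact Finset.prod_eq_zero (Finset.mem_univ j) (by simp)
  have h1 : x j ^ m i = ((X ^ m i : R[X]) %ₘ P).eval (x j) := by
    conv_lhs => rw [← eval_X (x := x j), ← eval_pow, ← modByMonic_add_div (X ^ m i : R[X]) P]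
    simp [hroot]
  have h2 : ((X ^ m i : R[X]) %ₘ P).natDegree < n + 1 := by
    rw [← hdeg]
    exact natDegree_modByMonic_lt _ hP (by
      intro h
      rw [h, natDegree_one] at hdeg
      omega)
  rw [Matrix.mul_apply, Matrix.of_apply, h1, eval_eq_sum_range' h2, ← Fin.sum_univ_eq_sum_range
    (fun l => ((X ^ m i : R[X]) %ₘ P).coeff l * x j ^ l), ← Equiv.sum_comp Fin.revPerm]
  refine Finset.sum_congr rfl fun l _ => ?_
  have : ((Fin.revPerm l : Fin (n + 1)) : ℕ) = n - l := by
    simp [Fin.val_rev]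
  rw [this]
  rfl

theorem vandermondeProd_mul_schurPoly (k : Fin n → ℕ) :
    vandermondeProd (n + 1) * schurPoly (n + 1) k = schurNumerator (n + 1) k :=
  Classical.epsilon_spec (p := fun S => vandermondeProd (n + 1) * S = schurNumerator (n + 1) k)
    ⟨remDet (∏ i, (X - C (MvPolynomial.X i))) (schurExp k), by
      rw [schurNumerator_eq, altDet_eq_remDet_mul, altDet_staircase_X, mul_comm]⟩

theorem schurPoly_eq_remDet (k : Fin n → ℕ) :
    schurPoly (n + 1) k = remDet (∏ i, (X - C (MvPolynomial.X i))) (schurExp k) := by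
  apply mul_left_cancel₀ (vandermondeProd_ne_zero (n + 1))
  rw [vandermondeProd_mul_schurPoly, schurNumerator_eq, altDet_eq_remDet_mul, altDet_staircase_X,
    mul_comm]

theorem aeval_schurPoly (x : Fin (n + 1) → R) (k : Fin n → ℕ) :
    MvPolynomial.aeval x (schurPoly (n + 1) k) = remDet (∏ i, (X - C (x i))) (schurExp k) := by
  rw [schurPoly_eq_remDet]
  have h := map_remDet (MvPolynomial.aeval x : MvPolynomial (Fin (n + 1)) ℤ →ₐ[ℤ] R).toRingHom
    (P := ∏ i, (X - C (MvPolynomial.X i : MvPolynomial (Fin (n + 1)) ℤ)))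
    (monic_prod_of_monic _ _ fun i _ => monic_X_sub_C _) (schurExp k)
  simp only [AlgHom.toRingHom_eq_coe, RingHom.coe_coe] at h
  rw [h, Polynomial.map_prod]
  simp

theorem altDet_eq_schur_mul (x : Fin (n + 1) → R) (k : Fin n → ℕ) :
    altDet x (schurExp k) =
      MvPolynomial.aeval x (schurPoly (n + 1) k) * altDet x (fun i => n - (i : ℕ)) := by
  rw [aeval_schurPoly, altDet_eq_remDet_mul]

end Alternant

section Degree

variable {n : ℕ}

theorem one_le_degreeOf_X_sub_X {σ : Type*} {a b : σ} (h : a ≠ b) :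
    1 ≤ (MvPolynomial.X a - MvPolynomial.X b : MvPolynomial σ ℤ).degreeOf a := by
  classical
  rw [sub_eq_add_neg, MvPolynomial.degreeOf_add_eq_of_degreeOf_lt]
  · simp
  · rw [MvPolynomial.degreeOf_neg, MvPolynomial.degreeOf_X_of_ne h]
    simp

theorem degreeOf_vandermondeProd (j : Fin (n + 1)) :
    n ≤ (vandermondeProd (n + 1)).degreeOf j := by
  classical
  have hne : ∀ i : Fin (n + 1), ∀ i' ∈ Finset.Ioi i,
      (MvPolynomial.X i - MvPolynomial.X i' : MvPolynomial (Fin (n + 1)) ℤ) ≠ 0 := by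
    intro i i' hi h
    have := MvPolynomial.X_injective (sub_eq_zero.1 h)
    simp [this] at hi
  have hne' : ∀ i ∈ (Finset.univ : Finset (Fin (n + 1))), ∏ i' ∈ Finset.Ioi i,
      (MvPolynomial.X i - MvPolynomial.X i' : MvPolynomial (Fin (n + 1)) ℤ) ≠ 0 :=
    fun i _ => Finset.prod_ne_zero_iff.2 (hne i)
  rw [vandermondeProd, MvPolynomial.degreeOf_prod_eq _ _ hne']
  have key : ∀ i : Fin (n + 1), (if i < j then 1 else 0) + (if i = j then n - (j : ℕ) else 0) ≤
      (∏ i' ∈ Finset.Ioi i, (MvPolynomial.X i - MvPolynomial.X i' :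
        MvPolynomial (Fin (n + 1)) ℤ)).degreeOf j := by
    intro i
    rw [MvPolynomial.degreeOf_prod_eq _ _ (hne i)]
    rcases lt_trichotomy i j with h | h | h
    · rw [if_pos h, if_neg h.ne, add_zero]
      refine le_trans ?_ (Finset.single_le_sum
        (f := fun i' => (MvPolynomial.X i - MvPolynomial.X i' :
          MvPolynomial (Fin (n + 1)) ℤ).degreeOf j) (fun _ _ => Nat.zero_le _)
        (Finset.mem_Ioi.2 h))
      change 1 ≤ MvPolynomial.degreeOf j _
      rw [← neg_sub, MvPolynomial.degreeOf_neg]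
      exact one_le_degreeOf_X_sub_X h.ne'
    · subst h
      rw [if_neg (lt_irrefl _), if_pos rfl, zero_add]
      have hc : n - (i : ℕ) = ∑ i' ∈ Finset.Ioi i, 1 := by simp
      rw [hc]
      exact Finset.sum_le_sum fun i' hi' => one_le_degreeOf_X_sub_X (Finset.mem_Ioi.1 hi').ne
    · rw [if_neg h.not_gt, if_neg h.ne']
      exact Nat.zero_le _
  refine le_trans ?_ (Finset.sum_le_sum fun i _ => key i)
  rw [Finset.sum_add_distrib, Finset.sum_ite_eq' Finset.univ j, if_pos (Finset.mem_univ j),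
    ← Finset.card_filter]
  have : (Finset.univ.filter fun i : Fin (n + 1) => i < j) = Finset.Iio j := by
    ext i
    simp
  rw [this, Fin.card_Iio]
  omega

theorem schurExp_le (k : Fin n → ℕ) (i : Fin (n + 1)) : schurExp k i ≤ (∑ i, k i) + n := by
  refine Nat.add_le_add (Finset.sum_le_sum fun m _ => ?_) (Nat.sub_le _ _)
  split_ifs <;> simp

theorem degreeOf_altDet_X_le (m : Fin n → ℕ) (N : ℕ) (hm : ∀ i, m i ≤ N) (j : Fin n) :
    (altDet (MvPolynomial.X : Fin n → MvPolynomial (Fin n) ℤ) m).degreeOf j ≤ N := by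
  rw [altDet, Matrix.det_apply]
  refine (MvPolynomial.degreeOf_sum_le _ _ _).trans (Finset.sup_le fun p _ => ?_)
  have h1 : (∏ i, Matrix.of (fun i j : Fin n =>
      (MvPolynomial.X j : MvPolynomial (Fin n) ℤ) ^ m i) (p i) i).degreeOf j ≤ N := by
    refine (MvPolynomial.degreeOf_prod_le _ _ _).trans ?_
    rw [Finset.sum_eq_single j]
    · simpa using hm (p j)
    · intro i _ hi
      simpa using MvPolynomial.degreeOf_X_pow_of_ne _ hi.symm
    · simp
  rcases Int.units_eq_one_or (Equiv.Perm.sign p) with h | h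
  · rw [h, one_smul]
    exact h1
  · rw [h, Units.neg_smul, one_smul, MvPolynomial.degreeOf_neg]
    exact h1

theorem degreeOf_schurPoly_le (k : Fin n → ℕ) (j : Fin (n + 1)) :
    (schurPoly (n + 1) k).degreeOf j ≤ ∑ i, k i := by
  by_cases h : schurPoly (n + 1) k = 0
  · simp [h]
  have h1 := degreeOf_altDet_X_le (schurExp k) _ (schurExp_le k) j
  rw [← schurNumerator_eq, ← vandermondeProd_mul_schurPoly,
    MvPolynomial.degreeOf_mul_eq (vandermondeProd_ne_zero _) h] at h1
  have h2 := degreeOf_vandermondeProd j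
  omega

end Degree

section SchurExp

variable {n : ℕ}

theorem schurExp_last (k : Fin n → ℕ) : schurExp k (Fin.last n) = 0 := by
  rw [schurExp, Finset.sum_eq_zero]
  · simp
  · intro m _
    rw [if_neg]
    simp [Fin.val_last]

theorem schurExp_castSucc (k : Fin n → ℕ) (i : Fin n) :
    schurExp k i.castSucc = schurExp k i.succ + k i + 1 := by
  have h : ∀ m : Fin n, (if (i.castSucc : ℕ) ≤ (m : ℕ) then k m else 0) =
      (if (i.succ : ℕ) ≤ (m : ℕ) then k m else 0) + if m = i then k m else 0 := by
    intro m
    simp only [Fin.val_castSucc, Fin.val_succ, Fin.ext_iff]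
    rcases lt_trichotomy (m : ℕ) i with h | h | h
    · rw [if_neg (by omega), if_neg (by omega), if_neg (by omega)]
    · rw [if_pos (by omega), if_neg (by omega), if_pos (by omega), zero_add]
    · rw [if_pos (by omega), if_pos (by omega), if_neg (by omega), add_zero]
  rw [schurExp, schurExp, Finset.sum_congr rfl fun m _ => h m, Finset.sum_add_distrib,
    Finset.sum_ite_eq' Finset.univ i, if_pos (Finset.mem_univ i)]
  have := i.2
  simp only [Fin.val_castSucc, Fin.val_succ]
  omega

theorem strictAnti_schurExp (k : Fin n → ℕ) : StrictAnti (schurExp k) :=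
  Fin.strictAnti_iff_succ_lt.2 fun i => by
    rw [schurExp_castSucc]
    omega

theorem schurExp_injective : Function.Injective (schurExp (n := n)) := by
  intro k k' h
  ext i
  have h1 := schurExp_castSucc k i
  have h2 := schurExp_castSucc k' i
  rw [h] at h1
  omega

theorem exists_schurExp_eq {m : Fin (n + 1) → ℕ} (hm : StrictAnti m) (h0 : m (Fin.last n) = 0) :
    ∃ k, schurExp k = m := by
  refine ⟨fun i => m i.castSucc - m i.succ - 1, ?_⟩
  ext i
  induction i using Fin.reverseInduction with
  | last => rw [schurExp_last, h0]
  | cast i ih =>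
    rw [schurExp_castSucc, ih]
    have := Fin.strictAnti_iff_succ_lt.1 hm i
    omega

/-- The weight `∑ i k_i` of a tuple of multiplicities. -/
def schurWeight (k : Fin n → ℕ) : ℕ := ∑ i : Fin n, ((i : ℕ) + 1) * k i

theorem sum_schurExp (k : Fin n → ℕ) :
    ∑ i, schurExp k i = schurWeight k + ∑ i : Fin (n + 1), (i : ℕ) := by
  simp only [schurExp, Finset.sum_add_distrib]
  congr 1
  · rw [Finset.sum_comm, schurWeight]
    refine Finset.sum_congr rfl fun m _ => ?_
    rw [← Finset.sum_filter, Finset.sum_const, smul_eq_mul]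
    congr 1
    have : (Finset.univ.filter fun i : Fin (n + 1) => (i : ℕ) ≤ (m : ℕ)) = Finset.Iic m.castSucc := by
      ext i
      simp [Fin.le_def]
    rw [this, Fin.card_Iic, Fin.val_castSucc]
  · rw [← Equiv.sum_comp Fin.revPerm]
    refine Finset.sum_congr rfl fun i _ => ?_
    simp [Fin.val_rev]
    have := i.2
    omega

/-- The tuples of weight `N`. -/
def weightFiber (n N : ℕ) : Finset (Fin n → ℕ) :=
  (Fintype.piFinset fun _ => Finset.range (N + 1)).filter fun k => schurWeight k = N

theorem mem_weightFiber {N : ℕ} {k : Fin n → ℕ} : k ∈ weightFiber n N ↔ schurWeight k = N := by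
  rw [weightFiber, Finset.mem_filter, Fintype.mem_piFinset, and_iff_right_of_imp]
  rintro rfl i
  rw [Finset.mem_range, Nat.lt_succ_iff, schurWeight]
  refine le_trans ?_ (Finset.single_le_sum (f := fun i : Fin n => ((i : ℕ) + 1) * k i)
    (fun _ _ => Nat.zero_le _) (Finset.mem_univ i))
  exact Nat.le_mul_of_pos_left _ (Nat.succ_pos _)

end SchurExp

section Homogenization

variable {R S : Type*} [CommRing R] [CommRing S] [Algebra R S]

theorem sum_coeff_prod_X_sub_C {ι : Type*} (s : Finset ι) (x : ι → R) (w z : S) :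
    ∑ l ∈ Finset.range (s.card + 1),
      algebraMap R S ((∏ k ∈ s, (X - C (x k))).coeff l) * w ^ l * z ^ (s.card - l) =
    ∏ k ∈ s, (w - algebraMap R S (x k) * z) := by
  classical
  induction s using Finset.induction_on with
  | empty => simp
  | insert a s ha ih =>
    rw [Finset.prod_insert ha, Finset.prod_insert ha, Finset.card_insert_of_notMem ha, ← ih]
    set q := ∏ k ∈ s, (X - C (x k)) with hq
    have hdeg : q.natDegree ≤ s.card := by
      refine (natDegree_prod_le _ _).trans ((Finset.sum_le_sum fun k _ =>
        natDegree_X_sub_C_le (x k)).trans ?_)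
      simp
    have h1 : ∀ l, ((X - C (x a)) * q).coeff l = (X * q).coeff l - x a * q.coeff l := by
      intro l
      rw [sub_mul, coeff_sub, coeff_C_mul]
    simp only [h1, map_sub, map_mul]
    simp only [sub_mul, Finset.sum_sub_distrib]
    congr 1
    · rw [Finset.sum_range_succ']
      simp only [coeff_X_mul, coeff_X_mul_zero, map_zero, zero_mul, add_zero, Finset.mul_sum]
      refine Finset.sum_congr rfl fun l hl => ?_
      rw [pow_succ, Nat.add_sub_add_right]
      ring
    · rw [Finset.sum_range_succ, coeff_eq_zero_of_natDegree_lt (n := s.card + 1) (by omega)]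
      simp only [map_zero, mul_zero, zero_mul, add_zero, Finset.mul_sum]
      refine Finset.sum_congr rfl fun l hl => ?_
      rw [Finset.mem_range] at hl
      rw [Nat.succ_sub (by omega), pow_succ]
      ring

end Homogenization

section Cauchy

variable {R : Type*} [CommRing R] {n : ℕ}

theorem altDet_id (x : Fin (n + 1) → R) :
    altDet x (fun i => (i : ℕ)) = ∏ i, ∏ j ∈ Finset.Ioi i, (x j - x i) := by
  rw [← Matrix.det_vandermonde, ← Matrix.det_transpose]
  rfl

theorem altDet_id_mul (x y : Fin (n + 1) → R) :
    altDet x (fun i => (i : ℕ)) * altDet y (fun i => (i : ℕ)) =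
      altDet x (fun i => n - (i : ℕ)) * altDet y (fun i => n - (i : ℕ)) := by
  rw [altDet_id, altDet_id, altDet_staircase, altDet_staircase]
  simp only [← Finset.prod_mul_distrib]
  refine Finset.prod_congr rfl fun i _ => Finset.prod_congr rfl fun j _ => ?_
  ring

theorem altDet_mul (x : Fin n → R) (c : R) (m : Fin n → ℕ) :
    altDet (fun j => x j * c) m = c ^ (∑ i, m i) * altDet x m := by
  have h : (Matrix.of fun i j : Fin n => (x j * c) ^ m i) =
      Matrix.diagonal (fun i => c ^ m i) * Matrix.of fun i j : Fin n => x j ^ m i := by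
    ext i j
    simp [Matrix.diagonal_mul, mul_pow, mul_comm]
  rw [altDet, h, Matrix.det_mul, Matrix.det_diagonal, Finset.prod_pow_eq_pow_sum]
  rfl

/-- The coefficients of `∏_{k ≠ i} (1 - x_k Z)`. -/
def cauchyCoeff (x : Fin (n + 1) → R) : Matrix (Fin (n + 1)) (Fin (n + 1)) R :=
  Matrix.of fun i m => (∏ k ∈ Finset.univ.erase i, (X - C (x k))).coeff (n - (m : ℕ))

theorem sum_cauchyCoeff {S : Type*} [CommRing S] [Algebra R S] (x : Fin (n + 1) → R)
    (i : Fin (n + 1)) (w z : S) :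
    ∑ m, algebraMap R S (cauchyCoeff x i m) * w ^ (n - (m : ℕ)) * z ^ (m : ℕ) =
      ∏ k ∈ Finset.univ.erase i, (w - algebraMap R S (x k) * z) := by
  have hc : (Finset.univ.erase i).card = n := by simp
  have hs := Fin.sum_univ_eq_sum_range (fun l =>
    algebraMap R S ((∏ k ∈ Finset.univ.erase i, (X - C (x k))).coeff l) * w ^ l * z ^ (n - l)) (n + 1)
  rw [← sum_coeff_prod_X_sub_C, hc, ← hs, ← Equiv.sum_comp Fin.revPerm]
  refine Finset.sum_congr rfl fun m _ => ?_
  have h1 : ((Fin.revPerm m : Fin (n + 1)) : ℕ) = n - m := by simp [Fin.val_rev]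
  have h2 : n - (n - (m : ℕ)) = m := by have := m.2; omega
  rw [cauchyCoeff, Matrix.of_apply, h1, h2]

theorem det_cauchyCoeff_mul (x : Fin (n + 1) → R) :
    (cauchyCoeff x).det * altDet x (fun i => n - (i : ℕ)) =
      altDet x (fun i => (i : ℕ)) * altDet x (fun i => n - (i : ℕ)) := by
  have h : cauchyCoeff x * (Matrix.of fun i j : Fin (n + 1) => x j ^ (n - (i : ℕ))) =
      Matrix.diagonal fun i => ∏ k ∈ Finset.univ.erase i, (x i - x k) := by
    ext i j
    have := sum_cauchyCoeff x i (x j) (1 : R)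
    simp only [Algebra.algebraMap_self, RingHom.id_apply, one_pow, mul_one] at this
    rw [Matrix.mul_apply, Matrix.diagonal_apply]
    simp only [Matrix.of_apply]
    rw [this]
    split_ifs with hij
    · rw [hij]
    · exact Finset.prod_eq_zero (Finset.mem_erase.2 ⟨Ne.symm hij, Finset.mem_univ j⟩) (sub_self _)
  rw [altDet, ← Matrix.det_mul, h, Matrix.det_diagonal, ← altDet, altDet_id, altDet_staircase]
  have h2 : ∀ i : Fin (n + 1), ∏ k ∈ Finset.univ.erase i, (x i - x k) =
      (∏ k ∈ Finset.Iio i, (x i - x k)) * ∏ k ∈ Finset.Ioi i, (x i - x k) := by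
    intro i
    rw [← Finset.prod_union]
    · refine Finset.prod_congr ?_ fun _ _ => rfl
      ext k
      simp [lt_or_lt_iff_ne]
    · rw [Finset.disjoint_left]
      intro k hk hk'
      exact lt_asymm (Finset.mem_Iio.1 hk) (Finset.mem_Ioi.1 hk')
  rw [Finset.prod_congr rfl fun i _ => h2 i, Finset.prod_mul_distrib]
  congr 1
  exact Finset.prod_comm' (by simp)

/-- The matrix `(1 - x_i y_j T)⁻¹` of power series. -/
def cauchyMat (x y : Fin (n + 1) → R) : Matrix (Fin (n + 1)) (Fin (n + 1)) (PowerSeries R) :=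
  Matrix.of fun i j => PowerSeries.mk fun N => (x i * y j) ^ N

theorem mk_pow_mul_one_sub (a : R) :
    (PowerSeries.mk fun N => a ^ N) * (1 - PowerSeries.C a * PowerSeries.X) = 1 := by
  ext N
  rcases N with _ | N
  · simp
  · rw [mul_sub, mul_one, ← mul_assoc, map_sub, PowerSeries.coeff_succ_mul_X, mul_comm,
      PowerSeries.coeff_C_mul]
    simp [pow_succ']

theorem det_cauchyMat_mul [IsDomain R] {x : Fin (n + 1) → R}
    (hx : altDet x (fun i => n - (i : ℕ)) ≠ 0) (y : Fin (n + 1) → R) :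
    (cauchyMat x y).det * ∏ j, ∏ i, (1 - PowerSeries.C (x i * y j) * PowerSeries.X) =
      PowerSeries.C (altDet x (fun i => n - (i : ℕ)) * altDet y (fun i => n - (i : ℕ))) *
        PowerSeries.X ^ (∑ i : Fin (n + 1), (i : ℕ)) := by
  have hdet : (cauchyCoeff x).det = altDet x (fun i => (i : ℕ)) :=
    mul_right_cancel₀ hx (det_cauchyCoeff_mul x)
  have h : cauchyMat x y * Matrix.diagonal
      (fun j => ∏ i, (1 - PowerSeries.C (x i * y j) * PowerSeries.X)) =
      (cauchyCoeff x).map (algebraMap R (PowerSeries R)) *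
        Matrix.of fun i j : Fin (n + 1) =>
          (PowerSeries.C (y j) * PowerSeries.X : PowerSeries R) ^ (i : ℕ) := by
    ext1 i j
    rw [Matrix.mul_diagonal, Matrix.mul_apply]
    have := sum_cauchyCoeff x i (1 : PowerSeries R) (PowerSeries.C (y j) * PowerSeries.X)
    simp only [one_pow, mul_one] at this
    simp only [Matrix.map_apply, Matrix.of_apply]
    rw [this, cauchyMat, Matrix.of_apply, ← Finset.mul_prod_erase _ _ (Finset.mem_univ i),
      ← mul_assoc, mk_pow_mul_one_sub, one_mul]
    refine Finset.prod_congr rfl fun k _ => ?_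
    rw [map_mul, mul_assoc]
    rfl
  have h2 := congrArg Matrix.det h
  rw [Matrix.det_mul, Matrix.det_diagonal, Matrix.det_mul, ← RingHom.mapMatrix_apply,
    ← RingHom.map_det, hdet] at h2
  rw [h2]
  change _ * altDet (fun j => PowerSeries.C (y j) * PowerSeries.X) _ = _
  rw [altDet_mul, ← map_altDet, ← altDet_id_mul, map_mul]
  change PowerSeries.C _ * _ = _
  ring

end Cauchy

section CauchyBinet

variable {R S : Type*} [CommRing R] [CommRing S] {n : ℕ}

theorem altDet_comp_perm (x : Fin n → R) (m : Fin n → ℕ) (p : Equiv.Perm (Fin n)) :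
    altDet x (fun i => m (p i)) = ((Equiv.Perm.sign p : ℤ) : R) * altDet x m :=
  Matrix.det_permute p (Matrix.of fun i j : Fin n => x j ^ m i)

theorem altDet_eq_zero_of_not_injective (x : Fin n → R) {m : Fin n → ℕ}
    (hm : ¬ Function.Injective m) : altDet x m = 0 := by
  simp only [Function.Injective, not_forall] at hm
  obtain ⟨i, j, h, hij⟩ := hm
  exact Matrix.det_zero_of_row_eq hij (by ext l; simp [h])

theorem altDet_eq_sum (x : Fin n → R) (m : Fin n → ℕ) :
    altDet x m = ∑ p : Equiv.Perm (Fin n), ((Equiv.Perm.sign p : ℤ) : R) * ∏ i, x (p i) ^ m i := by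
  rw [altDet, ← Matrix.det_transpose, Matrix.det_apply']
  rfl

theorem altDet_eq_sum' (x : Fin n → R) (m : Fin n → ℕ) :
    altDet x m = ∑ p : Equiv.Perm (Fin n), ((Equiv.Perm.sign p : ℤ) : R) * ∏ i, x i ^ m (p i) := by
  rw [altDet, Matrix.det_apply']
  rfl

/-- The strictly decreasing exponent sequences with sum `N`. -/
def antiFiber (n N : ℕ) : Finset (Fin n → ℕ) := by
  classical
  exact (Finset.piAntidiag Finset.univ N).filter StrictAnti

theorem mem_antiFiber {N : ℕ} {m : Fin n → ℕ} :
    m ∈ antiFiber n N ↔ ∑ i, m i = N ∧ StrictAnti m := by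
  simp [antiFiber, Finset.mem_piAntidiag]

theorem coeff_det_cauchyMat_aux (x y : Fin (n + 1) → R) (N : ℕ) :
    PowerSeries.coeff N (cauchyMat x y).det =
      ∑ l ∈ Finset.piAntidiag Finset.univ N, (∏ i, y i ^ l i) * altDet x l := by
  have h1 : ∀ p : Equiv.Perm (Fin (n + 1)),
      PowerSeries.coeff N (∏ i, cauchyMat x y (p i) i) =
        ∑ l ∈ Finset.piAntidiag Finset.univ N, (∏ i, y i ^ l i) * ∏ i, x (p i) ^ l i := by
    intro p
    rw [PowerSeries.coeff_prod]
    refine Finset.sum_nbij' (fun l => ⇑l) (fun l => Finsupp.equivFunOnFinite.symm l) ?_ ?_ ?_ ?_ ?_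
    · intro l hl
      simpa [Finset.mem_piAntidiag] using (Finset.mem_finsuppAntidiag.1 hl).1
    · intro l hl
      simpa [Finset.mem_finsuppAntidiag] using (Finset.mem_piAntidiag.1 hl).1
    · intro l _
      ext i
      simp
    · intro l _
      ext i
      simp
    · intro l _
      rw [← Finset.prod_mul_distrib]
      refine Finset.prod_congr rfl fun i _ => ?_
      rw [cauchyMat, Matrix.of_apply, PowerSeries.coeff_mk, mul_pow, mul_comm]
  rw [Matrix.det_apply', map_sum]
  have h2 : ∀ p : Equiv.Perm (Fin (n + 1)), PowerSeries.coeff N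
      (((Equiv.Perm.sign p : ℤ) : PowerSeries R) * ∏ i, cauchyMat x y (p i) i) =
      ((Equiv.Perm.sign p : ℤ) : R) *
        ∑ l ∈ Finset.piAntidiag Finset.univ N, (∏ i, y i ^ l i) * ∏ i, x (p i) ^ l i := by
    intro p
    rw [← h1, ← PowerSeries.coeff_C_mul, map_intCast]
  rw [Finset.sum_congr rfl fun p _ => h2 p]
  simp only [Finset.mul_sum]
  rw [Finset.sum_comm]
  refine Finset.sum_congr rfl fun l _ => ?_
  rw [altDet_eq_sum, Finset.mul_sum]
  refine Finset.sum_congr rfl fun p _ => ?_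
  ring

theorem StrictAnti.comp_perm_inj {m m' : Fin n → ℕ} (hm : StrictAnti m) (hm' : StrictAnti m')
    {p p' : Equiv.Perm (Fin n)} (h : (fun i => m (p i)) = fun i => m' (p' i)) :
    m = m' ∧ p = p' := by
  have h1 : ∀ i, m i = m' (p' (p.symm i)) := fun i => by
    have := congrFun h (p.symm i)
    simpa using this
  have hmono : StrictMono fun i => p' (p.symm i) := by
    intro i j hij
    have := hm hij
    rw [h1 i, h1 j] at this
    exact hm'.lt_iff_gt.1 this
  have hid : (fun i => p' (p.symm i)) = id := by
    apply (StrictMono.range_inj hmono strictMono_id).1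
    rw [Set.range_id]
    exact (p.symm.trans p').surjective.range_eq
  have h2 : ∀ i, p' (p.symm i) = i := congrFun hid
  refine ⟨funext fun i => by rw [h1, h2], Equiv.ext fun i => ?_⟩
  have := h2 (p i)
  simpa using this.symm

theorem coeff_det_cauchyMat (x y : Fin (n + 1) → R) (N : ℕ) :
    PowerSeries.coeff N (cauchyMat x y).det =
      ∑ m ∈ antiFiber (n + 1) N, altDet x m * altDet y m := by
  classical
  rw [coeff_det_cauchyMat_aux, ← Finset.sum_filter_of_ne (p := Function.Injective)]
  swap
  · intro l _ h
    by_contra hl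
    exact h (by rw [altDet_eq_zero_of_not_injective x hl, mul_zero])
  have h1 : ∀ m ∈ antiFiber (n + 1) N, altDet x m * altDet y m =
      ∑ p : Equiv.Perm (Fin (n + 1)), (∏ i, y i ^ m (p i)) * altDet x (fun i => m (p i)) := by
    intro m _
    rw [altDet_eq_sum' y, Finset.mul_sum]
    refine Finset.sum_congr rfl fun p _ => ?_
    rw [altDet_comp_perm]
    ring
  rw [Finset.sum_congr rfl h1, ← Finset.sum_product']
  symm
  refine Finset.sum_nbij (fun q => fun i => q.1 (q.2 i)) ?_ ?_ ?_ ?_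
  · rintro ⟨m, p⟩ h
    obtain ⟨h2, h3⟩ := mem_antiFiber.1 (Finset.mem_product.1 h).1
    rw [Finset.mem_filter, Finset.mem_piAntidiag]
    refine ⟨⟨?_, by simp⟩, h3.injective.comp p.injective⟩
    rw [← h2]
    exact Equiv.sum_comp p m
  · rintro ⟨m, p⟩ h ⟨m', p'⟩ h' heq
    have h2 := (mem_antiFiber.1 (Finset.mem_product.1 h).1).2
    have h3 := (mem_antiFiber.1 (Finset.mem_product.1 h').1).2
    obtain ⟨h4, h5⟩ := h2.comp_perm_inj h3 heq
    rw [Prod.mk.injEq]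
    exact ⟨h4, h5⟩
  · intro l hl
    rw [Finset.mem_coe, Finset.mem_filter, Finset.mem_piAntidiag] at hl
    obtain ⟨⟨h2, -⟩, h3⟩ := hl
    set s := Tuple.sort (fun i => OrderDual.toDual (l i)) with hs
    have h4 : Antitone (fun i => l (s i)) :=
      fun i j hij => Tuple.monotone_sort (fun i => OrderDual.toDual (l i)) hij
    have h5 : StrictAnti (fun i => l (s i)) :=
      h4.strictAnti_of_injective (h3.comp s.injective)
    refine ⟨(fun i => l (s i), s.symm), ?_, ?_⟩
    · rw [Finset.mem_coe, Finset.mem_product, mem_antiFiber]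
      refine ⟨⟨?_, h5⟩, Finset.mem_univ _⟩
      rw [← h2]
      exact Equiv.sum_comp s l
    · ext i
      simp
  · intro q _
    rfl

theorem altDet_add (x : Fin n → R) (m : Fin n → ℕ) (c : ℕ) :
    altDet x (fun i => m i + c) = (∏ i, x i) ^ c * altDet x m := by
  have h : (Matrix.of fun i j : Fin n => x j ^ (m i + c)) =
      (Matrix.of fun i j : Fin n => x j ^ m i) * Matrix.diagonal fun j => x j ^ c := by
    ext i j
    simp [Matrix.mul_diagonal, pow_add]
  rw [altDet, h, Matrix.det_mul, Matrix.det_diagonal, Finset.prod_pow, mul_comm]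
  rfl

theorem sum_antiFiber_pos (x y : Fin (n + 1) → R) (N : ℕ) :
    ∑ m ∈ (antiFiber (n + 1) N).filter (fun m => m (Fin.last n) ≠ 0), altDet x m * altDet y m =
      PowerSeries.coeff N (PowerSeries.C ((∏ i, x i) * ∏ i, y i) *
        (PowerSeries.X ^ (n + 1) * (cauchyMat x y).det)) := by
  rw [PowerSeries.coeff_C_mul, PowerSeries.coeff_X_pow_mul']
  have hpos : ∀ m ∈ (antiFiber (n + 1) N).filter (fun m => m (Fin.last n) ≠ 0), ∀ i, 1 ≤ m i := by
    intro m hm i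
    rw [Finset.mem_filter, mem_antiFiber] at hm
    have := hm.1.2.antitone (Fin.le_last i)
    have := hm.2
    omega
  split_ifs with hN
  · rw [coeff_det_cauchyMat, Finset.mul_sum]
    symm
    refine Finset.sum_nbij (fun m i => m i + 1) ?_ ?_ ?_ ?_
    · intro m hm
      rw [mem_antiFiber] at hm
      rw [Finset.mem_filter, mem_antiFiber]
      refine ⟨⟨?_, fun i j hij => Nat.add_lt_add_right (hm.2 hij) 1⟩, by simp⟩
      rw [Finset.sum_add_distrib, hm.1]
      simp
      omega
    · intro m _ m' _ h
      ext i
      have := congrFun h i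
      simpa using this
    · intro m hm
      have h1 := hpos m hm
      rw [Finset.mem_coe, Finset.mem_filter, mem_antiFiber] at hm
      refine ⟨fun i => m i - 1, ?_, ?_⟩
      · rw [Finset.mem_coe, mem_antiFiber]
        constructor
        · have h2 : ∑ i, (m i - 1) + ∑ i : Fin (n + 1), 1 = N := by
            rw [← Finset.sum_add_distrib, ← hm.1.1]
            exact Finset.sum_congr rfl fun i _ => Nat.sub_add_cancel (h1 i)
          simp at h2
          omega
        · intro i j hij
          have := hm.1.2 hij
          have := h1 j
          change m j - 1 < m i - 1
          omega
      · ext i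
        exact Nat.sub_add_cancel (h1 i)
    · intro m _
      rw [altDet_add, altDet_add]
      ring
  · rw [mul_zero]
    apply Finset.sum_eq_zero
    intro m hm
    exfalso
    apply hN
    have h1 := hpos m hm
    rw [Finset.mem_filter, mem_antiFiber] at hm
    rw [← hm.1.1]
    calc n + 1 = ∑ i : Fin (n + 1), 1 := by simp
      _ ≤ _ := Finset.sum_le_sum fun i _ => h1 i

theorem sum_antiFiber_zero (x y : Fin (n + 1) → R) (N : ℕ) :
    ∑ m ∈ (antiFiber (n + 1) N).filter (fun m => ¬ m (Fin.last n) ≠ 0), altDet x m * altDet y m =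
      PowerSeries.coeff N (PowerSeries.X ^ (∑ i : Fin (n + 1), (i : ℕ)) *
        PowerSeries.mk fun N => ∑ k ∈ weightFiber n N,
          altDet x (schurExp k) * altDet y (schurExp k)) := by
  rw [PowerSeries.coeff_X_pow_mul']
  split_ifs with hN
  · rw [PowerSeries.coeff_mk]
    symm
    refine Finset.sum_nbij schurExp ?_ (schurExp_injective.injOn) ?_ fun _ _ => rfl
    · intro k hk
      rw [mem_weightFiber] at hk
      rw [Finset.mem_filter, mem_antiFiber]
      refine ⟨⟨?_, strictAnti_schurExp k⟩, by simp [schurExp_last]⟩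
      rw [sum_schurExp, hk]
      omega
    · intro m hm
      rw [Finset.mem_coe, Finset.mem_filter, mem_antiFiber] at hm
      obtain ⟨k, rfl⟩ := exists_schurExp_eq hm.1.2 (by simpa using hm.2)
      refine ⟨k, ?_, rfl⟩
      rw [Finset.mem_coe, mem_weightFiber]
      have := hm.1.1
      rw [sum_schurExp] at this
      omega
  · apply Finset.sum_eq_zero
    intro m hm
    exfalso
    rw [Finset.mem_filter, mem_antiFiber] at hm
    obtain ⟨k, rfl⟩ := exists_schurExp_eq hm.1.2 (by simpa using hm.2)
    apply hN
    rw [← hm.1.1, sum_schurExp]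
    exact Nat.le_add_left _ _

theorem det_cauchyMat_mul_one_sub (x y : Fin (n + 1) → R) :
    (cauchyMat x y).det * (1 - PowerSeries.C ((∏ i, x i) * ∏ i, y i) * PowerSeries.X ^ (n + 1)) =
      PowerSeries.X ^ (∑ i : Fin (n + 1), (i : ℕ)) *
        PowerSeries.mk fun N => ∑ k ∈ weightFiber n N,
          altDet x (schurExp k) * altDet y (schurExp k) := by
  classical
  have h : (cauchyMat x y).det = PowerSeries.C ((∏ i, x i) * ∏ i, y i) *
        (PowerSeries.X ^ (n + 1) * (cauchyMat x y).det) +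
      PowerSeries.X ^ (∑ i : Fin (n + 1), (i : ℕ)) *
        PowerSeries.mk fun N => ∑ k ∈ weightFiber n N,
          altDet x (schurExp k) * altDet y (schurExp k) := by
    ext N
    rw [map_add, ← sum_antiFiber_pos, ← sum_antiFiber_zero, coeff_det_cauchyMat,
      Finset.sum_filter_add_sum_filter_not]
  rw [mul_sub, mul_one]
  nth_rewrite 1 [h]
  ring

/-- The series `∑_k S_k(x) S_k(y) T ^ |k|`. -/
def schurSeries (x y : Fin (n + 1) → R) : PowerSeries R :=
  PowerSeries.mk fun N => ∑ k ∈ weightFiber n N,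
    MvPolynomial.aeval x (schurPoly (n + 1) k) * MvPolynomial.aeval y (schurPoly (n + 1) k)

theorem schurSeries_mul_of_ne_zero [IsDomain R] {x y : Fin (n + 1) → R}
    (hx : altDet x (fun i => n - (i : ℕ)) ≠ 0) (hy : altDet y (fun i => n - (i : ℕ)) ≠ 0) :
    schurSeries x y * ∏ j, ∏ i, (1 - PowerSeries.C (x i * y j) * PowerSeries.X) =
      1 - PowerSeries.C ((∏ i, x i) * ∏ i, y i) * PowerSeries.X ^ (n + 1) := by
  have h1 := det_cauchyMat_mul hx y
  have h2 := det_cauchyMat_mul_one_sub x y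
  have h3 : (PowerSeries.mk fun N => ∑ k ∈ weightFiber n N,
      altDet x (schurExp k) * altDet y (schurExp k)) =
      PowerSeries.C (altDet x (fun i => n - (i : ℕ)) * altDet y (fun i => n - (i : ℕ))) *
        schurSeries x y := by
    ext N
    rw [PowerSeries.coeff_C_mul, schurSeries, PowerSeries.coeff_mk, PowerSeries.coeff_mk,
      Finset.mul_sum]
    refine Finset.sum_congr rfl fun k _ => ?_
    rw [altDet_eq_schur_mul, altDet_eq_schur_mul]
    ring
  rw [h3] at h2
  have hX : (PowerSeries.X : PowerSeries R) ^ (∑ i : Fin (n + 1), (i : ℕ)) ≠ 0 :=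
    pow_ne_zero _ PowerSeries.X_ne_zero
  have hC : PowerSeries.C (altDet x (fun i => n - (i : ℕ)) * altDet y (fun i => n - (i : ℕ))) ≠ 0 := by
    rw [Ne, map_eq_zero_iff _ PowerSeries.C_injective]
    exact mul_ne_zero hx hy
  apply mul_left_cancel₀ (mul_ne_zero hC hX)
  calc _ = (PowerSeries.X ^ (∑ i : Fin (n + 1), (i : ℕ)) * (PowerSeries.C (altDet x
          (fun i => n - (i : ℕ)) * altDet y (fun i => n - (i : ℕ))) * schurSeries x y)) *
          ∏ j, ∏ i, (1 - PowerSeries.C (x i * y j) * PowerSeries.X) := by ring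
    _ = ((cauchyMat x y).det * ∏ j, ∏ i, (1 - PowerSeries.C (x i * y j) * PowerSeries.X)) *
        (1 - PowerSeries.C ((∏ i, x i) * ∏ i, y i) * PowerSeries.X ^ (n + 1)) := by
        rw [← h2]
        ring
    _ = _ := by rw [h1]

theorem map_schurSeries (g : R →+* S) (x y : Fin (n + 1) → R) :
    PowerSeries.map g (schurSeries x y) = schurSeries (fun i => g (x i)) (fun i => g (y i)) := by
  ext N
  rw [PowerSeries.coeff_map, schurSeries, schurSeries, PowerSeries.coeff_mk, PowerSeries.coeff_mk,
    map_sum]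
  have h : ∀ (z : Fin (n + 1) → R) (p : MvPolynomial (Fin (n + 1)) ℤ),
      g (MvPolynomial.aeval z p) = MvPolynomial.aeval (fun i => g (z i)) p := by
    intro z p
    rw [MvPolynomial.aeval_def, MvPolynomial.aeval_def, MvPolynomial.eval₂_comp_left]
    congr 1
    exact RingHom.ext_int _ _
  refine Finset.sum_congr rfl fun k _ => ?_
  rw [map_mul, h, h]

/-- The Cauchy identity for Schur polynomials, with the full columns split off. -/
theorem schurSeries_mul (x y : Fin (n + 1) → R) :
    schurSeries x y * ∏ j, ∏ i, (1 - PowerSeries.C (x i * y j) * PowerSeries.X) =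
      1 - PowerSeries.C ((∏ i, x i) * ∏ i, y i) * PowerSeries.X ^ (n + 1) := by
  let A := MvPolynomial (Fin (n + 1) ⊕ Fin (n + 1)) ℤ
  let u : Fin (n + 1) → A := fun i => MvPolynomial.X (Sum.inl i)
  let v : Fin (n + 1) → A := fun i => MvPolynomial.X (Sum.inr i)
  have hne : ∀ w : Fin (n + 1) → A, Function.Injective w →
      altDet w (fun i => n - (i : ℕ)) ≠ 0 := by
    intro w hw
    rw [altDet_staircase, Finset.prod_ne_zero_iff]
    intro i _
    rw [Finset.prod_ne_zero_iff]
    intro j hj h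
    have := hw (sub_eq_zero.1 h)
    simp [this] at hj
  have hu : Function.Injective u := fun i j h => Sum.inl_injective (MvPolynomial.X_injective h)
  have hv : Function.Injective v := fun i j h => Sum.inr_injective (MvPolynomial.X_injective h)
  have h := congrArg (PowerSeries.map (MvPolynomial.aeval (Sum.elim x y) : A →ₐ[ℤ] R).toRingHom)
    (schurSeries_mul_of_ne_zero (hne u hu) (hne v hv))
  simpa [map_schurSeries, map_prod, u, v] using h

end CauchyBinet

section TwistedOperators

variable {F L : Type*} [Field F] [Fintype F] [Field L] [Algebra F L] {r : ℕ}

/-- The operator `x ↦ ∑ κ_i x ^ (q ^ i)`. -/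
def twistOp (F : Type*) [Field F] [Fintype F] {L : Type*} [Field L] [Algebra F L] {r : ℕ}
    (κ : Fin (r + 1) → L) : Module.End F L :=
  ∑ i : Fin (r + 1), LinearMap.mulLeft F (κ i) *
    (FiniteField.frobeniusAlgHom F L).toLinearMap ^ (i : ℕ)

/-- The polynomial `∑ κ_i Y ^ (q ^ i)`. -/
def twistPoly (F : Type*) [Fintype F] {L : Type*} [Field L] {r : ℕ} (κ : Fin (r + 1) → L) : L[X] :=
  ∑ i : Fin (r + 1), C (κ i) * X ^ (Fintype.card F ^ (i : ℕ))

theorem frobeniusAlgHom_pow_apply (i : ℕ) (y : L) :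
    ((FiniteField.frobeniusAlgHom F L).toLinearMap ^ i) y = y ^ (Fintype.card F ^ i) := by
  induction i generalizing y with
  | zero => simp
  | succ i ih =>
    rw [pow_succ', Module.End.mul_apply, ih]
    simp [pow_succ, pow_mul]

theorem twistOp_apply (κ : Fin (r + 1) → L) (x : L) :
    twistOp F κ x = ∑ i : Fin (r + 1), κ i * x ^ (Fintype.card F ^ (i : ℕ)) := by
  simp [twistOp, LinearMap.sum_apply, frobeniusAlgHom_pow_apply]

theorem eval_twistPoly (κ : Fin (r + 1) → L) (x : L) :
    (twistPoly F κ).eval x = twistOp F κ x := by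
  simp [twistPoly, twistOp_apply, eval_finsetSum]

omit [Algebra F L] in
theorem natDegree_twistPoly {κ : Fin (r + 1) → L} (hκ : κ (Fin.last r) ≠ 0) :
    (twistPoly F κ).natDegree = Fintype.card F ^ r := by
  have hq : 1 < Fintype.card F := Fintype.one_lt_card
  rw [twistPoly, Fin.sum_univ_castSucc, natDegree_add_eq_right_of_natDegree_lt]
  · rw [natDegree_C_mul_X_pow _ _ hκ, Fin.val_last]
  · rw [natDegree_C_mul_X_pow _ _ hκ, Fin.val_last]
    refine lt_of_le_of_lt (natDegree_sum_le_of_forall_le (n := Fintype.card F ^ r - 1) _ _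
      fun i _ => ?_) ?_
    · refine (natDegree_C_mul_X_pow_le _ _).trans ?_
      have : Fintype.card F ^ ((Fin.castSucc i : Fin (r + 1)) : ℕ) < Fintype.card F ^ r :=
        Nat.pow_lt_pow_right hq i.2
      omega
    · have : 0 < Fintype.card F ^ r := Nat.pow_pos (by omega)
      omega

theorem derivative_twistPoly (κ : Fin (r + 1) → L) :
    derivative (twistPoly F κ) = C (κ 0) := by
  have hq : ((Fintype.card F : ℕ) : L) = 0 := by
    rw [← map_natCast (algebraMap F L), FiniteField.cast_card_eq_zero, map_zero]
  rw [twistPoly, derivative_sum, Fin.sum_univ_succ, Finset.sum_eq_zero]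
  · simp
  · intro i _
    simp [derivative_X_pow, hq]

/-- The polynomial whose evaluation is the operator `g (D)`, for `D = ∑ κ_i τ ^ i`. -/
def twistAeval (κ : Fin (r + 1) → L) (g : F[X]) : L[X] :=
  ∑ m ∈ Finset.range (g.natDegree + 1), C (algebraMap F L (g.coeff m)) * (twistPoly F κ).comp^[m] X

theorem eval_comp_iterate (κ : Fin (r + 1) → L) (m : ℕ) (x : L) :
    ((twistPoly F κ).comp^[m] X).eval x = (twistOp F κ ^ m) x := by
  induction m with
  | zero => simp
  | succ m ih =>
    rw [Function.iterate_succ_apply', eval_comp, ih, eval_twistPoly, pow_succ',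
      Module.End.mul_apply]

theorem eval_twistAeval (κ : Fin (r + 1) → L) (g : F[X]) (x : L) :
    (twistAeval κ g).eval x = aeval (twistOp F κ) g x := by
  rw [twistAeval, eval_finsetSum, aeval_eq_sum_range, LinearMap.sum_apply]
  refine Finset.sum_congr rfl fun m _ => ?_
  rw [eval_mul, eval_C, eval_comp_iterate, LinearMap.smul_apply, Algebra.smul_def]

omit [Algebra F L] in
theorem natDegree_comp_iterate {κ : Fin (r + 1) → L} (hκ : κ (Fin.last r) ≠ 0) (m : ℕ) :
    ((twistPoly F κ).comp^[m] X).natDegree = (Fintype.card F ^ r) ^ m := by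
  rw [natDegree_iterate_comp, natDegree_X, mul_one, natDegree_twistPoly hκ]

theorem natDegree_twistAeval (hr : r ≠ 0) {κ : Fin (r + 1) → L} (hκ : κ (Fin.last r) ≠ 0)
    {g : F[X]} (hg : g ≠ 0) :
    (twistAeval κ g).natDegree = Fintype.card F ^ (r * g.natDegree) := by
  have hq : 1 < Fintype.card F ^ r := Nat.one_lt_pow hr Fintype.one_lt_card
  have hlead : algebraMap F L (g.coeff g.natDegree) ≠ 0 := by
    rw [Ne, map_eq_zero]
    exact leadingCoeff_ne_zero.2 hg
  rw [pow_mul, twistAeval, Finset.sum_range_succ, natDegree_add_eq_right_of_natDegree_lt]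
  · rw [natDegree_C_mul hlead, natDegree_comp_iterate hκ]
  · rw [natDegree_C_mul hlead, natDegree_comp_iterate hκ]
    refine lt_of_le_of_lt (natDegree_sum_le_of_forall_le
      (n := (Fintype.card F ^ r) ^ g.natDegree - 1) _ _ fun i hi => ?_) ?_
    · refine (natDegree_C_mul_le _ _).trans ?_
      rw [natDegree_comp_iterate hκ]
      have := Nat.pow_lt_pow_right hq (Finset.mem_range.1 hi)
      omega
    · have : 0 < (Fintype.card F ^ r) ^ g.natDegree := Nat.pow_pos (by omega)
      omega

theorem derivative_comp_iterate (κ : Fin (r + 1) → L) (m : ℕ) :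
    derivative ((twistPoly F κ).comp^[m] X) = C (κ 0 ^ m) := by
  induction m with
  | zero => simp
  | succ m ih =>
    rw [Function.iterate_succ_apply', derivative_comp, ih, derivative_twistPoly, C_comp, ← C_mul,
      pow_succ]

theorem derivative_twistAeval (κ : Fin (r + 1) → L) (g : F[X]) :
    derivative (twistAeval κ g) = C (aeval (κ 0) g) := by
  rw [twistAeval, derivative_sum, aeval_eq_sum_range, map_sum]
  refine Finset.sum_congr rfl fun m _ => ?_
  rw [derivative_C_mul, derivative_comp_iterate, ← C_mul, Algebra.smul_def]

/-- The kernel of `g (D)`. -/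
def twistKer (κ : Fin (r + 1) → L) (g : F[X]) : Submodule F L :=
  LinearMap.ker (aeval (twistOp F κ) g)

theorem mem_twistKer {κ : Fin (r + 1) → L} {g : F[X]} {x : L} :
    x ∈ twistKer κ g ↔ aeval (twistOp F κ) g x = 0 := LinearMap.mem_ker

theorem twistAeval_ne_zero {κ : Fin (r + 1) → L} {g : F[X]} (h0 : aeval (κ 0) g ≠ 0) :
    twistAeval κ g ≠ 0 := by
  intro h
  have := derivative_twistAeval κ g
  rw [h, derivative_zero] at this
  exact h0 (C_eq_zero.1 this.symm)

theorem natCard_twistKer [IsAlgClosed L] (hr : r ≠ 0) {κ : Fin (r + 1) → L}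
    (hκ : κ (Fin.last r) ≠ 0) {g : F[X]} (h0 : aeval (κ 0) g ≠ 0) :
    Nat.card (twistKer κ g) = Fintype.card F ^ (r * g.natDegree) := by
  have hg : g ≠ 0 := by
    rintro rfl
    simp at h0
  have hne := twistAeval_ne_zero h0
  have hsep : (twistAeval κ g).Separable := by
    rw [Polynomial.Separable, derivative_twistAeval]
    refine ⟨0, C (aeval (κ 0) g)⁻¹, ?_⟩
    rw [zero_mul, zero_add, ← C_mul, inv_mul_cancel₀ h0, C_1]
  have hset : (twistKer κ g : Set L) = (twistAeval κ g).rootSet L := by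
    ext x
    rw [mem_rootSet, SetLike.mem_coe, mem_twistKer, ← eval_twistAeval, coe_aeval_eq_eval]
    exact (and_iff_right hne).symm
  have h1 : Nat.card (twistKer κ g) = Nat.card ((twistAeval κ g).rootSet L) := by
    rw [← hset]
    rfl
  rw [h1, Nat.card_eq_fintype_card, card_rootSet_eq_natDegree hsep (IsAlgClosed.splits _),
    natDegree_twistAeval hr hκ hg]

theorem finite_twistKer [IsAlgClosed L] (hr : r ≠ 0) {κ : Fin (r + 1) → L}
    (hκ : κ (Fin.last r) ≠ 0) {g : F[X]} (h0 : aeval (κ 0) g ≠ 0) :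
    Finite (twistKer κ g) := by
  apply Nat.finite_of_card_ne_zero
  rw [natCard_twistKer hr hκ h0]
  exact pow_ne_zero _ Fintype.card_ne_zero

theorem finrank_twistKer [IsAlgClosed L] (hr : r ≠ 0) {κ : Fin (r + 1) → L}
    (hκ : κ (Fin.last r) ≠ 0) {g : F[X]} (h0 : aeval (κ 0) g ≠ 0) :
    Module.finrank F (twistKer κ g) = r * g.natDegree := by
  have := finite_twistKer hr hκ h0
  have h1 := natCard_twistKer hr hκ h0
  have h2 : Module.Finite F (twistKer κ g) := Module.Finite.of_finite
  rw [Module.natCard_eq_pow_finrank (K := F), Nat.card_eq_fintype_card] at h1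
  exact Nat.pow_right_injective Fintype.one_lt_card h1

theorem aeval_twistOp_surjective [IsAlgClosed L] (hr : r ≠ 0) {κ : Fin (r + 1) → L}
    (hκ : κ (Fin.last r) ≠ 0) {g : F[X]} (hg : g ≠ 0) :
    Function.Surjective (aeval (twistOp F κ) g) := by
  intro y
  have hpos : 0 < Fintype.card F ^ (r * g.natDegree) := Nat.pow_pos Fintype.card_pos
  obtain ⟨x, hx⟩ := IsAlgClosed.exists_root (twistAeval κ g - C y) (by
    intro h
    have h1 := natDegree_eq_zero_iff_degree_le_zero.2 h.le
    rw [natDegree_sub_C, natDegree_twistAeval hr hκ hg] at h1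
    omega)
  refine ⟨x, ?_⟩
  rw [IsRoot, eval_sub, eval_C, eval_twistAeval] at hx
  exact sub_eq_zero.1 hx

end TwistedOperators

section CoefficientFrobenius

variable (F : Type*) [Field F] [Fintype F] {L : Type*} [Field L] [Algebra F L]

/-- The `q`-Frobenius on the coefficients of a polynomial. -/
def coeffFrob : L[X] →+* L[X] := mapRingHom (FiniteField.frobeniusAlgHom F L).toRingHom

theorem coeff_coeffFrob (p : L[X]) (i : ℕ) :
    (coeffFrob F p).coeff i = p.coeff i ^ Fintype.card F := by
  simp [coeffFrob]

theorem coeff_coeffFrob_iterate (e : ℕ) (p : L[X]) (i : ℕ) :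
    ((coeffFrob F)^[e] p).coeff i = p.coeff i ^ Fintype.card F ^ e := by
  induction e with
  | zero => simp
  | succ e ih => rw [Function.iterate_succ_apply', coeff_coeffFrob, ih, pow_succ, pow_mul]

theorem coeffFrob_C (c : L) : coeffFrob F (C c) = C (c ^ Fintype.card F) := by
  simp [coeffFrob]

theorem coeffFrob_X : coeffFrob F (X : L[X]) = X := by
  simp [coeffFrob]

theorem coeffFrob_map (g : F[X]) : coeffFrob F (g.map (algebraMap F L)) = g.map (algebraMap F L) := by
  ext i
  rw [coeff_coeffFrob, coeff_map, ← map_pow, FiniteField.pow_card]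

variable {F}

theorem dvd_coeffFrob_iterate {g : F[X]} {p : L[X]} (h : g.map (algebraMap F L) ∣ p) (e : ℕ) :
    g.map (algebraMap F L) ∣ (coeffFrob F)^[e] p := by
  induction e with
  | zero => exact h
  | succ e ih =>
    rw [Function.iterate_succ_apply']
    have := map_dvd (coeffFrob F) ih
    rwa [coeffFrob_map] at this

theorem exists_algebraMap_eq_of_pow_card {x : L} (h : x ^ Fintype.card F = x) :
    ∃ c : F, algebraMap F L c = x := by
  have hq : 1 < Fintype.card F := Fintype.one_lt_card
  have hsplit : (X ^ Fintype.card F - X : F[X]).Splits := by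
    rw [splits_iff_card_roots, FiniteField.roots_X_pow_card_sub_X,
      FiniteField.X_pow_card_sub_X_natDegree_eq F hq]
    rfl
  have hne : (X ^ Fintype.card F - X : F[X]) ≠ 0 := FiniteField.X_pow_card_sub_X_ne_zero F hq
  have h1 : x ∈ ((X ^ Fintype.card F - X : F[X]).map (algebraMap F L)).roots := by
    rw [mem_roots (map_ne_zero hne)]
    simp [IsRoot, h]
  rw [hsplit.roots_map] at h1
  obtain ⟨c, -, hc⟩ := Multiset.mem_map.1 h1
  exact ⟨c, hc⟩

theorem exists_map_eq_of_coeffFrob {p : L[X]} (h : coeffFrob F p = p) :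
    ∃ g : F[X], g.map (algebraMap F L) = p := by
  rw [← mem_lifts, lifts_iff_coeff_lifts]
  intro i
  have := congrArg (fun p => p.coeff i) h
  simp only [coeff_coeffFrob] at this
  exact exists_algebraMap_eq_of_pow_card this

end CoefficientFrobenius

section Omega

variable {F : Type*} [Field F] [Fintype F] {L : Type*} [Field L] [Algebra F L] {r : ℕ}

/-- The polynomial `((g(t) - g(D)) / (t - D)) x`, for `D = ∑ κ_i τ ^ i`. -/
def omegaPoly (κ : Fin (r + 1) → L) (g : F[X]) (x : L) : L[X] :=
  ∑ i ∈ Finset.range g.natDegree, C (aeval (twistOp F κ) (divX^[i + 1] g) x) * X ^ i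

omit [Fintype F] in
theorem coeff_divX_iterate (g : F[X]) (i j : ℕ) : (divX^[i] g).coeff j = g.coeff (j + i) := by
  induction i generalizing j with
  | zero => simp
  | succ i ih => rw [Function.iterate_succ_apply', coeff_divX, ih, add_right_comm, add_assoc]

theorem coeff_omegaPoly (κ : Fin (r + 1) → L) (g : F[X]) (x : L) (i : ℕ) :
    (omegaPoly κ g x).coeff i = aeval (twistOp F κ) (divX^[i + 1] g) x := by
  rw [omegaPoly, finsetSum_coeff]
  simp only [coeff_C_mul, coeff_X_pow, mul_ite, mul_one, mul_zero]
  rw [Finset.sum_ite_eq]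
  split_ifs with h
  · rfl
  · have h1 : divX^[i + 1] g = 0 := by
      ext j
      rw [coeff_divX_iterate, coeff_eq_zero_of_natDegree_lt, coeff_zero]
      rw [Finset.mem_range] at h
      omega
    rw [h1, map_zero, LinearMap.zero_apply]

theorem omegaPoly_add (κ : Fin (r + 1) → L) (g : F[X]) (x y : L) :
    omegaPoly κ g (x + y) = omegaPoly κ g x + omegaPoly κ g y := by
  ext i
  simp [coeff_omegaPoly]

theorem omegaPoly_smul (κ : Fin (r + 1) → L) (g : F[X]) (c : F) (x : L) :
    omegaPoly κ g (c • x) = C (algebraMap F L c) * omegaPoly κ g x := by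
  ext i
  rw [coeff_omegaPoly, coeff_C_mul, coeff_omegaPoly, map_smul, Algebra.smul_def]

/-- `omegaPoly` as a linear map. -/
def omegaLin (κ : Fin (r + 1) → L) (g : F[X]) : L →ₗ[F] L[X] where
  toFun := omegaPoly κ g
  map_add' := omegaPoly_add κ g
  map_smul' c x := by
    rw [omegaPoly_smul, RingHom.id_apply, Algebra.smul_def]
    rfl

theorem omegaLin_apply (κ : Fin (r + 1) → L) (g : F[X]) (x : L) :
    omegaLin κ g x = omegaPoly κ g x := rfl

theorem degree_omegaPoly_lt (κ : Fin (r + 1) → L) {g : F[X]} (hg : g.Monic) (x : L) :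
    (omegaPoly κ g x).degree < (g.map (algebraMap F L)).degree := by
  rw [degree_map, degree_eq_natDegree hg.ne_zero, degree_lt_iff_coeff_zero]
  intro i hi
  have h1 : divX^[i + 1] g = 0 := by
    ext j
    rw [coeff_divX_iterate, coeff_eq_zero_of_natDegree_lt (by omega), coeff_zero]
  rw [coeff_omegaPoly, h1, map_zero, LinearMap.zero_apply]

theorem omegaPoly_eq_zero (κ : Fin (r + 1) → L) {g : F[X]} (hg : g.Monic) (hd : g.natDegree ≠ 0)
    {x : L} (h : omegaPoly κ g x = 0) : x = 0 := by
  have h1 : divX^[g.natDegree - 1 + 1] g = 1 := by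
    rw [Nat.sub_add_cancel (Nat.pos_of_ne_zero hd)]
    ext j
    rw [coeff_divX_iterate, coeff_one]
    split_ifs with hj
    · rw [hj, zero_add]
      exact hg
    · rw [coeff_eq_zero_of_natDegree_lt (by omega)]
  have h2 := coeff_omegaPoly κ g x (g.natDegree - 1)
  rw [h, h1, map_one, coeff_zero] at h2
  exact h2.symm

theorem aeval_twistOp_comm (κ : Fin (r + 1) → L) (a : F[X]) (x : L) :
    aeval (twistOp F κ) a (twistOp F κ x) = twistOp F κ (aeval (twistOp F κ) a x) := by
  have h : aeval (twistOp F κ) a * aeval (twistOp F κ) (X : F[X]) =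
      aeval (twistOp F κ) (X : F[X]) * aeval (twistOp F κ) a := by
    rw [← map_mul, ← map_mul, mul_comm]
  rw [aeval_X] at h
  exact LinearMap.congr_fun h x

theorem X_mul_omegaPoly (κ : Fin (r + 1) → L) (g : F[X]) (x : L) :
    X * omegaPoly κ g x = omegaPoly κ g (twistOp F κ x) + g.map (algebraMap F L) * C x -
      C (aeval (twistOp F κ) g x) := by
  have key : ∀ p : F[X], aeval (twistOp F κ) p x =
      aeval (twistOp F κ) p.divX (twistOp F κ x) + algebraMap F L (p.coeff 0) * x := by
    intro p
    conv_lhs => rw [← divX_mul_X_add p]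
    rw [map_add, map_mul, aeval_X, aeval_C, LinearMap.add_apply, Module.End.mul_apply]
    rw [Module.algebraMap_end_apply, Algebra.smul_def]
  ext i
  rw [coeff_sub, coeff_add, coeff_omegaPoly, coeff_mul_C, coeff_map]
  rcases i with _ | i
  · rw [coeff_X_mul_zero, coeff_C_zero, key g]
    simp
  · rw [coeff_X_mul, coeff_omegaPoly, coeff_C_succ, key, coeff_divX_iterate, zero_add,
      ← Function.iterate_succ_apply' divX, sub_zero]

theorem sum_coeffFrob_omegaPoly (κ : Fin (r + 1) → L) (g : F[X]) (x : L) :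
    ∑ i : Fin (r + 1), C (κ i) * (coeffFrob F)^[(i : ℕ)] (omegaPoly κ g x) =
      omegaPoly κ g (twistOp F κ x) := by
  ext j
  rw [coeff_omegaPoly, aeval_twistOp_comm, twistOp_apply, finsetSum_coeff]
  refine Finset.sum_congr rfl fun i _ => ?_
  rw [coeff_C_mul, coeff_coeffFrob_iterate, coeff_omegaPoly]

theorem dvd_X_mul_omegaPoly (κ : Fin (r + 1) → L) (g : F[X]) {x : L} (hx : x ∈ twistKer κ g) :
    g.map (algebraMap F L) ∣ X * omegaPoly κ g x - omegaPoly κ g (twistOp F κ x) := by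
  rw [X_mul_omegaPoly, mem_twistKer.1 hx, C_0, sub_zero, add_sub_cancel_left]
  exact dvd_mul_right _ _

theorem aeval_mem_twistKer (κ : Fin (r + 1) → L) (g a : F[X]) {x : L} (hx : x ∈ twistKer κ g) :
    aeval (twistOp F κ) a x ∈ twistKer κ g := by
  rw [mem_twistKer] at hx ⊢
  rw [← Module.End.mul_apply, ← map_mul, mul_comm, map_mul, Module.End.mul_apply, hx, map_zero]

theorem dvd_map_mul_omegaPoly (κ : Fin (r + 1) → L) (g a : F[X]) {x : L} (hx : x ∈ twistKer κ g) :
    g.map (algebraMap F L) ∣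
      a.map (algebraMap F L) * omegaPoly κ g x - omegaPoly κ g (aeval (twistOp F κ) a x) := by
  induction a using Polynomial.induction_on generalizing x with
  | C c => simp [omegaPoly_smul, Module.algebraMap_end_apply]
  | add a b ha hb =>
    rw [Polynomial.map_add, map_add, LinearMap.add_apply, omegaPoly_add, add_mul, add_sub_add_comm]
    exact dvd_add (ha hx) (hb hx)
  | monomial m c ih =>
    have h1 : twistOp F κ x ∈ twistKer κ g := by
      have := aeval_mem_twistKer κ g X hx
      rwa [aeval_X] at this
    have h2 := dvd_add (ih h1) ((dvd_X_mul_omegaPoly κ g hx).mul_left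
      ((C c * X ^ m : F[X]).map (algebraMap F L)))
    convert h2 using 1
    rw [pow_succ, ← mul_assoc, map_mul _ _ (X : F[X]), aeval_X, Module.End.mul_apply,
      Polynomial.map_mul _ (q := X), map_X]
    ring

theorem pow_card_pow_twistOp {κ : Fin (r + 1) → L} {d : ℕ}
    (hκ : ∀ i, κ i ^ Fintype.card F ^ d = κ i) (a : F[X]) (x : L) :
    (aeval (twistOp F κ) a x) ^ Fintype.card F ^ d =
      aeval (twistOp F κ) a (x ^ Fintype.card F ^ d) := by
  have h1 : Commute ((FiniteField.frobeniusAlgHom F L).toLinearMap ^ d) (twistOp F κ) := by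
    ext y
    rw [Module.End.mul_apply, Module.End.mul_apply, twistOp_apply, twistOp_apply, map_sum]
    refine Finset.sum_congr rfl fun i _ => ?_
    rw [frobeniusAlgHom_pow_apply, frobeniusAlgHom_pow_apply, mul_pow, hκ, ← pow_mul, ← pow_mul,
      mul_comm (_ ^ d)]
  have h2 : Commute ((FiniteField.frobeniusAlgHom F L).toLinearMap ^ d)
      (aeval (twistOp F κ) a) := by
    induction a using Polynomial.induction_on with
    | C c =>
      rw [aeval_C]
      exact (Algebra.commutes c _).symm
    | add a b ha hb =>
      rw [map_add]
      exact ha.add_right hb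
    | monomial m c ih =>
      rw [pow_succ, ← mul_assoc, map_mul, aeval_X]
      exact ih.mul_right h1
  have h3 := LinearMap.congr_fun h2 x
  rw [Module.End.mul_apply, Module.End.mul_apply, frobeniusAlgHom_pow_apply,
    frobeniusAlgHom_pow_apply] at h3
  exact h3

theorem coeffFrob_iterate_omegaPoly {κ : Fin (r + 1) → L} {d : ℕ}
    (hκ : ∀ i, κ i ^ Fintype.card F ^ d = κ i) (g : F[X]) (x : L) :
    (coeffFrob F)^[d] (omegaPoly κ g x) = omegaPoly κ g (x ^ Fintype.card F ^ d) := by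
  ext i
  rw [coeff_coeffFrob_iterate, coeff_omegaPoly, coeff_omegaPoly, pow_card_pow_twistOp hκ]

end Omega

section Moore

variable {F : Type*} [Field F] [Fintype F] {L : Type*} [Field L] [Algebra F L] {n : ℕ}

/-- A relation with coefficients `c` modulo `g` between the vectors `(ω, σ ω, …, σ ^ n ω)` at the
points `y_i`. -/
def OmegaRel {ι : Type*} [Fintype ι] (κ : Fin (n + 2) → L) (g : F[X]) (y c : ι → L) : Prop :=
  ∀ j ≤ n, g.map (algebraMap F L) ∣ ∑ i, C (c i) * (coeffFrob F)^[j] (omegaPoly κ g (y i))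

theorem OmegaRel.frob {ι : Type*} [Fintype ι] {κ : Fin (n + 2) → L} {g : F[X]} {y c : ι → L}
    (hy : ∀ i, y i ∈ twistKer κ g) (h0 : IsCoprime (g.map (algebraMap F L)) (X - C (κ 0)))
    (h : OmegaRel κ g y c) : OmegaRel κ g y (fun i => c i ^ Fintype.card F) := by
  have h1 : ∀ j ≤ n, g.map (algebraMap F L) ∣
      ∑ i, C (c i ^ Fintype.card F) * (coeffFrob F)^[j + 1] (omegaPoly κ g (y i)) := by
    intro j hj
    have := dvd_coeffFrob_iterate (h j hj) 1
    rw [Function.iterate_one, map_sum] at this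
    simpa only [map_mul, coeffFrob_C, ← Function.iterate_succ_apply'] using this
  intro j hj
  rcases j with _ | j
  · apply h0.dvd_of_dvd_mul_left
    have h2 : (X - C (κ 0)) * ∑ i, C (c i ^ Fintype.card F) * (coeffFrob F)^[0] (omegaPoly κ g (y i)) =
        ∑ i, C (c i ^ Fintype.card F) *
          (X * omegaPoly κ g (y i) - omegaPoly κ g (twistOp F κ (y i))) +
        ∑ l : Fin (n + 1), C (κ l.succ) * ∑ i, C (c i ^ Fintype.card F) *
          (coeffFrob F)^[(l : ℕ) + 1] (omegaPoly κ g (y i)) := by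
      simp only [Finset.mul_sum]
      rw [Finset.sum_comm (s := (Finset.univ : Finset (Fin (n + 1)))), ← Finset.sum_add_distrib]
      refine Finset.sum_congr rfl fun i _ => ?_
      rw [← sum_coeffFrob_omegaPoly, Fin.sum_univ_succ]
      have h3 : ∑ l : Fin (n + 1), C (κ l.succ) * (C (c i ^ Fintype.card F) *
          (coeffFrob F)^[(l : ℕ) + 1] (omegaPoly κ g (y i))) =
          C (c i ^ Fintype.card F) * ∑ l : Fin (n + 1), C (κ l.succ) *
            (coeffFrob F)^[(l : ℕ) + 1] (omegaPoly κ g (y i)) := by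
        rw [Finset.mul_sum]
        refine Finset.sum_congr rfl fun l _ => ?_
        ring
      rw [h3]
      simp only [Fin.val_zero, Function.iterate_zero, id_eq, Fin.val_succ]
      ring
    rw [h2]
    refine dvd_add (Finset.dvd_sum fun i _ => (dvd_X_mul_omegaPoly κ g (hy i)).mul_left _)
      (Finset.dvd_sum fun l _ => (h1 l (Nat.lt_succ_iff.1 l.2)).mul_left _)
  · exact h1 j (by omega)

theorem OmegaRel.eq_zero {ι : Type*} [Fintype ι] {κ : Fin (n + 2) → L} {g : F[X]} (hg : g.Monic)
    (hd : g.natDegree ≠ 0) {y : ι → L}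
    (hy : ∀ i, y i ∈ twistKer κ g) (h0 : IsCoprime (g.map (algebraMap F L)) (X - C (κ 0)))
    (hlin : LinearIndependent F y) {c : ι → L} (h : OmegaRel κ g y c) : c = 0 := by
  classical
  induction hN : (Finset.univ.filter fun i => c i ≠ 0).card using Nat.strong_induction_on
    generalizing c with
  | _ N ih =>
    by_contra hc
    obtain ⟨a, ha⟩ := Function.ne_iff.1 hc
    rw [Pi.zero_apply] at ha
    let b : ι → L := fun i => (c a)⁻¹ * c i
    have hb : OmegaRel κ g y b := by
      intro j hj
      have := (h j hj).mul_left (C (c a)⁻¹)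
      rw [Finset.mul_sum] at this
      simpa only [b, C_mul, mul_assoc] using this
    have hba : b a = 1 := inv_mul_cancel₀ ha
    have hsub : OmegaRel κ g y (fun i => b i ^ Fintype.card F - b i) := by
      intro j hj
      have := dvd_sub (hb.frob hy h0 j hj) (hb j hj)
      rw [← Finset.sum_sub_distrib] at this
      simpa only [C_sub, sub_mul] using this
    have hzero := ih _ ?_ hsub rfl
    · have h1 : ∀ i, ∃ e : F, algebraMap F L e = b i := fun i =>
        exists_algebraMap_eq_of_pow_card (sub_eq_zero.1 (congrFun hzero i))
      choose e he using h1
      have h2 := hb 0 (Nat.zero_le _)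
      have h3 : ∑ i, C (b i) * (coeffFrob F)^[0] (omegaPoly κ g (y i)) =
          omegaPoly κ g (∑ i, e i • y i) := by
        rw [← omegaLin_apply, map_sum]
        refine Finset.sum_congr rfl fun i _ => ?_
        rw [omegaLin_apply, omegaPoly_smul, he]
        rfl
      rw [h3] at h2
      have h4 := omegaPoly_eq_zero κ hg hd
        (eq_zero_of_dvd_of_degree_lt h2 (degree_omegaPoly_lt κ hg _))
      have h5 := Fintype.linearIndependent_iff.1 hlin e h4 a
      have h6 := he a
      rw [h5, map_zero, hba] at h6
      exact zero_ne_one h6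
    · rw [← hN]
      apply Finset.card_lt_card
      rw [Finset.ssubset_iff_of_subset]
      · refine ⟨a, by simpa using ha, ?_⟩
        simp [hba]
      · intro i
        simp only [Finset.mem_filter, Finset.mem_univ, true_and, b]
        intro hi hci
        apply hi
        rw [hci, mul_zero, zero_pow Fintype.card_ne_zero, sub_zero]

end Moore

section Filtration

/-- A multiplicative filtration of a ring indexed by the integers. -/
structure RingFiltration (R : Type*) [CommRing R] where
  /-- the steps of the filtration -/
  step : ℤ → AddSubgroup R
  one_mem : (1 : R) ∈ step 0
  mul_mem : ∀ {a b : ℤ} {x y : R}, x ∈ step a → y ∈ step b → x * y ∈ step (a + b)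

namespace RingFiltration

variable {R : Type*} [CommRing R] (W : RingFiltration R)

theorem prod_mem {ι : Type*} (s : Finset ι) (x : ι → R) (a : ι → ℤ) (h : ∀ i ∈ s, x i ∈ W.step (a i)) :
    ∏ i ∈ s, x i ∈ W.step (∑ i ∈ s, a i) := by
  classical
  induction s using Finset.induction_on with
  | empty => simpa using W.one_mem
  | insert i s hi ih =>
    rw [Finset.prod_insert hi, Finset.sum_insert hi]
    exact W.mul_mem (h i (Finset.mem_insert_self _ _)) (ih fun j hj => h j (Finset.mem_insert_of_mem hj))

theorem det_mem {ι : Type*} [Fintype ι] [DecidableEq ι] (M : Matrix ι ι R) (u v : ι → ℤ)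
    (h : ∀ i j, M i j ∈ W.step (u i + v j)) : M.det ∈ W.step (∑ i, u i + ∑ i, v i) := by
  rw [Matrix.det_apply]
  refine sum_mem fun p _ => ?_
  have h1 : ∏ i, M (p i) i ∈ W.step (∑ i, u i + ∑ i, v i) := by
    rw [← Equiv.sum_comp p u, ← Finset.sum_add_distrib]
    exact W.prod_mem _ _ _ fun i _ => h _ _
  rcases Int.units_eq_one_or (Equiv.Perm.sign p) with h2 | h2
  · rw [h2, one_smul]
    exact h1
  · rw [h2, Units.neg_smul, one_smul]
    exact neg_mem h1

/-- The filtration of a polynomial ring for which the variable has weight `w`. -/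
def poly (w : ℤ) : RingFiltration R[X] where
  step a :=
    { carrier := {p | ∀ m : ℕ, p.coeff m ∈ W.step (a - w * m)}
      add_mem' := fun hp hq m => by
        rw [coeff_add]
        exact add_mem (hp m) (hq m)
      zero_mem' := fun m => by
        rw [coeff_zero]
        exact zero_mem _
      neg_mem' := fun hp m => by
        rw [coeff_neg]
        exact neg_mem (hp m) }
  one_mem m := by
    rw [coeff_one]
    split_ifs with h
    · rw [h]
      simpa using W.one_mem
    · exact zero_mem _
  mul_mem {a b p q} hp hq m := by
    rw [coeff_mul]
    refine sum_mem fun x hx => ?_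
    have h := W.mul_mem (hp x.1) (hq x.2)
    have h2 : a - w * x.1 + (b - w * x.2) = a + b - w * m := by
      rw [← Finset.HasAntidiagonal.mem_antidiagonal.1 hx]
      push_cast
      ring
    rwa [h2] at h

theorem mem_poly {w a : ℤ} {p : R[X]} :
    p ∈ (W.poly w).step a ↔ ∀ m : ℕ, p.coeff m ∈ W.step (a - w * m) := Iff.rfl

theorem C_mem_poly {w a : ℤ} {x : R} (h : x ∈ W.step a) : C x ∈ (W.poly w).step a := by
  intro m
  rw [coeff_C]
  split_ifs with hm
  · rw [hm]
    simpa using h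
  · exact zero_mem _

theorem X_mem_poly (w : ℤ) : (X : R[X]) ∈ (W.poly w).step w := by
  intro m
  rw [coeff_X]
  split_ifs with hm
  · rw [← hm]
    simpa using W.one_mem
  · exact zero_mem _

/-- The trivial filtration, `0` in negative degrees and everything in the other degrees. -/
def trivial (R : Type*) [CommRing R] : RingFiltration R where
  step a :=
    { carrier := {x | x ≠ 0 → 0 ≤ a}
      add_mem' := fun {x y} hx hy h => by
        by_cases h0 : x = 0
        · exact hy (by rintro rfl; exact h (by rw [h0, add_zero]))
        · exact hx h0
      zero_mem' := fun h => absurd rfl h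
      neg_mem' := fun hx h => hx (neg_ne_zero.1 h) }
  one_mem _ := le_rfl
  mul_mem hx hy h := add_nonneg (hx (left_ne_zero_of_mul h)) (hy (right_ne_zero_of_mul h))

theorem mem_trivial {a : ℤ} {x : R} : x ∈ (trivial R).step a ↔ (x ≠ 0 → 0 ≤ a) := Iff.rfl

end RingFiltration

end Filtration

section FrobeniusMatrix

variable (F : Type*) [Field F] [Fintype F] {L : Type*} [Field L] [Algebra F L] {n : ℕ}

/-- The matrix of `σ` in the coordinates `(ω, σ ω, …, σ ^ n ω)`. -/
def frobMat (κ : Fin (n + 2) → L) : Matrix (Fin (n + 1)) (Fin (n + 1)) L[X] :=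
  Matrix.of fun i j => if i = Fin.last n then
    C (κ (Fin.last (n + 1)))⁻¹ * ((if j = 0 then X else 0) - C (κ j.castSucc))
    else if (j : ℕ) = i + 1 then 1 else 0

/-- The matrix of `σ ^ e` in the coordinates `(ω, σ ω, …, σ ^ n ω)`. -/
def frobMatPow (κ : Fin (n + 2) → L) : ℕ → Matrix (Fin (n + 1)) (Fin (n + 1)) L[X]
  | 0 => 1
  | e + 1 => (frobMatPow κ e).map (coeffFrob F) * frobMat κ

theorem frobMatPow_succ' (κ : Fin (n + 2) → L) (e : ℕ) :
    frobMatPow F κ (e + 1) = (frobMat κ).map (coeffFrob F ^ e : L[X] →+* L[X]) * frobMatPow F κ e := by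
  induction e with
  | zero =>
    ext1 i j
    simp [frobMatPow, RingHom.one_def]
  | succ e ih =>
    rw [frobMatPow, ih, Matrix.map_mul, Matrix.map_map, Matrix.mul_assoc, ← frobMatPow, pow_succ', RingHom.coe_mul,
      ← ih]

theorem frobMat_mulVec (κ : Fin (n + 2) → L) (v : ℕ → L[X])
    (i : Fin (n + 1)) : ∑ j, frobMat κ i j * v j = if i = Fin.last n then
      C (κ (Fin.last (n + 1)))⁻¹ * (X * v 0 - ∑ j : Fin (n + 1), C (κ j.castSucc) * v j)
      else v (i + 1) := by
  split_ifs with h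
  · simp only [frobMat, Matrix.of_apply, if_pos h, mul_assoc]
    rw [← Finset.mul_sum]
    simp only [sub_mul, Finset.sum_sub_distrib, ite_mul, zero_mul]
    rw [Finset.sum_ite_eq' Finset.univ (0 : Fin (n + 1)), if_pos (Finset.mem_univ _)]
    rfl
  · simp only [frobMat, Matrix.of_apply, if_neg h, ite_mul, zero_mul, one_mul]
    have hi : (i : ℕ) + 1 < n + 1 := by
      have h1 := i.2
      have h2 : (i : ℕ) ≠ n := fun h2 => h (Fin.ext (by simpa using h2))
      omega
    rw [Finset.sum_eq_single ⟨(i : ℕ) + 1, hi⟩]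
    · simp
    · intro j _ hj
      rw [if_neg]
      intro h2
      exact hj (Fin.ext h2)
    · simp

theorem det_frobMat (κ : Fin (n + 2) → L) :
    (frobMat κ).det = (-1) ^ n * C (κ (Fin.last (n + 1)))⁻¹ * (X - C (κ 0)) := by
  rw [Matrix.det_succ_column_zero, Finset.sum_eq_single (Fin.last n)]
  · have h1 : (frobMat κ).submatrix (Fin.last n).succAbove Fin.succ = 1 := by
      ext1 i j
      rw [Matrix.submatrix_apply, frobMat, Matrix.of_apply, Fin.succAbove_last,
        if_neg (Fin.castSucc_lt_last i).ne, Matrix.one_apply]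
      simp [Fin.ext_iff, eq_comm]
    rw [h1, Matrix.det_one, mul_one, frobMat, Matrix.of_apply, if_pos rfl, if_pos rfl]
    simp [mul_assoc]
  · intro i _ hi
    rw [frobMat, Matrix.of_apply, if_neg hi, if_neg (by simp)]
    simp
  · simp

theorem dvd_frobMatPow {κ : Fin (n + 2) → L} (hκ : κ (Fin.last (n + 1)) ≠ 0) {g : F[X]} {x : L}
    (hx : x ∈ twistKer κ g) (e : ℕ) (i : Fin (n + 1)) :
    g.map (algebraMap F L) ∣ (coeffFrob F)^[e] ((coeffFrob F)^[(i : ℕ)] (omegaPoly κ g x)) -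
      ∑ j, frobMatPow F κ e i j * (coeffFrob F)^[(j : ℕ)] (omegaPoly κ g x) := by
  have step : ∀ i : Fin (n + 1), g.map (algebraMap F L) ∣
      coeffFrob F ((coeffFrob F)^[(i : ℕ)] (omegaPoly κ g x)) -
        ∑ j, frobMat κ i j * (coeffFrob F)^[(j : ℕ)] (omegaPoly κ g x) := by
    intro i
    rw [frobMat_mulVec κ (fun j => (coeffFrob F)^[j] (omegaPoly κ g x)) i,
      ← Function.iterate_succ_apply' (coeffFrob F)]
    split_ifs with hi
    · subst hi
      have h1 := sum_coeffFrob_omegaPoly (F := F) κ g x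
      rw [Fin.sum_univ_castSucc] at h1
      have h2 := (dvd_X_mul_omegaPoly κ g hx).mul_left (C (-(κ (Fin.last (n + 1)))⁻¹))
      rw [← h1] at h2
      convert h2 using 1
      have h3 : (C (κ (Fin.last (n + 1)))⁻¹ : L[X]) * C (κ (Fin.last (n + 1))) = 1 := by
        rw [← C_mul, inv_mul_cancel₀ hκ, C_1]
      simp only [Fin.val_last, Function.iterate_zero, id_eq, Fin.val_castSucc, C_neg]
      linear_combination (-(coeffFrob F)^[n + 1] (omegaPoly κ g x)) * h3
    · simp
  induction e generalizing i with
  | zero => simp [frobMatPow, Matrix.one_apply]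
  | succ e ih =>
    have h1 := map_dvd (coeffFrob F) (ih i)
    rw [coeffFrob_map, map_sub, map_sum, ← Function.iterate_succ_apply' (coeffFrob F)] at h1
    have h2 := Finset.dvd_sum (s := Finset.univ) fun l _ =>
      (step l).mul_left (coeffFrob F (frobMatPow F κ e i l))
    convert dvd_add h1 h2 using 1
    rw [sub_add, sub_right_inj, ← Finset.sum_sub_distrib, frobMatPow]
    simp only [Matrix.mul_apply, Matrix.map_apply, Finset.sum_mul, mul_sub, map_mul, Finset.mul_sum]
    rw [Finset.sum_comm]
    refine Finset.sum_congr rfl fun l _ => ?_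
    rw [sub_sub_cancel]
    refine Finset.sum_congr rfl fun j _ => ?_
    ring

variable {F}

/-- The matrix `(σ ^ i ω(x_j))` modulo `g`. -/
def omegaMat (κ : Fin (n + 2) → L) (g : F[X]) (x : Fin (n + 1) → L) :
    Matrix (Fin (n + 1)) (Fin (n + 1)) (AdjoinRoot (g.map (algebraMap F L))) :=
  Matrix.of fun i j => AdjoinRoot.mk _ ((coeffFrob F)^[(i : ℕ)] (omegaPoly κ g (x j)))

/-- The map `F[t] → L[t] / g`. -/
def modHom (L : Type*) [Field L] [Algebra F L] (g : F[X]) :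
    F[X] →+* AdjoinRoot (g.map (algebraMap F L)) :=
  (AdjoinRoot.mk _).comp (mapRingHom (algebraMap F L))

omit [Fintype F] in
theorem modHom_eq_zero_iff {g a : F[X]} : modHom L g a = 0 ↔ g ∣ a := by
  rw [modHom, RingHom.comp_apply, AdjoinRoot.mk_eq_zero, coe_mapRingHom, Polynomial.map_dvd_map']

theorem mk_iterate_omegaPoly_sum {κ : Fin (n + 2) → L} {g : F[X]} {x : Fin (n + 1) → L}
    (hx : ∀ i, x i ∈ twistKer κ g) (a : Fin (n + 1) → F[X]) (e : ℕ) :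
    AdjoinRoot.mk (g.map (algebraMap F L)) ((coeffFrob F)^[e] (omegaPoly κ g
      (∑ j, aeval (twistOp F κ) (a j) (x j)))) =
      ∑ j, AdjoinRoot.mk _ ((coeffFrob F)^[e] (omegaPoly κ g (x j))) * modHom L g (a j) := by
  have h1 : ∀ j, AdjoinRoot.mk (g.map (algebraMap F L)) ((coeffFrob F)^[e] (omegaPoly κ g
      (aeval (twistOp F κ) (a j) (x j)))) =
      AdjoinRoot.mk _ ((coeffFrob F)^[e] (omegaPoly κ g (x j))) * modHom L g (a j) := by
    intro j
    symm
    have h2 := dvd_coeffFrob_iterate (dvd_map_mul_omegaPoly κ g (a j) (hx j)) e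
    rw [← RingHom.coe_pow, map_sub, map_mul] at h2
    have h3 : (coeffFrob F ^ e : L[X] →+* L[X]) ((a j).map (algebraMap F L)) =
        (a j).map (algebraMap F L) := by
      rw [RingHom.coe_pow]
      exact Function.iterate_fixed (coeffFrob_map F (a j)) e
    rw [h3, ← AdjoinRoot.mk_eq_mk] at h2
    rw [modHom, RingHom.comp_apply, ← map_mul, mul_comm, ← RingHom.coe_pow]
    exact h2
  rw [← omegaLin_apply, map_sum, ← RingHom.coe_pow, map_sum, map_sum]
  refine Finset.sum_congr rfl fun j _ => ?_
  rw [omegaLin_apply, RingHom.coe_pow, h1]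

theorem isUnit_omegaMat [IsAlgClosed L] {κ : Fin (n + 2) → L} (hκ : κ (Fin.last (n + 1)) ≠ 0)
    {g : F[X]} (hg : g.Monic) (hd : g.natDegree ≠ 0) (h0 : aeval (κ 0) g ≠ 0)
    {x : Fin (n + 1) → L} (hx : ∀ i, x i ∈ twistKer κ g)
    (hspan : ∀ y ∈ twistKer κ g, ∃ a : Fin (n + 1) → F[X], y = ∑ j, aeval (twistOp F κ) (a j) (x j)) :
    IsUnit (omegaMat κ g x) := by
  set G := g.map (algebraMap F L) with hG
  have hGm : G.Monic := hg.map _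
  have hcop : IsCoprime G (X - C (κ 0)) := by
    rw [isCoprime_comm]
    refine (irreducible_X_sub_C (κ 0)).coprime_iff_not_dvd.2 fun h => h0 ?_
    rw [dvd_iff_isRoot, IsRoot, hG, eval_map_algebraMap] at h
    exact h
  have hfin := finite_twistKer (Nat.succ_ne_zero n) hκ h0
  have : Module.Finite F (twistKer κ g) := Module.Finite.of_finite
  have : Module.Finite L (AdjoinRoot G) := hGm.finite_adjoinRoot
  let B := Module.finBasis F (twistKer κ g)
  let y : Fin (Module.finrank F (twistKer κ g)) → L := fun i => B i
  have hylin : LinearIndependent F y := B.linearIndependent.map' (twistKer κ g).subtype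
    (Submodule.ker_subtype _)
  have hy : ∀ i, y i ∈ twistKer κ g := fun i => (B i).2
  let V : Fin (Module.finrank F (twistKer κ g)) → (Fin (n + 1) → AdjoinRoot G) :=
    fun b i => AdjoinRoot.mk G ((coeffFrob F)^[(i : ℕ)] (omegaPoly κ g (y b)))
  have hV : LinearIndependent L V := by
    rw [Fintype.linearIndependent_iff]
    intro c hc
    have : OmegaRel κ g y c := by
      intro j hj
      have h1 := congrFun hc ⟨j, Nat.lt_succ_of_le hj⟩
      rw [Finset.sum_apply] at h1
      rw [← hG, ← AdjoinRoot.mk_eq_zero, map_sum, ← Pi.zero_apply (M := fun _ => AdjoinRoot G)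
        (⟨j, Nat.lt_succ_of_le hj⟩ : Fin (n + 1)), ← h1]
      refine Finset.sum_congr rfl fun b _ => ?_
      rw [map_mul, Pi.smul_apply, Algebra.smul_def]
      rfl
    exact congrFun (this.eq_zero hg hd hy hcop hylin)
  have hcard : Fintype.card (Fin (Module.finrank F (twistKer κ g))) =
      Module.finrank L (Fin (n + 1) → AdjoinRoot G) := by
    rw [Fintype.card_fin, finrank_twistKer (Nat.succ_ne_zero n) hκ h0, Module.finrank_pi_fintype,
      Finset.sum_const, Finset.card_univ, Fintype.card_fin, smul_eq_mul,
      (AdjoinRoot.powerBasis hGm.ne_zero).finrank, AdjoinRoot.powerBasis_dim, hG, natDegree_map]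
  have htop := hV.span_eq_top_of_card_eq_finrank' hcard
  rw [← Matrix.mulVec_surjective_iff_isUnit]
  intro v
  have hv : v ∈ Submodule.span L (Set.range V) := by
    rw [htop]
    exact Submodule.mem_top
  have hle : Submodule.span L (Set.range V) ≤
      (LinearMap.range (Matrix.mulVecLin (omegaMat κ g x))).restrictScalars L := by
    rw [Submodule.span_le]
    rintro _ ⟨b, rfl⟩
    obtain ⟨a, ha⟩ := hspan (y b) (hy b)
    refine ⟨fun j => modHom L g (a j), ?_⟩
    ext i
    change ∑ j, omegaMat κ g x i j * modHom L g (a j) = _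
    simp only [V]
    rw [ha, mk_iterate_omegaPoly_sum hx]
    rfl
  exact hle hv

theorem map_charpoly_eq [IsAlgClosed L] {κ : Fin (n + 2) → L} (hκ : κ (Fin.last (n + 1)) ≠ 0) {d : ℕ}
    (hκd : ∀ i, κ i ^ Fintype.card F ^ d = κ i)
    {g : F[X]} (hg : g.Monic) (hd : g.natDegree ≠ 0) (h0 : aeval (κ 0) g ≠ 0)
    {x : Fin (n + 1) → L} (hx : ∀ i, x i ∈ twistKer κ g)
    (hspan : ∀ y ∈ twistKer κ g, ∃ a : Fin (n + 1) → F[X], y = ∑ j, aeval (twistOp F κ) (a j) (x j))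
    {b : Matrix (Fin (n + 1)) (Fin (n + 1)) F[X]}
    (hb : ∀ j, x j ^ Fintype.card F ^ d = ∑ i, aeval (twistOp F κ) (b i j) (x i)) :
    b.charpoly.map (modHom L g) = (frobMatPow F κ d).charpoly.map (AdjoinRoot.mk _) := by
  have h1 : (frobMatPow F κ d).map (AdjoinRoot.mk _) * omegaMat κ g x =
      omegaMat κ g x * b.map (modHom L g) := by
    ext1 i j
    have h2 := dvd_frobMatPow F hκ (hx j) d i
    rw [← AdjoinRoot.mk_eq_mk, ← Function.iterate_add_apply, add_comm, Function.iterate_add_apply,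
      coeffFrob_iterate_omegaPoly hκd, hb, mk_iterate_omegaPoly_sum hx, map_sum] at h2
    rw [Matrix.mul_apply, Matrix.mul_apply]
    simp only [map_mul] at h2
    exact h2.symm
  obtain ⟨U, hU⟩ := isUnit_omegaMat hκ hg hd h0 hx hspan
  have h2 : (frobMatPow F κ d).map (AdjoinRoot.mk _) = U.val * b.map (modHom L g) * U.val⁻¹ := by
    rw [hU, ← h1, ← hU, Matrix.mul_assoc, ← Matrix.coe_units_inv, U.mul_inv, Matrix.mul_one]
  rw [← Matrix.charpoly_map, ← Matrix.charpoly_map, h2, Matrix.charpoly_units_conj]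

end FrobeniusMatrix

section FrobeniusPolynomial

variable {F : Type*} [Field F] [Fintype F] {L : Type*} [Field L] [Algebra F L] {n : ℕ}

theorem coeffFrob_iterate_frobMat {κ : Fin (n + 2) → L} {d : ℕ}
    (hκd : ∀ i, κ i ^ Fintype.card F ^ d = κ i) :
    (frobMat κ).map (coeffFrob F ^ d : L[X] →+* L[X]) = frobMat κ := by
  ext1 i j
  ext m
  rw [Matrix.map_apply, RingHom.coe_pow, coeff_coeffFrob_iterate]
  simp only [frobMat, Matrix.of_apply]
  have h0 : (0 : L) ^ Fintype.card F ^ d = 0 := zero_pow (pow_ne_zero _ Fintype.card_ne_zero)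
  have hfix : ∀ p : L[X], (coeffFrob F)^[d] p = p → ∀ m, p.coeff m ^ Fintype.card F ^ d = p.coeff m := by
    intro p hp m
    rw [← coeff_coeffFrob_iterate, hp]
  have hC : ∀ c : L, c ^ Fintype.card F ^ d = c → (coeffFrob F)^[d] (C c) = C c := by
    intro c hc
    ext m
    rw [coeff_coeffFrob_iterate, coeff_C]
    split_ifs <;> simp [hc, h0]
  have hX : (coeffFrob F)^[d] (X : L[X]) = X := Function.iterate_fixed (coeffFrob_X F) d
  apply hfix
  rw [← RingHom.coe_pow]
  split_ifs
  · rw [map_mul, map_sub, RingHom.coe_pow, hC, hC, hX]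
    · exact hκd _
    · rw [inv_pow, hκd]
  · rw [map_mul, map_sub, RingHom.coe_pow, hC, hC, ← RingHom.coe_pow, map_zero]
    · exact hκd _
    · rw [inv_pow, hκd]
  · exact map_one _
  · exact map_zero _

theorem map_coeffFrob_charpoly {κ : Fin (n + 2) → L} {d : ℕ}
    (hκd : ∀ i, κ i ^ Fintype.card F ^ d = κ i) :
    (frobMatPow F κ d).charpoly.map (coeffFrob F) = (frobMatPow F κ d).charpoly := by
  rcases d with _ | d
  · simp [frobMatPow, ← Matrix.charpoly_map]
  · rw [← Matrix.charpoly_map]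
    conv_lhs => rw [frobMatPow_succ', Matrix.map_mul, Matrix.map_map, ← RingHom.coe_mul, ← pow_succ',
      coeffFrob_iterate_frobMat hκd, Matrix.charpoly_mul_comm]
    rfl

theorem exists_map_map_eq {p : L[X][X]} (h : p.map (coeffFrob F) = p) :
    ∃ P : F[X][X], P.map (mapRingHom (algebraMap F L)) = p := by
  rw [← mem_lifts, lifts_iff_coeff_lifts]
  intro i
  have := congrArg (fun p => p.coeff i) h
  simp only [coeff_map] at this
  obtain ⟨g, hg⟩ := exists_map_eq_of_coeffFrob this
  exact ⟨g, hg⟩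

theorem det_frobMatPow (κ : Fin (n + 2) → L) {lam : F}
    (hlam : κ (Fin.last (n + 1)) = algebraMap F L lam) (e : ℕ) :
    (frobMatPow F κ e).det = C (algebraMap F L (((-1) ^ n * lam⁻¹) ^ e)) *
      ∏ i ∈ Finset.range e, (X - C (κ 0 ^ Fintype.card F ^ i)) := by
  induction e with
  | zero => simp [frobMatPow]
  | succ e ih =>
    have h1 : ∀ c : F, (coeffFrob F ^ e : L[X] →+* L[X]) (C (algebraMap F L c)) =
        C (algebraMap F L c) := by
      intro c
      rw [RingHom.coe_pow]
      refine Function.iterate_fixed ?_ e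
      rw [coeffFrob_C, ← map_pow, FiniteField.pow_card]
    have h2 : (coeffFrob F ^ e : L[X] →+* L[X]) (X - C (κ 0)) = X - C (κ 0 ^ Fintype.card F ^ e) := by
      have h0 : (0 : L) ^ Fintype.card F ^ e = 0 := zero_pow (pow_ne_zero _ Fintype.card_ne_zero)
      rw [map_sub, RingHom.coe_pow, Function.iterate_fixed (coeffFrob_X F) e]
      congr 1
      ext m
      rw [coeff_coeffFrob_iterate, coeff_C, coeff_C]
      split_ifs <;> simp [h0]
    rw [frobMatPow_succ', Matrix.det_mul, ih, Finset.prod_range_succ, ← RingHom.mapMatrix_apply,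
      ← RingHom.map_det, det_frobMat, hlam, ← map_inv₀, map_mul, map_mul, map_pow, map_neg, map_one,
      h1, h2, pow_succ ((-1) ^ n * lam⁻¹) e]
    simp only [map_mul, map_pow, map_neg, map_one]
    ring

theorem prod_X_sub_C_pow_card_eq {θ : L} {f : F[X]} (hf : f.Monic) (hirr : Irreducible f)
    (hroot : aeval θ f = 0) (hθ : θ ^ Fintype.card F ^ f.natDegree = θ) :
    ∏ i ∈ Finset.range f.natDegree, (X - C (θ ^ Fintype.card F ^ i)) = f.map (algebraMap F L) := by
  set d := f.natDegree with hd
  have hdpos : 0 < d := hirr.natDegree_pos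
  have hfix : coeffFrob F (∏ i ∈ Finset.range d, (X - C (θ ^ Fintype.card F ^ i))) =
      ∏ i ∈ Finset.range d, (X - C (θ ^ Fintype.card F ^ i)) := by
    rw [map_prod]
    simp only [map_sub, coeffFrob_X, coeffFrob_C, ← pow_mul, ← pow_succ]
    obtain ⟨e, he⟩ := Nat.exists_eq_succ_of_ne_zero hdpos.ne'
    rw [he] at hθ ⊢
    rw [Finset.prod_range_succ, Finset.prod_range_succ', hθ]
    simp
  obtain ⟨g, hg⟩ := exists_map_eq_of_coeffFrob hfix
  have hgm : g.Monic := by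
    have : (g.map (algebraMap F L)).Monic := by
      rw [hg]
      exact monic_prod_of_monic _ _ fun i _ => monic_X_sub_C _
    exact (monic_map_iff).1 this
  have hgd : g.natDegree = d := by
    rw [← natDegree_map (algebraMap F L), hg, natDegree_prod_of_monic _ _ fun i _ => monic_X_sub_C _,
      Finset.sum_congr rfl fun i _ => natDegree_X_sub_C _]
    simp
  have hdvd : f ∣ g := by
    have hmin : f = minpoly F θ := minpoly.eq_of_irreducible_of_monic hirr hroot hf
    rw [hmin]
    apply minpoly.dvd
    rw [← eval_map_algebraMap, hg, eval_prod]
    refine Finset.prod_eq_zero (Finset.mem_range.2 hdpos) ?_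
    simp
  rw [← hg, eq_of_monic_of_dvd_of_natDegree_le hf hgm hdvd (by rw [hgd])]

/-- The filtration of `L[t]` for which `t` has weight `n + 1`. -/
def coeffFiltration (L : Type*) [Field L] (n : ℕ) : RingFiltration L[X] :=
  (RingFiltration.trivial L).poly (n + 1)

theorem mem_coeffFiltration {a : ℤ} {p : L[X]} :
    p ∈ (coeffFiltration L n).step a ↔ ∀ m : ℕ, p.coeff m ≠ 0 → ((n : ℤ) + 1) * m ≤ a := by
  rw [coeffFiltration, RingFiltration.mem_poly]
  simp only [RingFiltration.mem_trivial, sub_nonneg]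

theorem coeffFrob_iterate_mem {a : ℤ} {p : L[X]} (h : p ∈ (coeffFiltration L n).step a) :
    coeffFrob F p ∈ (coeffFiltration L n).step a := by
  rw [mem_coeffFiltration] at h ⊢
  intro m hm
  apply h
  rw [coeff_coeffFrob] at hm
  exact ne_zero_pow Fintype.card_ne_zero hm

theorem C_mem_coeffFiltration {a : ℤ} (ha : 0 ≤ a) (c : L) :
    C c ∈ (coeffFiltration L n).step a :=
  RingFiltration.C_mem_poly _ fun _ => ha

theorem frobMat_mem (κ : Fin (n + 2) → L) (i j : Fin (n + 1)) :
    frobMat κ i j ∈ (coeffFiltration L n).step ((i : ℤ) + 1 - j) := by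
  rw [frobMat, Matrix.of_apply]
  split_ifs with h1 h2 h2
  · subst h1 h2
    rw [← zero_add ((_ : ℤ) + 1 - _)]
    refine RingFiltration.mul_mem _ (C_mem_coeffFiltration le_rfl _) (sub_mem ?_
      (C_mem_coeffFiltration ?_ _))
    · have := RingFiltration.X_mem_poly (RingFiltration.trivial L) ((n : ℤ) + 1)
      rw [← coeffFiltration] at this
      simpa using this
    · simp
      omega
  · rw [← zero_add ((_ : ℤ) + 1 - _)]
    refine RingFiltration.mul_mem _ (C_mem_coeffFiltration le_rfl _) (sub_mem (zero_mem _)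
      (C_mem_coeffFiltration ?_ _))
    have := j.2
    subst h1
    simp
    omega
  · exact C_mem_coeffFiltration (by omega) 1
  · exact zero_mem _

theorem frobMatPow_mem (κ : Fin (n + 2) → L) (e : ℕ) (i j : Fin (n + 1)) :
    frobMatPow F κ e i j ∈ (coeffFiltration L n).step ((i : ℤ) + e - j) := by
  induction e generalizing i j with
  | zero =>
    rw [frobMatPow, Matrix.one_apply]
    split_ifs with h
    · subst h
      exact C_mem_coeffFiltration (by simp) 1
    · exact zero_mem _
  | succ e ih =>
    rw [frobMatPow, Matrix.mul_apply]
    refine sum_mem fun l _ => ?_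
    have := RingFiltration.mul_mem _ (coeffFrob_iterate_mem (F := F) (ih i l)) (frobMat_mem κ l j)
    have h2 : (i : ℤ) + e - l + (l + 1 - j) = i + ((e + 1 : ℕ) : ℤ) - j := by
      push_cast
      ring
    rwa [h2] at this

theorem charpoly_frobMatPow_mem (κ : Fin (n + 2) → L) (d : ℕ) :
    (frobMatPow F κ d).charpoly ∈ ((coeffFiltration L n).poly d).step ((n + 1) * d) := by
  have h := RingFiltration.det_mem ((coeffFiltration L n).poly d) (Matrix.charmatrix (frobMatPow F κ d))
    (fun i => (i : ℤ) + d) (fun i => -(i : ℤ)) ?_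
  · rw [Finset.sum_add_distrib] at h
    rw [Matrix.charpoly]
    simpa using h
  · intro i j
    have h1 := RingFiltration.C_mem_poly (w := d) _ (frobMatPow_mem (F := F) κ d i j)
    rw [sub_eq_add_neg] at h1
    by_cases hij : i = j
    · subst hij
      rw [Matrix.charmatrix_apply_eq]
      refine sub_mem ?_ h1
      simpa using RingFiltration.X_mem_poly (coeffFiltration L n) (d : ℤ)
    · rw [Matrix.charmatrix_apply_ne _ _ _ hij]
      exact neg_mem h1

/-- The properties of the characteristic polynomial of Frobenius used below. -/
structure FrobPolySpec (P : F[X][X]) (n : ℕ) (f : F[X]) (lam : F) : Prop where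
  monic : P.Monic
  natDegree : P.natDegree = n + 1
  coeff_zero : (-1) ^ (n + 1) * P.coeff 0 = C (((-1) ^ n * lam⁻¹) ^ f.natDegree) * f
  weight : ∀ m k, (P.coeff m).coeff k ≠ 0 →
    (n + 1) * k + f.natDegree * m ≤ (n + 1) * f.natDegree

theorem exists_frobPoly {κ : Fin (n + 2) → L} {lam : F}
    (hlam : κ (Fin.last (n + 1)) = algebraMap F L lam) {f : F[X]} (hf : f.Monic)
    (hirr : Irreducible f) (hroot : aeval (κ 0) f = 0)
    (hκd : ∀ i, κ i ^ Fintype.card F ^ f.natDegree = κ i) :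
    ∃ P : F[X][X], P.map (mapRingHom (algebraMap F L)) = (frobMatPow F κ f.natDegree).charpoly ∧
      FrobPolySpec P n f lam := by
  have hinj : Function.Injective (mapRingHom (algebraMap F L)) :=
    map_injective _ (algebraMap F L).injective
  obtain ⟨P, hP⟩ := exists_map_map_eq (map_coeffFrob_charpoly hκd)
  refine ⟨P, hP, ?_, ?_, ?_, ?_⟩
  · apply monic_of_injective hinj
    rw [hP]
    exact Matrix.charpoly_monic _
  · rw [← natDegree_map_eq_of_injective hinj, hP, Matrix.charpoly_natDegree_eq_dim, Fintype.card_fin]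
  · apply hinj
    have h := Matrix.det_eq_sign_charpoly_coeff (frobMatPow F κ f.natDegree)
    rw [← hP, coeff_map, Fintype.card_fin, det_frobMatPow κ hlam,
      prod_X_sub_C_pow_card_eq hf hirr hroot (hκd 0)] at h
    rw [map_mul, map_mul, map_pow, map_neg, map_one, ← h, coe_mapRingHom, map_C]
  · intro m k hk
    have h := charpoly_frobMatPow_mem (F := F) κ f.natDegree
    rw [← hP, RingFiltration.mem_poly] at h
    have h2 := mem_coeffFiltration.1 (h m) k
    rw [coeff_map, coe_mapRingHom, coeff_map, Ne, map_eq_zero] at h2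
    have h3 := h2 hk
    zify
    linarith

end FrobeniusPolynomial

section TateBasis

variable {R M : Type*} [CommRing R] [AddCommGroup M] [Module R M] {l : R}

theorem PrincipalCompletion.evalₐ_eq (c : PrincipalCompletion R l) (m : ℕ) :
    AdicCompletion.evalₐ (Ideal.span {l}) m c = Ideal.Quotient.mk _ (c.rep m) := by
  have h : (Ideal.span {l} ^ m • ⊤ : Ideal R) ≤ Ideal.span {l} ^ m := by simp
  rw [← AdicCompletion.factor_eval_eq_evalₐ _ c h]
  change Ideal.Quotient.factor h (c.val m) = _
  rw [← c.mkQ_rep m]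
  rfl

theorem PrincipalCompletion.eq_zero_of_dvd_rep {c : PrincipalCompletion R l}
    (h : ∀ m, l ^ m ∣ c.rep m) : c = 0 := by
  apply AdicCompletion.ext_evalₐ
  intro m
  rw [PrincipalCompletion.evalₐ_eq, map_zero, Ideal.Quotient.eq_zero_iff_mem,
    Ideal.span_singleton_pow, Ideal.mem_span_singleton]
  exact h m

theorem tateModule.sum_smul_apply {ι : Type*} [Fintype ι] (c : ι → PrincipalCompletion R l)
    (x : ι → tateModule R M l) (m : ℕ) :
    (∑ i, c i • x i).1 m = ∑ i, (c i).rep m • (x i).1 m := by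
  have h : (∑ i, c i • x i).1 = ∑ i, (c i • x i).1 := by
    rw [← Submodule.subtype_apply, map_sum]
    rfl
  rw [h, Finset.sum_apply]
  rfl

theorem tateModule.pow_smul_apply (x : tateModule R M l) (m e : ℕ) :
    l ^ e • x.1 (m + e) = x.1 m := by
  induction e with
  | zero => simp
  | succ e ih => rw [pow_succ, mul_smul, ← add_assoc, x.2.2, ih]

theorem tateModule.exists_apply_one (hsurj : ∀ y : M, ∃ z, l • z = y) {x : M} (hx : l • x = 0) :
    ∃ t : tateModule R M l, t.1 1 = x := by
  choose s hs using hsurj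
  let t : ℕ → M := fun m => Nat.rec x (fun _ y => s y) m
  have ht : ∀ m, l • t (m + 1) = t m := fun m => hs _
  have ht2 : ∀ m, l ^ (m + 1) • t m = 0 := by
    intro m
    induction m with
    | zero => simpa [t] using hx
    | succ m ih => rw [pow_succ, mul_smul, ht, ih]
  refine ⟨⟨fun m => Nat.casesOn m 0 t, ?_, ?_⟩, rfl⟩
  · intro m
    rcases m with _ | m
    · simp
    · exact ht2 m
  · intro m
    rcases m with _ | m
    · exact hx
    · exact ht m

variable {ι : Type*} [Fintype ι] {x : ι → tateModule R M l}

theorem tateModule.dvd_of_sum_eq_zero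
    (h1 : ∀ a : ι → R, ∑ j, a j • (x j).1 1 = 0 → ∀ j, l ∣ a j) (m : ℕ) {a : ι → R}
    (ha : ∑ j, a j • (x j).1 m = 0) (j : ι) : l ^ m ∣ a j := by
  induction m generalizing a with
  | zero => simp
  | succ m ih =>
    have h2 : ∑ j, a j • (x j).1 1 = 0 := by
      have h3 := congrArg (fun y => l ^ m • y) ha
      simp only [Finset.smul_sum, smul_zero] at h3
      rw [← h3]
      refine Finset.sum_congr rfl fun j _ => ?_
      rw [smul_comm, add_comm m 1, tateModule.pow_smul_apply]
    choose b hb using h1 a h2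
    have h4 : ∑ j, b j • (x j).1 m = 0 := by
      rw [← ha]
      refine Finset.sum_congr rfl fun j _ => ?_
      rw [hb j, mul_comm, mul_smul, (x j).2.2]
    rw [hb j, pow_succ']
    exact mul_dvd_mul_left _ (ih h4)

theorem tateModule.exists_sum_eq
    (h2 : ∀ y : M, l • y = 0 → ∃ a : ι → R, y = ∑ j, a j • (x j).1 1) (m : ℕ) {y : M}
    (hy : l ^ m • y = 0) : ∃ a : ι → R, y = ∑ j, a j • (x j).1 m := by
  induction m generalizing y with
  | zero =>
    rw [pow_zero, one_smul] at hy
    refine ⟨0, ?_⟩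
    simp [hy]
  | succ m ih =>
    obtain ⟨a, ha⟩ := h2 (l ^ m • y) (by rw [← mul_smul, ← pow_succ', hy])
    obtain ⟨b, hb⟩ := ih (y := y - ∑ j, a j • (x j).1 (m + 1)) (by
      rw [smul_sub, ha, Finset.smul_sum, sub_eq_zero]
      refine Finset.sum_congr rfl fun j _ => ?_
      rw [smul_comm, add_comm m 1, tateModule.pow_smul_apply])
    refine ⟨fun j => a j + l * b j, ?_⟩
    rw [sub_eq_iff_eq_add'] at hb
    rw [hb, ← Finset.sum_add_distrib]
    refine Finset.sum_congr rfl fun j _ => ?_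
    rw [add_smul, mul_comm, mul_smul, (x j).2.2]

/-- Lifts of a basis of the `l`-torsion form a basis of the Tate module. -/
theorem tateModule.exists_basis
    (h1 : ∀ a : ι → R, ∑ j, a j • (x j).1 1 = 0 → ∀ j, l ∣ a j)
    (h2 : ∀ y : M, l • y = 0 → ∃ a : ι → R, y = ∑ j, a j • (x j).1 1) :
    ∃ B : Module.Basis ι (PrincipalCompletion R l) (tateModule R M l), ⇑B = x := by
  have hli : LinearIndependent (PrincipalCompletion R l) x := by
    rw [Fintype.linearIndependent_iff]
    intro c hc j
    apply PrincipalCompletion.eq_zero_of_dvd_rep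
    intro m
    refine tateModule.dvd_of_sum_eq_zero h1 m ?_ j (a := fun j => (c j).rep m)
    rw [← tateModule.sum_smul_apply, hc]
    rfl
  have hspan : ⊤ ≤ Submodule.span (PrincipalCompletion R l) (Set.range x) := by
    intro y _
    have h3 := fun m => tateModule.exists_sum_eq h2 m (y.2.1 m)
    choose a ha using h3
    have hcomp : ∀ j m, a m j ≡ a (m + 1) j [SMOD (Ideal.span {l} ^ m • ⊤ : Submodule R R)] := by
      intro j m
      rw [SModEq.sub_mem]
      have h4 : l ^ m ∣ a m j - a (m + 1) j := by
        refine tateModule.dvd_of_sum_eq_zero h1 m ?_ j (a := fun j => a m j - a (m + 1) j)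
        simp only [sub_smul, Finset.sum_sub_distrib]
        rw [← ha m, sub_eq_zero, ← y.2.2 m, ha (m + 1), Finset.smul_sum]
        refine Finset.sum_congr rfl fun j _ => ?_
        rw [smul_comm, (x j).2.2]
      simpa [Ideal.span_singleton_pow, Ideal.mem_span_singleton] using h4
    let c : ι → PrincipalCompletion R l := fun j =>
      AdicCompletion.mk _ _ (AdicCompletion.AdicCauchySequence.mk _ _ (fun m => a m j) (hcomp j))
    have hy : y = ∑ j, c j • x j := by
      ext m
      rw [tateModule.sum_smul_apply, ha m]
      refine Finset.sum_congr rfl fun j _ => ?_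
      exact (tateModule.smul_apply (c j) (x j) m rfl).symm
    rw [hy]
    exact sum_mem fun j _ => Submodule.smul_mem _ _ (Submodule.subset_span ⟨j, rfl⟩)
  exact ⟨Module.Basis.mk hli hspan, Module.Basis.coe_mk hli hspan⟩

theorem PrincipalCompletion.map_charpoly_eq [DecidableEq ι] (B : Matrix ι ι (PrincipalCompletion R l))
    {P : R[X]} (h : ∀ m k, l ^ m ∣ ((Matrix.of fun i j => (B i j).rep m).charpoly - P).coeff k) :
    P.map (algebraMap R (PrincipalCompletion R l)) = B.charpoly := by
  refine Polynomial.ext fun k => AdicCompletion.ext_evalₐ fun m => ?_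
  have h1 : B.map (AdicCompletion.evalₐ (Ideal.span {l}) m : _ →+* _) =
      (Matrix.of fun i j => (B i j).rep m).map (Ideal.Quotient.mk (Ideal.span {l} ^ m)) := by
    ext1 i j
    exact PrincipalCompletion.evalₐ_eq _ _
  have h2 : AdicCompletion.evalₐ (Ideal.span {l}) m (B.charpoly.coeff k) =
      Ideal.Quotient.mk _ ((Matrix.of fun i j => (B i j).rep m).charpoly.coeff k) := by
    rw [← coeff_map, ← Matrix.charpoly_map, ← h1, Matrix.charpoly_map, coeff_map]
    rfl
  rw [h2, coeff_map, AlgHom.commutes, eq_comm, ← sub_eq_zero]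
  change Ideal.Quotient.mk _ _ - Ideal.Quotient.mk _ _ = _
  rw [← map_sub, ← coeff_sub, Ideal.Quotient.eq_zero_iff_mem,
    Ideal.span_singleton_pow, Ideal.mem_span_singleton]
  exact h m k

theorem PrincipalCompletion.algebraMap_injective [IsNoetherianRing R] [IsDomain R] (hl : ¬ IsUnit l) :
    Function.Injective (algebraMap R (PrincipalCompletion R l)) := by
  have : IsHausdorff (Ideal.span {l}) R := IsHausdorff.of_isDomain _ (by
    rwa [ne_eq, Ideal.span_singleton_eq_top])
  exact AdicCompletion.of_injective _ _

end TateBasis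

section Torsion

variable {F : Type*} [Field F] [Fintype F]

theorem natCard_quotient_span {l : F[X]} (hm : l.Monic) :
    Nat.card (F[X] ⧸ Ideal.span {l}) = Fintype.card F ^ l.natDegree := by
  have : Module.Finite F (AdjoinRoot l) := hm.finite_adjoinRoot
  have h1 := Module.natCard_eq_pow_finrank (K := F) (V := AdjoinRoot l)
  rw [(AdjoinRoot.powerBasis hm.ne_zero).finrank, AdjoinRoot.powerBasis_dim,
    Nat.card_eq_fintype_card (α := F)] at h1
  exact h1

theorem exists_torsion_basis_of_card {M : Type*} [AddCommGroup M] [Module F[X] M] {l : F[X]}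
    (hm : l.Monic) (hirr : Irreducible l) {N : ℕ}
    (hcard : Nat.card (Submodule.torsionBy F[X] M l) = Fintype.card F ^ (N * l.natDegree)) :
    ∃ b : Fin N → M, (∀ i, l • b i = 0) ∧
      (∀ a : Fin N → F[X], ∑ j, a j • b j = 0 → ∀ j, l ∣ a j) ∧
      ∀ y : M, l • y = 0 → ∃ a : Fin N → F[X], y = ∑ j, a j • b j := by
  have hmax : (Ideal.span {l}).IsMaximal := PrincipalIdealRing.isMaximal_of_irreducible hirr
  let _ : Field (F[X] ⧸ Ideal.span {l}) := Ideal.Quotient.field _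
  have hfin : Finite (Submodule.torsionBy F[X] M l) := by
    apply Nat.finite_of_card_ne_zero
    rw [hcard]
    exact pow_ne_zero _ Fintype.card_ne_zero
  have hfinQ : Module.Finite (F[X] ⧸ Ideal.span {l}) (Submodule.torsionBy F[X] M l) :=
    Module.Finite.of_finite
  have hrank : Module.finrank (F[X] ⧸ Ideal.span {l}) (Submodule.torsionBy F[X] M l) = N := by
    have h1 := Module.natCard_eq_pow_finrank (K := F[X] ⧸ Ideal.span {l})
      (V := Submodule.torsionBy F[X] M l)
    rw [hcard, natCard_quotient_span hm, ← pow_mul] at h1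
    have h2 := Nat.pow_right_injective (Fintype.one_lt_card (α := F)) h1
    rw [mul_comm] at h2
    exact (Nat.eq_of_mul_eq_mul_left hirr.natDegree_pos h2).symm
  let B := Module.finBasisOfFinrankEq (F[X] ⧸ Ideal.span {l}) (Submodule.torsionBy F[X] M l) hrank
  have hsum : ∀ a : Fin N → F[X], ((∑ j, Ideal.Quotient.mk (Ideal.span {l}) (a j) • B j :
      Submodule.torsionBy F[X] M l) : M) = ∑ j, a j • (B j : M) := by
    intro a
    rw [← Submodule.subtype_apply, map_sum]
    rfl
  refine ⟨fun i => B i, fun i => (Submodule.mem_torsionBy_iff _ _).1 (B i).2, ?_, ?_⟩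
  · intro a ha j
    have h1 : ∑ j, Ideal.Quotient.mk (Ideal.span {l}) (a j) • B j = 0 := by
      apply Subtype.ext
      rw [hsum, ha]
      rfl
    have h2 := Fintype.linearIndependent_iff.1 B.linearIndependent _ h1 j
    rwa [Ideal.Quotient.eq_zero_iff_mem, Ideal.mem_span_singleton] at h2
  · intro y hy
    choose a ha using fun j => Ideal.Quotient.mk_surjective (B.repr ⟨y, (Submodule.mem_torsionBy_iff _ _).2 hy⟩ j)
    refine ⟨a, ?_⟩
    rw [← hsum]
    simp only [ha]
    rw [B.sum_repr]

end Torsion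

section Reduction

variable {F : Type*} [Field F] [Fintype F] {n : ℕ}

/-- The coefficients of the reduction of `φ` modulo `f`. -/
def redCoeff (φ : GoodDrinfeldModule F (n + 1)) (f : MonicIrr F) (i : Fin (n + 2)) : ResClosure f :=
  algebraMap (ResField f) (ResClosure f) (AdjoinRoot.mk f.1 (φ.coeff i))

theorem twistOp_redCoeff (φ : GoodDrinfeldModule F (n + 1)) (f : MonicIrr F) :
    twistOp F (redCoeff φ f) = redOp φ f := rfl

omit [Fintype F] in
theorem algebraMap_mk_C (f : MonicIrr F) (c : F) :
    algebraMap (ResField f) (ResClosure f) (AdjoinRoot.mk f.1 (C c)) =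
      algebraMap F (ResClosure f) c := by
  rw [IsScalarTower.algebraMap_apply F (ResField f) (ResClosure f)]
  rfl

omit [Fintype F] in
theorem redCoeff_last (φ : GoodDrinfeldModule F (n + 1)) (f : MonicIrr F) :
    redCoeff φ f (Fin.last (n + 1)) = algebraMap F (ResClosure f) (φ.lead : F) := by
  rw [redCoeff, φ.coeff_last, algebraMap_mk_C]

omit [Fintype F] in
theorem redCoeff_last_ne_zero (φ : GoodDrinfeldModule F (n + 1)) (f : MonicIrr F) :
    redCoeff φ f (Fin.last (n + 1)) ≠ 0 := by
  rw [redCoeff_last, Ne, map_eq_zero]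
  exact φ.lead.ne_zero

omit [Fintype F] in
theorem aeval_redCoeff_zero (φ : GoodDrinfeldModule F (n + 1)) (f : MonicIrr F) (g : F[X]) :
    aeval (redCoeff φ f 0) g = algebraMap (ResField f) (ResClosure f) (AdjoinRoot.mk f.1 g) := by
  rw [redCoeff, φ.coeff_zero, AdjoinRoot.mk_X, aeval_algebraMap_apply, AdjoinRoot.aeval_eq]

omit [Fintype F] in
theorem aeval_redCoeff_zero_eq_zero_iff (φ : GoodDrinfeldModule F (n + 1)) (f : MonicIrr F)
    (g : F[X]) : aeval (redCoeff φ f 0) g = 0 ↔ f.1 ∣ g := by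
  rw [aeval_redCoeff_zero, map_eq_zero, AdjoinRoot.mk_eq_zero]

omit [Fintype F] in
theorem aeval_redCoeff_zero_ne_zero (φ : GoodDrinfeldModule F (n + 1)) {f l : MonicIrr F}
    (hl : l ≠ f) (m : ℕ) : aeval (redCoeff φ f 0) (l.1 ^ m) ≠ 0 := by
  rw [Ne, aeval_redCoeff_zero_eq_zero_iff]
  intro h
  have h1 := f.2.2.prime.dvd_of_dvd_pow h
  apply hl
  apply Subtype.ext
  exact (eq_of_monic_of_associated f.2.1 l.2.1 (f.2.2.associated_of_dvd l.2.2 h1)).symm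

theorem redCoeff_pow (φ : GoodDrinfeldModule F (n + 1)) (f : MonicIrr F) (i : Fin (n + 2)) :
    redCoeff φ f i ^ Fintype.card F ^ f.1.natDegree = redCoeff φ f i := by
  rw [← frobAut_apply]
  exact (frobAut f).commutes _

theorem smul_redModule_of (φ : GoodDrinfeldModule F (n + 1)) (f : MonicIrr F) (g : F[X])
    (x : ResClosure f) : g • Module.AEval'.of (redOp φ f) x =
      Module.AEval'.of (redOp φ f) (aeval (redOp φ f) g x) := rfl

theorem redModule_eq_of (φ : GoodDrinfeldModule F (n + 1)) (f : MonicIrr F) (y : RedModule φ f) :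
    Module.AEval'.of (redOp φ f) ((Module.AEval'.of (redOp φ f)).symm y) = y :=
  LinearEquiv.apply_symm_apply _ _

theorem smul_redModule_surjective (φ : GoodDrinfeldModule F (n + 1)) (f : MonicIrr F) {g : F[X]}
    (hg : g ≠ 0) (y : RedModule φ f) : ∃ z, g • z = y := by
  obtain ⟨x, hx⟩ := aeval_twistOp_surjective (Nat.succ_ne_zero n) (redCoeff_last_ne_zero φ f) hg
    ((Module.AEval'.of (redOp φ f)).symm y)
  refine ⟨Module.AEval'.of (redOp φ f) x, ?_⟩
  rw [smul_redModule_of, ← twistOp_redCoeff, hx, twistOp_redCoeff, redModule_eq_of]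

theorem smul_eq_zero_iff_mem_twistKer (φ : GoodDrinfeldModule F (n + 1)) (f : MonicIrr F) (g : F[X])
    (y : RedModule φ f) :
    g • y = 0 ↔ (Module.AEval'.of (redOp φ f)).symm y ∈ twistKer (redCoeff φ f) g := by
  rw [mem_twistKer, twistOp_redCoeff]
  conv_lhs => rw [← redModule_eq_of φ f y, smul_redModule_of]
  exact LinearEquiv.map_eq_zero_iff _

/-- A basis of the `l`-torsion of the reduction. -/
theorem exists_torsion_basis (φ : GoodDrinfeldModule F (n + 1)) {f l : MonicIrr F} (hl : l ≠ f) :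
    ∃ b : Fin (n + 1) → RedModule φ f, (∀ i, l.1 • b i = 0) ∧
      (∀ a : Fin (n + 1) → F[X], ∑ j, a j • b j = 0 → ∀ j, l.1 ∣ a j) ∧
      ∀ y : RedModule φ f, l.1 • y = 0 → ∃ a : Fin (n + 1) → F[X], y = ∑ j, a j • b j := by
  apply exists_torsion_basis_of_card l.2.1 l.2.2
  have h0 := aeval_redCoeff_zero_ne_zero φ hl 1
  rw [pow_one] at h0
  rw [← natCard_twistKer (Nat.succ_ne_zero n) (redCoeff_last_ne_zero φ f) h0]
  refine Nat.card_congr ((Module.AEval'.of (redOp φ f)).symm.toEquiv.subtypeEquiv fun y => ?_)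
  rw [Submodule.mem_torsionBy_iff]
  exact smul_eq_zero_iff_mem_twistKer φ f l.1 y

theorem exists_tate_basis (φ : GoodDrinfeldModule F (n + 1)) {f : MonicIrr F} {P : F[X][X]}
    (hP : P.map (mapRingHom (algebraMap F (ResClosure f))) =
      (frobMatPow F (redCoeff φ f) f.1.natDegree).charpoly) {l : MonicIrr F} (hl : l ≠ f) :
    ∃ B : Module.Basis (Fin (n + 1)) (PrincipalCompletion F[X] l.1) (RedTate φ f l),
      P.map (algebraMap F[X] (PrincipalCompletion F[X] l.1)) =
        (LinearMap.toMatrix B B (frobTate φ f l).toLinearMap).charpoly := by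
  obtain ⟨b, hb0, hb1, hb2⟩ := exists_torsion_basis φ hl
  choose x hx using fun i => tateModule.exists_apply_one
    (smul_redModule_surjective φ f l.2.1.ne_zero) (hb0 i)
  simp only [← hx] at hb1 hb2
  obtain ⟨B, hB⟩ := tateModule.exists_basis hb1 hb2
  refine ⟨B, PrincipalCompletion.map_charpoly_eq _ ?_⟩
  set N := LinearMap.toMatrix B B (frobTate φ f l).toLinearMap with hN
  intro m k
  rcases Nat.eq_zero_or_pos m with rfl | hm
  · simp
  have hfrob : ∀ j, frobTate φ f l (x j) = ∑ i, N i j • x i := by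
    intro j
    have h1 := B.sum_repr (frobTate φ f l (B j))
    rw [hB] at h1
    rw [← h1]
    refine Finset.sum_congr rfl fun i _ => ?_
    rw [hN, LinearMap.toMatrix_apply, hB]
    rfl
  let e := (Module.AEval'.of (redOp φ f)).symm
  have hsum : ∀ a : Fin (n + 1) → F[X], e (∑ j, a j • (x j).1 m) =
      ∑ j, aeval (twistOp F (redCoeff φ f)) (a j) (e ((x j).1 m)) := by
    intro a
    rw [map_sum]
    refine Finset.sum_congr rfl fun j _ => ?_
    exact Module.AEval.of_symm_smul _ _ _
  have hlev : ∀ j, e ((x j).1 m) ^ Fintype.card F ^ f.1.natDegree =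
      ∑ i, aeval (twistOp F (redCoeff φ f)) ((N i j).rep m) (e ((x i).1 m)) := by
    intro j
    have h1 := congrArg (fun y : RedTate φ f l => e (y.1 m)) (hfrob j)
    simp only [tateModule.sum_smul_apply] at h1
    rw [hsum] at h1
    rw [← h1, ← frobAut_apply]
    rfl
  have hmain := map_charpoly_eq (g := l.1 ^ m) (redCoeff_last_ne_zero φ f) (redCoeff_pow φ f)
    (l.2.1.pow m) (by
      rw [natDegree_pow]
      exact mul_ne_zero hm.ne' l.2.2.natDegree_pos.ne') (aeval_redCoeff_zero_ne_zero φ hl m)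
    (x := fun j => e ((x j).1 m))
    (fun j => (smul_eq_zero_iff_mem_twistKer φ f _ _).1 ((x j).2.1 m))
    (fun y hy => by
      have h1 : l.1 ^ m • e.symm y = 0 := by
        rw [smul_eq_zero_iff_mem_twistKer]
        simpa [e] using hy
      obtain ⟨a, ha⟩ := tateModule.exists_sum_eq hb2 m h1
      refine ⟨a, ?_⟩
      rw [← hsum, ← ha, LinearEquiv.apply_symm_apply])
    (b := Matrix.of fun i j => (N i j).rep m) hlev
  rw [← modHom_eq_zero_iff (L := ResClosure f), coeff_sub, map_sub, ← coeff_map, hmain, ← hP,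
    coeff_map, coeff_map, sub_eq_zero]
  rfl

end Reduction

section DualCharpoly

theorem C_det_mul_charpoly_eq {R ι : Type*} [CommRing R] [Fintype ι] [DecidableEq ι]
    {A B : Matrix ι ι R} (h : A * B = 1) :
    C (A.charpoly.coeff 0) * B.charpoly = A.charpoly.reverse := by
  have h0 : A.charpoly.coeff 0 = (-1) ^ Fintype.card ι * A.det := by
    rw [Matrix.det_eq_sign_charpoly_coeff, ← mul_assoc, ← mul_pow]
    simp
  have h1 : A.map (C : R →+* R[X]) * B.charmatrix = -(1 - (X : R[X]) • A.map C) := by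
    rw [Matrix.charmatrix, mul_sub, RingHom.mapMatrix_apply, ← Matrix.map_mul, h]
    rw [Matrix.map_one _ (map_zero _) (map_one _), neg_sub]
    congr 1
    apply Matrix.ext
    intro i j
    rw [Matrix.scalar_apply, Matrix.mul_diagonal, Matrix.smul_apply, smul_eq_mul, mul_comm]
  have h2 := congrArg Matrix.det h1
  rw [Matrix.det_mul, ← RingHom.mapMatrix_apply, ← RingHom.map_det, Matrix.det_neg] at h2
  rw [Matrix.reverse_charpoly, Matrix.charpolyRev, h0, C_mul, mul_assoc, Matrix.charpoly, h2,
    ← mul_assoc]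
  simp [← mul_pow]

theorem charpoly_dualMap {R M ι : Type*} [CommRing R] [AddCommGroup M] [Module R M] [Module.Free R M]
    [Module.Finite R M] [Fintype ι] [DecidableEq ι] (B : Module.Basis ι R M) (e : M →ₗ[R] M) :
    e.dualMap.charpoly = (LinearMap.toMatrix B B e).charpoly := by
  rw [← LinearMap.charpoly_toMatrix e.dualMap B.dualBasis, LinearMap.dualMap_def,
    LinearMap.toMatrix_transpose, Matrix.charpoly_transpose]

theorem charpoly_mul_eq_of_basis {R M ι : Type*} [CommRing R] [AddCommGroup M] [Module R M]
    [Module.Free R M] [Module.Finite R M] [Fintype ι] [DecidableEq ι] (B : Module.Basis ι R M)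
    (e : M ≃ₗ[R] M) {p : R[X]} (hp : p = (LinearMap.toMatrix B B e.toLinearMap).charpoly) :
    p = e.toLinearMap.charpoly ∧ p.reverse = C (p.coeff 0) * e.symm.dualMap.toLinearMap.charpoly := by
  refine ⟨hp.trans (LinearMap.charpoly_toMatrix _ B), ?_⟩
  have hmul : LinearMap.toMatrix B B e.toLinearMap * LinearMap.toMatrix B B e.symm.toLinearMap = 1 := by
    rw [← LinearMap.toMatrix_mul, ← LinearMap.toMatrix_one B]
    congr 1
    ext1 x
    exact e.apply_symm_apply x
  rw [hp, ← C_det_mul_charpoly_eq hmul, ← charpoly_dualMap B e.symm.toLinearMap]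
  rfl

theorem tateModule.charpoly_eq {R M ι : Type*} [CommRing R] [AddCommGroup M] [Module R M] {l : R}
    [Module.Free (PrincipalCompletion R l) (tateModule R M l)]
    [Module.Finite (PrincipalCompletion R l) (tateModule R M l)] [Fintype ι] [DecidableEq ι]
    (B : Module.Basis ι (PrincipalCompletion R l) (tateModule R M l)) (e : M ≃ₗ[R] M)
    {p : (PrincipalCompletion R l)[X]}
    (hp : p = (LinearMap.toMatrix B B (tateEquiv l e).toLinearMap).charpoly) :
    p = LinearMap.charpoly (M := tateModule R M l) (tateEquiv l e).toLinearMap ∧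
      p.reverse = C (p.coeff 0) * ((tateEquiv l e).symm.dualMap).toLinearMap.charpoly :=
  charpoly_mul_eq_of_basis B (tateEquiv l e) hp

theorem map_reverse_of_injective {R S : Type*} [CommRing R] [CommRing S] {g : R →+* S}
    (hg : Function.Injective g) (p : R[X]) : p.reverse.map g = (p.map g).reverse := by
  rw [reverse, reverse, natDegree_map_eq_of_injective hg, ← reflect_map]

end DualCharpoly

section Charpoly

variable {F : Type*} [Field F] [Fintype F] {n : ℕ}

omit [Fintype F] in
theorem exists_monicIrr_ne (f : MonicIrr F) : ∃ l : MonicIrr F, l ≠ f := by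
  by_cases h : f.1 = X
  · refine ⟨⟨X - C 1, monic_X_sub_C 1, irreducible_X_sub_C 1⟩, fun h1 => ?_⟩
    have h2 := congrArg (fun p : MonicIrr F => p.1.eval 0) h1
    simp [h] at h2
  · exact ⟨⟨X, monic_X, irreducible_X⟩, fun h1 => h (congrArg Subtype.val h1).symm⟩

omit [Fintype F] in
theorem algebraMap_completion_injective (l : MonicIrr F) :
    Function.Injective (algebraMap F[X] (PrincipalCompletion F[X] l.1)) :=
  PrincipalCompletion.algebraMap_injective l.2.2.not_isUnit

theorem IsFrobCharpoly.unique {φ : GoodDrinfeldModule F (n + 1)} {f l : MonicIrr F} {P Q : F[X][X]}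
    (hP : IsFrobCharpoly φ f l P) (hQ : IsFrobCharpoly φ f l Q) : P = Q := by
  obtain ⟨_, _, h1⟩ := hP
  obtain ⟨_, _, h2⟩ := hQ
  exact map_injective _ (algebraMap_completion_injective l) (h1.trans h2.symm)

theorem IsDualFrobCharpoly.unique {φ : GoodDrinfeldModule F (n + 1)} {f l : MonicIrr F}
    {P Q : (FractionRing F[X])[X]}
    (hP : IsDualFrobCharpoly φ f l P) (hQ : IsDualFrobCharpoly φ f l Q) : P = Q := by
  obtain ⟨_, _, a, p, ha, h1, h2⟩ := hP
  obtain ⟨_, _, b, q, hb, h3, h4⟩ := hQ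
  have h5 : C b * p = C a * q := by
    apply map_injective _ (algebraMap_completion_injective l)
    rw [Polynomial.map_mul, Polynomial.map_mul, map_C, map_C, h2, h4]
    ring
  have hinj := IsFractionRing.injective F[X] (FractionRing F[X])
  have ha' : (C (algebraMap F[X] (FractionRing F[X]) a)) ≠ 0 := by
    rw [Ne, C_eq_zero, map_eq_zero_iff _ hinj]
    exact ha
  have hb' : (C (algebraMap F[X] (FractionRing F[X]) b)) ≠ 0 := by
    rw [Ne, C_eq_zero, map_eq_zero_iff _ hinj]
    exact hb
  apply mul_left_cancel₀ (mul_ne_zero hb' ha')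
  have h6 := congrArg (Polynomial.map (algebraMap F[X] (FractionRing F[X]))) h5
  rw [Polynomial.map_mul, Polynomial.map_mul, map_C, map_C, h1, h3] at h6
  rw [mul_assoc, h6]
  ring

/-- The monic polynomial whose roots are the inverses of the roots of `P`. -/
def invPoly (P : F[X][X]) : (FractionRing F[X])[X] :=
  C (algebraMap F[X] (FractionRing F[X]) (P.coeff 0))⁻¹ *
    (P.map (algebraMap F[X] (FractionRing F[X]))).reverse

omit [Fintype F] in
theorem FrobPolySpec.coeff_zero_eq {P : F[X][X]} {f : F[X]} {lam : F} (h : FrobPolySpec P n f lam) :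
    P.coeff 0 = C ((-1) ^ (n + 1) * ((-1) ^ n * lam⁻¹) ^ f.natDegree) * f := by
  rw [C_mul, mul_assoc, ← h.coeff_zero, C_pow, ← mul_assoc, ← mul_pow]
  simp

omit [Fintype F] in
theorem FrobPolySpec.coeff_zero_ne_zero {P : F[X][X]} {f : F[X]} {lam : F}
    (h : FrobPolySpec P n f lam) (hf : f ≠ 0) (hlam : lam ≠ 0) : P.coeff 0 ≠ 0 := by
  rw [h.coeff_zero_eq]
  refine mul_ne_zero ?_ hf
  rw [Ne, C_eq_zero]
  simp [hlam]

theorem exists_isFrobCharpoly (φ : GoodDrinfeldModule F (n + 1)) (f : MonicIrr F) :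
    ∃ P, FrobPolySpec P n f.1 (φ.lead : F) ∧ (∀ l : MonicIrr F, l ≠ f → IsFrobCharpoly φ f l P) ∧
      ∀ l : MonicIrr F, l ≠ f → IsDualFrobCharpoly φ f l (invPoly P) := by
  obtain ⟨P, hP, hspec⟩ := exists_frobPoly (redCoeff_last φ f) f.2.1 f.2.2
    ((aeval_redCoeff_zero_eq_zero_iff φ f f.1).2 dvd_rfl) (redCoeff_pow φ f)
  have hinj := IsFractionRing.injective F[X] (FractionRing F[X])
  have h0 : P.coeff 0 ≠ 0 := hspec.coeff_zero_ne_zero f.2.1.ne_zero φ.lead.ne_zero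
  refine ⟨P, hspec, fun l hl => ?_, fun l hl => ?_⟩
  · obtain ⟨B, hB⟩ := exists_tate_basis φ hP hl
    have hfree : Module.Free (PrincipalCompletion F[X] l.1) (RedTate φ f l) := Module.Free.of_basis B
    have hfin : Module.Finite (PrincipalCompletion F[X] l.1) (RedTate φ f l) := Module.Finite.of_basis B
    exact ⟨hfree, hfin, (tateModule.charpoly_eq B (frobRed φ f) hB).1⟩
  · obtain ⟨B, hB⟩ := exists_tate_basis φ hP hl
    have hfree : Module.Free (PrincipalCompletion F[X] l.1) (RedTate φ f l) := Module.Free.of_basis B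
    have hfin : Module.Finite (PrincipalCompletion F[X] l.1) (RedTate φ f l) := Module.Finite.of_basis B
    refine ⟨hfree, hfin, P.coeff 0, P.reverse, h0, ?_, ?_⟩
    · rw [map_reverse_of_injective hinj, invPoly, ← mul_assoc, ← C_mul, mul_inv_cancel₀, C_1, one_mul]
      rwa [Ne, map_eq_zero_iff _ hinj]
    · have h1 := (tateModule.charpoly_eq B (frobRed φ f) hB).2
      rwa [coeff_map, ← map_reverse_of_injective (algebraMap_completion_injective l)] at h1

theorem frobCharpoly_spec (φ : GoodDrinfeldModule F (n + 1)) (f : MonicIrr F) :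
    FrobPolySpec (frobCharpoly φ f) n f.1 (φ.lead : F) ∧
      dualFrobCharpoly φ f = invPoly (frobCharpoly φ f) := by
  obtain ⟨P, hspec, hP, hPd⟩ := exists_isFrobCharpoly φ f
  obtain ⟨l, hl⟩ := exists_monicIrr_ne f
  have h1 : ∀ l : MonicIrr F, l ≠ f → IsFrobCharpoly φ f l (frobCharpoly φ f) :=
    Classical.epsilon_spec (p := fun P => ∀ l : MonicIrr F, l ≠ f → IsFrobCharpoly φ f l P) ⟨P, hP⟩
  have h2 : ∀ l : MonicIrr F, l ≠ f → IsDualFrobCharpoly φ f l (dualFrobCharpoly φ f) :=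
    Classical.epsilon_spec (p := fun P => ∀ l : MonicIrr F, l ≠ f → IsDualFrobCharpoly φ f l P)
      ⟨_, hPd⟩
  have h3 := (h1 l hl).unique (hP l hl)
  have h4 := (h2 l hl).unique (hPd l hl)
  rw [h4, h3]
  exact ⟨hspec, rfl⟩

end Charpoly

section Reverse

theorem reverse_X_sub_C {R : Type*} [CommRing R] [Nontrivial R] (a : R) :
    (X - C a).reverse = 1 - C a * X := by
  have h : reflect 1 (X : R[X]) = 1 := by
    have := reflect_monomial (R := R) 1 1
    rwa [pow_one, revAt_le le_rfl, Nat.sub_self, pow_zero] at this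
  rw [reverse, natDegree_X_sub_C, reflect_sub, reflect_C, pow_one, h]

theorem reverse_prod {R ι : Type*} [CommRing R] [IsDomain R] (s : Finset ι) (p : ι → R[X]) :
    (∏ i ∈ s, p i).reverse = ∏ i ∈ s, (p i).reverse := by
  classical
  induction s using Finset.induction_on with
  | empty =>
    rw [Finset.prod_empty, Finset.prod_empty, ← C_1, reverse_C]
  | insert i s hi ih => rw [Finset.prod_insert hi, Finset.prod_insert hi, reverse_mul_of_domain, ih]

theorem exists_eq_prod_X_sub_C {k : Type*} [Field k] [IsAlgClosed k] {p : k[X]} (hp : p.Monic) {d : ℕ}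
    (hd : p.natDegree = d) :
    ∃ a : Fin d → k, p = ∏ i, (X - C (a i)) ∧ p.roots = Finset.univ.val.map a := by
  have h := IsAlgClosed.splits p
  have hc : p.roots.card = d := by
    rw [← hd]
    exact h.natDegree_eq_card_roots.symm
  obtain ⟨l, hl⟩ : ∃ l : List k, (l : Multiset k) = p.roots := ⟨_, Multiset.coe_toList _⟩
  have hlen : l.length = d := by
    rw [← hc, ← hl, Multiset.coe_card]
  subst hlen
  have h2 : p.roots = Finset.univ.val.map l.get := by
    rw [← hl, Fin.univ_val_map, List.ofFn_get]
  refine ⟨l.get, ?_, h2⟩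
  have h3 := h.eq_prod_roots_of_monic hp
  rw [h2, Multiset.map_map] at h3
  exact h3

end Reverse

section Tensor

variable {k : Type*} [Field k] {n : ℕ}

/-- The series of products of Schur functions in the roots of two polynomials. -/
def remSeries (n : ℕ) (P Q : k[X]) : PowerSeries k :=
  PowerSeries.mk fun N => ∑ e ∈ weightFiber n N, remDet P (schurExp e) * remDet Q (schurExp e)

theorem remDet_zero_schurExp {P : k[X]} (hP : P.Monic) (hd : P.natDegree = n + 1) :
    remDet P (schurExp (0 : Fin n → ℕ)) = 1 := by
  have h : ∀ i : Fin (n + 1), (X ^ schurExp (0 : Fin n → ℕ) i : k[X]) %ₘ P = X ^ (n - (i : ℕ)) := by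
    intro i
    have h1 : schurExp (0 : Fin n → ℕ) i = n - (i : ℕ) := by simp [schurExp]
    rw [h1, (modByMonic_eq_self_iff hP).2]
    rw [degree_eq_natDegree hP.ne_zero, hd, degree_X_pow]
    exact_mod_cast (by omega : n - (i : ℕ) < n + 1)
  rw [remDet, ← Matrix.det_one (n := Fin (n + 1))]
  congr 1
  ext i j
  rw [Matrix.of_apply, h, coeff_X_pow, Matrix.one_apply]
  refine if_congr ?_ rfl rfl
  rw [Fin.ext_iff]
  omega

theorem remSeries_mul_reverse_polyTensor {P Q : k[X]} (hP : P.Monic) (hQ : Q.Monic)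
    (hPd : P.natDegree = n + 1) (hQd : Q.natDegree = n + 1) :
    remSeries n P Q * ((polyTensor P Q).reverse : PowerSeries k) =
      1 - PowerSeries.C (P.coeff 0 * Q.coeff 0) * PowerSeries.X ^ (n + 1) := by
  set L := AlgebraicClosure k
  have hinj := (algebraMap k L).injective
  obtain ⟨a, ha, ha'⟩ := exists_eq_prod_X_sub_C (hP.map (algebraMap k L))
    ((natDegree_map_eq_of_injective hinj P).trans hPd)
  obtain ⟨b, hb, hb'⟩ := exists_eq_prod_X_sub_C (hQ.map (algebraMap k L))
    ((natDegree_map_eq_of_injective hinj Q).trans hQd)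
  set T : L[X] := ∏ p : Fin (n + 1) × Fin (n + 1), (X - C (a p.1 * b p.2)) with hT
  have hTp : ((P.aroots L ×ˢ Q.aroots L).map fun p => X - C (p.1 * p.2)).prod = T := by
    rw [aroots, aroots, ha', hb', hT, Multiset.prod_map_product_eq_prod_prod, Fintype.prod_prod_type,
      Multiset.map_map]
    refine congrArg Multiset.prod (Multiset.map_congr rfl fun i _ => ?_)
    rw [Function.comp_apply, Multiset.map_map]
    rfl
  have hTr : (T.reverse : PowerSeries L) =
      ∏ j, ∏ i, (1 - PowerSeries.C (a i * b j) * PowerSeries.X) := by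
    rw [hT, reverse_prod, Fintype.prod_prod_type_right]
    simp only [reverse_X_sub_C]
    rw [← Polynomial.coeToPowerSeries.ringHom_apply, map_prod]
    refine Finset.prod_congr rfl fun j _ => ?_
    rw [map_prod]
    refine Finset.prod_congr rfl fun i _ => ?_
    simp
  have hser : schurSeries a b = PowerSeries.map (algebraMap k L) (remSeries n P Q) := by
    ext N
    rw [PowerSeries.coeff_map, schurSeries, remSeries, PowerSeries.coeff_mk, PowerSeries.coeff_mk,
      map_sum]
    refine Finset.sum_congr rfl fun e _ => ?_
    rw [map_mul, map_remDet _ hP, map_remDet _ hQ, ha, hb, aeval_schurPoly, aeval_schurPoly]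
  have hc0 : (∏ i, a i) * ∏ i, b i = algebraMap k L (P.coeff 0 * Q.coeff 0) := by
    rw [map_mul, ← coeff_map, ← coeff_map, ha, hb, coeff_zero_eq_eval_zero, coeff_zero_eq_eval_zero,
      eval_prod, eval_prod]
    simp only [eval_sub, eval_X, eval_C, zero_sub, Finset.prod_neg]
    rw [mul_mul_mul_comm, ← mul_pow]
    simp
  have hmain : PowerSeries.map (algebraMap k L) (remSeries n P Q) * (T.reverse : PowerSeries L) =
      PowerSeries.map (algebraMap k L)
        (1 - PowerSeries.C (P.coeff 0 * Q.coeff 0) * PowerSeries.X ^ (n + 1)) := by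
    rw [hTr, ← hser, schurSeries_mul, hc0]
    simp
  have hunit : PowerSeries.constantCoeff (remSeries n P Q) ≠ 0 := by
    rw [← PowerSeries.coeff_zero_eq_constantCoeff_apply, remSeries, PowerSeries.coeff_mk]
    have : weightFiber n 0 = {0} := by
      ext e
      rw [mem_weightFiber, schurWeight, Finset.mem_singleton, funext_iff]
      simp
    rw [this, Finset.sum_singleton, remDet_zero_schurExp hP hPd, remDet_zero_schurExp hQ hQd]
    simp
  have hTrev : (T.reverse : PowerSeries L) = PowerSeries.map (algebraMap k L)
      ((remSeries n P Q)⁻¹ *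
        (1 - PowerSeries.C (P.coeff 0 * Q.coeff 0) * PowerSeries.X ^ (n + 1))) := by
    rw [map_mul, ← hmain, ← mul_assoc, ← map_mul, PowerSeries.inv_mul_cancel _ hunit, map_one, one_mul]
  have hlift : T ∈ lifts (algebraMap k L) := by
    rw [lifts_iff_coeff_lifts]
    intro m
    have h1 := congrArg (PowerSeries.coeff (revAt T.natDegree m)) hTrev
    rw [Polynomial.coeff_coe, coeff_reverse, revAt_invol, PowerSeries.coeff_map] at h1
    exact ⟨_, h1.symm⟩
  obtain ⟨R, hR⟩ := (mem_lifts _).1 hlift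
  have hspec : (polyTensor P Q).map (algebraMap k L) = T := by
    rw [← hTp]
    exact Classical.epsilon_spec (p := fun R : k[X] => R.map (algebraMap k L) =
      ((P.aroots L ×ˢ Q.aroots L).map fun p => X - C (p.1 * p.2)).prod) ⟨R, hR.trans hTp.symm⟩
  apply PowerSeries.map_injective _ hinj
  rw [map_mul, ← hmain, ← hspec, ← map_reverse_of_injective hinj, Polynomial.polynomial_map_coe]

end Tensor

section Integrality

theorem isIntegral_aeval_mul_pow {A B σ : Type*} [CommRing A] [CommRing B] [Algebra A B] [Algebra ℤ B]
    [Fintype σ]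
    {p : MvPolynomial σ ℤ} {N : ℕ} (hp : ∀ j, p.degreeOf j ≤ N) {x y : σ → B}
    (hxy : ∀ j, x j * y j = 1) (hy : ∀ j, IsIntegral A (y j)) :
    IsIntegral A (MvPolynomial.aeval x p * (∏ j, y j) ^ N) := by
  rw [MvPolynomial.aeval_def, MvPolynomial.eval₂_eq', Finset.sum_mul]
  refine IsIntegral.sum _ fun e he => ?_
  have h : (∏ j, x j ^ e j) * (∏ j, y j) ^ N = ∏ j, y j ^ (N - e j) := by
    rw [← Finset.prod_pow, ← Finset.prod_mul_distrib]
    refine Finset.prod_congr rfl fun j _ => ?_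
    have h1 : e j ≤ N := (MvPolynomial.degreeOf_le_iff.1 (hp j)) e he
    obtain ⟨c, rfl⟩ := Nat.exists_eq_add_of_le h1
    rw [pow_add, ← mul_assoc, ← mul_pow, hxy, one_pow, one_mul, Nat.add_sub_cancel_left]
  rw [mul_assoc, h]
  refine IsIntegral.mul ?_ (IsIntegral.prod _ fun j _ => (hy j).pow _)
  rw [eq_intCast (algebraMap ℤ B), ← map_intCast (algebraMap A B)]
  exact isIntegral_algebraMap

theorem aeval_schurPoly_eq_remDet {R : Type*} [CommRing R] [inst : Algebra ℤ R] {n : ℕ}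
    (x : Fin (n + 1) → R) (k : Fin n → ℕ) :
    MvPolynomial.aeval x (schurPoly (n + 1) k) = remDet (∏ i, (X - C (x i))) (schurExp k) := by
  rw [Subsingleton.elim inst (Ring.toIntAlgebra R)]
  exact aeval_schurPoly x k

end Integrality

section InvPoly

variable {F : Type*} [Field F] [Fintype F] {n : ℕ}

omit [Fintype F] in
theorem map_invPoly_eq {L : Type*} [Field L] [Algebra F[X] L] [Algebra (FractionRing F[X]) L]
    [IsScalarTower F[X] (FractionRing F[X]) L] {P : F[X][X]} (h0 : P.coeff 0 ≠ 0)
    {b : Fin (n + 1) → L} (hb : P.map (algebraMap F[X] L) = ∏ i, (X - C (b i))) :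
    (∀ i, b i ≠ 0) ∧
      (invPoly P).map (algebraMap (FractionRing F[X]) L) = ∏ i, (X - C (b i)⁻¹) := by
  have hinj : Function.Injective (algebraMap F[X] L) := by
    rw [IsScalarTower.algebraMap_eq F[X] (FractionRing F[X]) L]
    exact (algebraMap (FractionRing F[X]) L).injective.comp
      (IsFractionRing.injective F[X] (FractionRing F[X]))
  have hc : algebraMap F[X] L (P.coeff 0) = ∏ i, (-b i) := by
    rw [← coeff_map, hb, coeff_zero_eq_eval_zero, eval_prod]
    simp
  have hc0 : ∏ i, (-b i) ≠ 0 := by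
    rw [← hc, Ne, map_eq_zero_iff _ hinj]
    exact h0
  have hb0 : ∀ i, b i ≠ 0 := fun i => neg_ne_zero.1 (Finset.prod_ne_zero_iff.1 hc0 i (Finset.mem_univ i))
  refine ⟨hb0, ?_⟩
  rw [invPoly, Polynomial.map_mul, map_C,
    map_reverse_of_injective (algebraMap (FractionRing F[X]) L).injective, map_map,
    ← IsScalarTower.algebraMap_eq, hb, reverse_prod, map_inv₀, ← IsScalarTower.algebraMap_apply, hc,
    ← Finset.prod_inv_distrib, map_prod, ← Finset.prod_mul_distrib]
  refine Finset.prod_congr rfl fun i _ => ?_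
  rw [reverse_X_sub_C, mul_sub, ← mul_assoc, ← C_mul, mul_one, inv_neg, neg_mul,
    inv_mul_cancel₀ (hb0 i), C_neg, C_neg, C_1]
  ring

omit [Fintype F] in
theorem invPoly_monic {P : F[X][X]} (h0 : P.coeff 0 ≠ 0) : (invPoly P).Monic := by
  have hinj := IsFractionRing.injective F[X] (FractionRing F[X])
  have h1 : (P.map (algebraMap F[X] (FractionRing F[X]))).coeff 0 ≠ 0 := by
    rw [coeff_map, Ne, map_eq_zero_iff _ hinj]
    exact h0
  rw [Monic, invPoly, leadingCoeff_mul, leadingCoeff_C, reverse_leadingCoeff,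
    trailingCoeff_eq_coeff_zero h1, coeff_map, inv_mul_cancel₀]
  rwa [coeff_map] at h1

omit [Fintype F] in
theorem natDegree_invPoly {P : F[X][X]} (h0 : P.coeff 0 ≠ 0) : (invPoly P).natDegree = P.natDegree := by
  have hinj := IsFractionRing.injective F[X] (FractionRing F[X])
  have h1 : (P.map (algebraMap F[X] (FractionRing F[X]))).coeff 0 ≠ 0 := by
    rw [coeff_map, Ne, map_eq_zero_iff _ hinj]
    exact h0
  rw [invPoly, natDegree_C_mul, reverse_natDegree, natTrailingDegree_eq_zero.2 (Or.inr h1),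
    Nat.sub_zero, natDegree_map_eq_of_injective hinj]
  rw [coeff_map] at h1
  exact inv_ne_zero h1

omit [Fintype F] in
theorem coeff_invPoly {P : F[X][X]} (hP : P.natDegree = n + 1) {m : ℕ} (hm : m ≤ n + 1) :
    (invPoly P).coeff m = algebraMap F[X] (FractionRing F[X]) (P.coeff (n + 1 - m)) /
      algebraMap F[X] (FractionRing F[X]) (P.coeff 0) := by
  have hinj := IsFractionRing.injective F[X] (FractionRing F[X])
  rw [invPoly, coeff_C_mul, coeff_reverse, natDegree_map_eq_of_injective hinj, hP, revAt_le hm,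
    coeff_map, div_eq_inv_mul]

end InvPoly

section MuNu

variable {F : Type*} [Field F] [Fintype F] {n : ℕ}

theorem frobCharpoly_coeff_zero_ne_zero (φ : GoodDrinfeldModule F (n + 1)) (f : MonicIrr F) :
    (frobCharpoly φ f).coeff 0 ≠ 0 :=
  (frobCharpoly_spec φ f).1.coeff_zero_ne_zero f.2.1.ne_zero φ.lead.ne_zero

theorem dualFrobCharpoly_monic (φ : GoodDrinfeldModule F (n + 1)) (f : MonicIrr F) :
    (dualFrobCharpoly φ f).Monic := by
  rw [(frobCharpoly_spec φ f).2]
  exact invPoly_monic (frobCharpoly_coeff_zero_ne_zero φ f)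

theorem natDegree_dualFrobCharpoly (φ : GoodDrinfeldModule F (n + 1)) (f : MonicIrr F) :
    (dualFrobCharpoly φ f).natDegree = n + 1 := by
  rw [(frobCharpoly_spec φ f).2, natDegree_invPoly (frobCharpoly_coeff_zero_ne_zero φ f),
    (frobCharpoly_spec φ f).1.natDegree]

theorem exists_roots_frobCharpoly (φ : GoodDrinfeldModule F (n + 1)) (f : MonicIrr F) :
    ∃ b : Fin (n + 1) → AlgebraicClosure (FractionRing F[X]), (∀ i, b i ≠ 0) ∧
      (frobCharpoly φ f).map (algebraMap F[X] (AlgebraicClosure (FractionRing F[X]))) =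
        ∏ i, (X - C (b i)) ∧
      (dualFrobCharpoly φ f).map
        (algebraMap (FractionRing F[X]) (AlgebraicClosure (FractionRing F[X]))) =
        ∏ i, (X - C (b i)⁻¹) := by
  have hs := (frobCharpoly_spec φ f).1
  obtain ⟨b, hb, -⟩ := exists_eq_prod_X_sub_C
    (hs.monic.map (algebraMap F[X] (AlgebraicClosure (FractionRing F[X]))))
    ((hs.monic.natDegree_map _).trans hs.natDegree)
  obtain ⟨h0, h1⟩ := map_invPoly_eq (frobCharpoly_coeff_zero_ne_zero φ f) hb
  rw [← (frobCharpoly_spec φ f).2] at h1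
  exact ⟨b, h0, hb, h1⟩

theorem prod_X_sub_C_inv_unique {L : Type*} [Field L] {a b : Fin n → L}
    (h : ∏ i, (X - C (a i)) = ∏ i, (X - C (b i)⁻¹)) :
    ∏ i, (X - C (a i)⁻¹) = ∏ i, (X - C (b i)) := by
  have h1 := congrArg roots h
  have key : ∀ c : Fin n → L, (∏ i, (X - C (c i))).roots = Finset.univ.val.map c := by
    intro c
    rw [roots_prod _ _ (Finset.prod_ne_zero_iff.2 fun i _ => X_sub_C_ne_zero _)]
    simp [Multiset.bind_singleton]
  rw [key, key fun i => (b i)⁻¹] at h1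
  have h2 := congrArg (fun s => (s.map fun y : L => X - C y⁻¹).prod) h1
  simp only [Multiset.map_map, Function.comp_def, inv_inv] at h2
  exact h2

theorem muPrime_spec (φ : GoodDrinfeldModule F (n + 1)) (f : MonicIrr F) (k : Fin n → ℕ) :
    algebraMap F[X] (FractionRing F[X]) (muPrime φ f k) =
      remDet (dualFrobCharpoly φ f) (schurExp k) *
        algebraMap F[X] (FractionRing F[X]) f.1 ^ (∑ i, k i) := by
  set K := FractionRing F[X]
  set L := AlgebraicClosure K
  have hs := (frobCharpoly_spec φ f).1
  obtain ⟨b, hb0, hb, hb'⟩ := exists_roots_frobCharpoly φ f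
  have hval : ∀ a : Fin (n + 1) → L, (dualFrobCharpoly φ f).map (algebraMap K L) = ∏ i, (X - C (a i)) →
      MvPolynomial.aeval a (schurPoly (n + 1) k) * algebraMap F[X] L f.1 ^ (∑ i, k i) =
        algebraMap K L (remDet (dualFrobCharpoly φ f) (schurExp k) *
          algebraMap F[X] K f.1 ^ (∑ i, k i)) := by
    intro a ha
    rw [aeval_schurPoly_eq_remDet, ← ha, ← map_remDet _ (dualFrobCharpoly_monic φ f), map_mul, map_pow,
      ← IsScalarTower.algebraMap_apply]
  have hint : IsIntegral F[X] (MvPolynomial.aeval (fun i => (b i)⁻¹) (schurPoly (n + 1) k) *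
      algebraMap F[X] L f.1 ^ (∑ i, k i)) := by
    have h1 := isIntegral_aeval_mul_pow (A := F[X]) (degreeOf_schurPoly_le k)
      (x := fun i => (b i)⁻¹) (y := b) (fun i => inv_mul_cancel₀ (hb0 i)) (fun i =>
        ⟨frobCharpoly φ f, hs.monic, by
          rw [← eval_map, hb, eval_prod]
          exact Finset.prod_eq_zero (Finset.mem_univ i) (by simp)⟩)
    obtain ⟨u, hu⟩ : ∃ u : F, algebraMap F[X] L f.1 = algebraMap F[X] L (C u) * ∏ i, b i := by
      have h2 : (∏ i, b i) = algebraMap F[X] L ((-1) ^ (n + 1) * (frobCharpoly φ f).coeff 0) := by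
        rw [map_mul, ← coeff_map, hb, coeff_zero_eq_eval_zero, eval_prod]
        simp only [eval_sub, eval_X, eval_C, zero_sub, Finset.prod_neg]
        rw [map_pow, map_neg, map_one, ← mul_assoc, Finset.card_univ, Fintype.card_fin, ← mul_pow,
          neg_one_mul, neg_neg, one_pow, one_mul]
      rw [h2, hs.coeff_zero]
      refine ⟨(((-1) ^ n * (φ.lead : F)⁻¹) ^ f.1.natDegree)⁻¹, ?_⟩
      rw [← map_mul, ← mul_assoc, ← C_mul, inv_mul_cancel₀, C_1, one_mul]
      simp
    rw [hu, mul_pow, mul_left_comm]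
    exact IsIntegral.mul (isIntegral_algebraMap.pow _) h1
  obtain ⟨c, hc⟩ : ∃ c : F[X], algebraMap F[X] K c = remDet (dualFrobCharpoly φ f) (schurExp k) *
      algebraMap F[X] K f.1 ^ (∑ i, k i) := by
    rw [hval _ hb', isIntegral_algebraMap_iff (algebraMap K L).injective] at hint
    exact IsIntegrallyClosed.isIntegral_iff.1 hint
  obtain ⟨a, ha, hac⟩ := Classical.epsilon_spec (p := fun c : F[X] => ∃ α : Fin (n + 1) → L,
    (dualFrobCharpoly φ f).map (algebraMap K _) = ∏ i, (X - C (α i)) ∧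
    algebraMap F[X] L c = MvPolynomial.aeval α (schurPoly (n + 1) k) *
        algebraMap F[X] L f.1 ^ (∑ i, k i)) ⟨c, _, hb', by
      rw [hval _ hb', ← hc, ← IsScalarTower.algebraMap_apply]⟩
  apply (algebraMap K L).injective
  rw [← hval a ha, ← IsScalarTower.algebraMap_apply]
  exact hac

theorem nuPrime_spec (φ : GoodDrinfeldModule F (n + 1)) (f : MonicIrr F) (k : Fin n → ℕ) :
    nuPrime φ f k = remDet (frobCharpoly φ f) (schurExp k) := by
  set K := FractionRing F[X]
  set L := AlgebraicClosure K
  have hs := (frobCharpoly_spec φ f).1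
  obtain ⟨b, hb0, hb, hb'⟩ := exists_roots_frobCharpoly φ f
  have hval : ∀ a : Fin (n + 1) → L, (dualFrobCharpoly φ f).map (algebraMap K L) = ∏ i, (X - C (a i)) →
      MvPolynomial.aeval (fun i => (a i)⁻¹) (schurPoly (n + 1) k) =
        algebraMap F[X] L (remDet (frobCharpoly φ f) (schurExp k)) := by
    intro a ha
    rw [aeval_schurPoly_eq_remDet, prod_X_sub_C_inv_unique (ha.symm.trans hb'), ← hb, ← map_remDet _ hs.monic]
  obtain ⟨a, ha, hac⟩ := Classical.epsilon_spec (p := fun c : F[X] => ∃ α : Fin (n + 1) → L,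
    (dualFrobCharpoly φ f).map (algebraMap K _) = ∏ i, (X - C (α i)) ∧
    algebraMap F[X] L c = MvPolynomial.aeval (fun i => (α i)⁻¹) (schurPoly (n + 1) k))
      ⟨_, _, hb', (hval _ hb').symm⟩
  have hinj : Function.Injective (algebraMap F[X] L) := by
    rw [IsScalarTower.algebraMap_eq F[X] K L]
    exact (algebraMap K L).injective.comp (IsFractionRing.injective F[X] K)
  apply hinj
  rw [← hval a ha]
  exact hac

end MuNu

section EulerProduct

open Filter Topology

variable {R ι κ : Type*} [CommRing R] [UniformSpace R] [IsUniformAddGroup R] [NonarchimedeanRing R]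
  [Zero κ]

/-- Splitting off the component at `j` of the finitely supported functions supported in
`insert j S`. -/
def supportedInsertEquiv [DecidableEq ι] {j : ι} {S : Finset ι} (hj : j ∉ S) :
    {c : ι →₀ κ // c.support ⊆ insert j S} ≃ κ × {c : ι →₀ κ // c.support ⊆ S} where
  toFun c := (c.1 j, ⟨c.1.erase j, by
    rw [Finsupp.support_erase]
    exact (Finset.subset_insert_iff.1 c.2)⟩)
  invFun p := ⟨p.2.1.update j p.1, by
    refine fun i hi => ?_
    by_cases h : i = j
    · exact h ▸ Finset.mem_insert_self _ _
    · refine Finset.mem_insert_of_mem (p.2.2 ?_)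
      rw [Finsupp.mem_support_iff, Finsupp.coe_update, Function.update_of_ne h] at hi
      exact Finsupp.mem_support_iff.2 hi⟩
  left_inv c := by
    ext i
    simp
  right_inv p := by
    have h : p.2.1 j = 0 := by
      by_contra h
      exact hj (p.2.2 (Finsupp.mem_support_iff.2 h))
    ext i
    · simp
    · by_cases hi : i = j
      · subst hi
        simp [h]
      · simp [hi]

theorem hasSum_supported {t : ι → κ → R} (h0 : ∀ i, t i 0 = 1) {a : ι → R}
    (ha : ∀ i, HasSum (t i) (a i)) (S : Finset ι) :
    HasSum (fun c : {c : ι →₀ κ // c.support ⊆ S} => c.1.prod t) (∏ i ∈ S, a i) := by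
  classical
  induction S using Finset.induction_on with
  | empty =>
    have : Unique {c : ι →₀ κ // c.support ⊆ ∅} :=
      ⟨⟨⟨0, by simp⟩⟩, fun c => Subtype.ext (by simpa using c.2)⟩
    rw [Finset.prod_empty]
    have h := hasSum_unique (fun c : {c : ι →₀ κ // c.support ⊆ ∅} => c.1.prod t)
    have h1 : (default : {c : ι →₀ κ // c.support ⊆ ∅}).1 = 0 := by
      simpa using (default : {c : ι →₀ κ // c.support ⊆ ∅}).2
    rwa [h1, Finsupp.prod_zero_index] at h
  | insert j S hj ih =>
    rw [Finset.prod_insert hj]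
    refine ((supportedInsertEquiv hj).hasSum_iff.2 ((ha j).mul_of_nonarchimedean ih)).congr_fun
      fun c => ?_
    exact (Finsupp.mul_prod_erase' c.1 j t fun i => h0 i).symm

theorem hasProd_of_summable [CompleteSpace R] [T2Space R] {t : ι → κ → R} (h0 : ∀ i, t i 0 = 1)
    (hT : Summable fun c : ι →₀ κ => c.prod t) :
    HasProd (fun i => ∑' k, t i k) (∑' c : ι →₀ κ, c.prod t) := by
  classical
  have ha : ∀ i, HasSum (t i) (∑' k, t i k) := by
    intro i
    have h := hT.comp_injective (Finsupp.single_injective (M := κ) i)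
    refine (h.congr fun k => ?_).hasSum
    rw [Function.comp_apply, Finsupp.prod_single_index (h0 i)]
  have hprod := hasSum_supported h0 ha
  rw [HasProd, SummationFilter.unconditional_filter]
  rw [← tendsto_sub_nhds_zero_iff]
  intro U hU
  obtain ⟨V, hV⟩ := NonarchimedeanAddGroup.is_nonarchimedean U hU
  have hfin := hT.tendsto_cofinite_zero (V.isOpen.mem_nhds V.zero_mem)
  rw [mem_map, mem_cofinite] at hfin
  rw [mem_map, mem_atTop_sets]
  refine ⟨hfin.toFinset.biUnion Finsupp.support, fun S hS => hV ?_⟩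
  change (∏ i ∈ S, ∑' k, t i k) - ∑' c : ι →₀ κ, c.prod t ∈ V
  let W : Set (ι →₀ κ) := {c | c.support ⊆ S}
  have h1 := Summable.tsum_add_tsum_compl (s := W) (hT.subtype W) (hT.subtype Wᶜ)
  have h2 : ∑' c : W, c.1.prod t = ∏ i ∈ S, ∑' k, t i k := (hprod S).tsum_eq
  rw [← h1, ← h2, sub_add_cancel_left]
  refine neg_mem (tsum_mem V.isClosed fun c => ?_)
  by_contra hc
  exact c.2 ((Finset.subset_biUnion_of_mem Finsupp.support (hfin.mem_toFinset.2 hc)).trans hS)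

end EulerProduct

section Factorization

variable {F : Type*} [Field F]

theorem monic_finsuppProd (c : MonicIrr F →₀ ℕ) : (c.prod fun f k => f.1 ^ k).Monic :=
  monic_prod_of_monic _ _ fun f _ => f.2.1.pow _

theorem MonicIrr.not_dvd {f g : MonicIrr F} (h : f ≠ g) : ¬ f.1 ∣ g.1 := fun hd =>
  h (Subtype.ext (eq_of_monic_of_associated f.2.1 g.2.1 (f.2.2.associated_of_dvd g.2.2 hd)))

theorem multiplicity_finsuppProd (c : MonicIrr F →₀ ℕ) (f : MonicIrr F) :
    multiplicity f.1 (c.prod fun f k => f.1 ^ k) = c f := by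
  classical
  rw [← Finsupp.mul_prod_erase' c f _ fun g => pow_zero _]
  refine multiplicity_eq_of_dvd_of_not_dvd (dvd_mul_right _ _) fun h => ?_
  rw [pow_succ] at h
  have h1 := (mul_dvd_mul_iff_left (f.2.1.pow _).ne_zero).1 h
  rw [Finsupp.prod, f.2.2.prime.dvd_finsetProd_iff] at h1
  obtain ⟨g, hg, hd⟩ := h1
  rw [Finsupp.support_erase, Finset.mem_erase] at hg
  exact MonicIrr.not_dvd hg.1.symm (f.2.2.prime.dvd_of_dvd_pow hd)

theorem exists_finsuppProd_eq {a : F[X]} (ha : a.Monic) :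
    ∃ c : MonicIrr F →₀ ℕ, (c.prod fun f k => f.1 ^ k) = a := by
  induction h : a.natDegree using Nat.strong_induction_on generalizing a with
  | _ d ih =>
    by_cases hu : IsUnit a
    · exact ⟨0, by rw [Finsupp.prod_zero_index, ha.eq_one_of_isUnit hu]⟩
    · obtain ⟨f, hf, hirr, b, rfl⟩ := exists_monic_irreducible_factor a hu
      have hb : b.Monic := hf.of_mul_monic_left ha
      have hpos := hirr.natDegree_pos
      rw [hf.natDegree_mul hb] at h
      obtain ⟨c, hc⟩ := ih _ (by omega) hb rfl
      refine ⟨Finsupp.single ⟨f, hf, hirr⟩ 1 + c, ?_⟩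
      rw [Finsupp.prod_add_index' (fun _ => pow_zero _) fun _ _ _ => pow_add _ _ _, hc]
      congr 1
      exact (Finsupp.prod_single_index (h := fun (g : MonicIrr F) k => g.1 ^ k) (pow_zero f)).trans
        (pow_one f)

/-- Unique factorization of monic polynomials. -/
def factorEquiv (F : Type*) [Field F] : (MonicIrr F →₀ ℕ) ≃ MonicPoly F :=
  Equiv.ofBijective (fun c => ⟨c.prod fun f k => f.1 ^ k, monic_finsuppProd c⟩) ⟨fun c d h => by
    ext f
    rw [← multiplicity_finsuppProd c f, ← multiplicity_finsuppProd d f]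
    exact congrArg (fun a : MonicPoly F => multiplicity f.1 a.1) h, fun a => by
    obtain ⟨c, hc⟩ := exists_finsuppProd_eq a.2
    exact ⟨c, Subtype.ext hc⟩⟩

theorem factorEquiv_apply (c : MonicIrr F →₀ ℕ) :
    (factorEquiv F c).1 = c.prod fun f k => f.1 ^ k := rfl

/-- Finitely many finitely supported functions form a finitely supported function of tuples. -/
def finsuppPiEquiv (ι : Type*) (n : ℕ) : (ι →₀ (Fin n → ℕ)) ≃ (Fin n → (ι →₀ ℕ)) where
  toFun c i := c.mapRange (fun k => k i) rfl
  invFun c := by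
    classical
    exact Finsupp.onFinset (Finset.univ.biUnion fun i => (c i).support) (fun x i => c i x)
      fun x hx => by
        obtain ⟨i, hi⟩ := Function.ne_iff.1 hx
        exact Finset.mem_biUnion.2 ⟨i, Finset.mem_univ i, Finsupp.mem_support_iff.2 hi⟩
  left_inv c := by
    ext x i
    simp
  right_inv c := by
    ext i x
    simp

/-- Unique factorization of tuples of monic polynomials. -/
def tupleFactorEquiv (F : Type*) [Field F] (n : ℕ) :
    (MonicIrr F →₀ (Fin n → ℕ)) ≃ (Fin n → MonicPoly F) :=
  (finsuppPiEquiv (MonicIrr F) n).trans (Equiv.piCongrRight fun _ => factorEquiv F)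

variable {n : ℕ}

theorem tupleFactorEquiv_apply (c : MonicIrr F →₀ (Fin n → ℕ)) (i : Fin n) :
    (tupleFactorEquiv F n c i).1 = c.prod fun f k => f.1 ^ k i := by
  change (factorEquiv F (c.mapRange (fun k => k i) rfl)).1 = _
  rw [factorEquiv_apply, Finsupp.prod_mapRange_index fun f => pow_zero _]

theorem multiplicity_tupleFactorEquiv (c : MonicIrr F →₀ (Fin n → ℕ)) (f : MonicIrr F) (i : Fin n) :
    multiplicity f.1 (tupleFactorEquiv F n c i).1 = c f i := by
  change multiplicity f.1 (factorEquiv F (c.mapRange (fun k => k i) rfl)).1 = _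
  rw [factorEquiv_apply, multiplicity_finsuppProd]
  rfl

theorem finprod_multiplicity_tupleFactorEquiv {M : Type*} [CommMonoid M]
    {m : MonicIrr F → (Fin n → ℕ) → M} (hm : ∀ f, m f 0 = 1) (c : MonicIrr F →₀ (Fin n → ℕ)) :
    (∏ᶠ f : MonicIrr F, m f fun i => multiplicity f.1 (tupleFactorEquiv F n c i).1) = c.prod m := by
  simp only [multiplicity_tupleFactorEquiv]
  rw [finprod_eq_prod_of_mulSupport_subset (s := c.support)]
  · rfl
  · intro f hf
    rw [Finset.mem_coe, Finsupp.mem_support_iff]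
    intro h
    exact hf (by rw [← hm f, ← h])

theorem finite_monicPoly_natDegree_le [Fintype F] (N : ℕ) :
    {a : MonicPoly F | a.1.natDegree ≤ N}.Finite := by
  have h : Finite (degreeLT F (N + 1)) := Module.finite_of_finite F
  refine Set.Finite.of_injOn (f := fun a : MonicPoly F => a.1) (t := (degreeLT F (N + 1) : Set F[X]))
    (fun a ha => ?_) Subtype.val_injective.injOn (Set.toFinite _)
  refine mem_degreeLT.2 (degree_le_natDegree.trans_lt ?_)
  exact_mod_cast Nat.lt_succ_of_le ha

theorem finite_tuple_degree_le [Fintype F] (N : ℕ) :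
    {a : Fin n → MonicPoly F | ∑ i : Fin n, ((i : ℕ) + 1) * (a i).1.natDegree ≤ N}.Finite := by
  refine (Set.Finite.pi' fun _ : Fin n => finite_monicPoly_natDegree_le (F := F) N).subset
    fun a ha i => ?_
  rw [Set.mem_ofPred_eq] at ha ⊢
  refine le_trans ?_ ha
  refine le_trans ?_ (Finset.single_le_sum (f := fun i : Fin n => ((i : ℕ) + 1) * (a i).1.natDegree)
    (fun _ _ => Nat.zero_le _) (Finset.mem_univ i))
  exact Nat.le_mul_of_pos_left _ (Nat.succ_pos _)

theorem natDegree_finsuppProd {κ : Type*} [Zero κ] (e : MonicIrr F → κ → ℕ) (c : MonicIrr F →₀ κ) :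
    (c.prod fun f k => f.1 ^ e f k).natDegree = c.sum fun f k => f.1.natDegree * e f k := by
  rw [Finsupp.prod, natDegree_prod_of_monic _ _ fun f _ => f.2.1.pow _, Finsupp.sum]
  refine Finset.sum_congr rfl fun f _ => ?_
  rw [natDegree_pow, mul_comm]

end Factorization

section Nonarchimedean

open Filter Topology

instance KInf.instNonarchimedeanRing (F : Type*) [Field F] : NonarchimedeanRing (KInf F) where
  is_nonarchimedean U hU := by
    obtain ⟨γ, hγ⟩ := Valued.mem_nhds_zero.1 hU
    exact ⟨⟨Valued.v.restrict.ltAddSubgroup γ, Valued.isOpen_ball _ _⟩, hγ⟩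

variable {F : Type*} [Field F]

theorem exists_exp_ball_subset {U : Set (KInf F)} (hU : U ∈ 𝓝 0) :
    ∃ D : ℤ, ∀ x : KInf F, Valued.v x ≤ WithZero.exp (-D) → x ∈ U := by
  obtain ⟨γ, hγ⟩ := Valued.mem_nhds_zero.1 hU
  have h0 : MonoidWithZeroHom.ValueGroup₀.embedding γ.1 ≠ 0 := by
    rw [Ne, map_eq_zero]
    exact γ.ne_zero
  refine ⟨-(WithZero.log (MonoidWithZeroHom.ValueGroup₀.embedding γ.1) - 1), fun x hx => hγ ?_⟩
  change Valued.v.restrict x < γ.1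
  rw [Valuation.restrict_lt_iff_lt_embedding]
  refine hx.trans_lt ?_
  rw [← WithZero.lt_log_iff_exp_lt h0]
  omega

theorem le_exp_of_pow_le {x : WithZero (Multiplicative ℤ)} {n N : ℕ} {D : ℤ}
    (h : x ^ (n + 1) ≤ WithZero.exp (-(N : ℤ))) (hN : ((n + 1 : ℕ) : ℤ) * D ≤ N) :
    x ≤ WithZero.exp (-D) := by
  by_contra! hx
  have h1 := (pow_lt_pow_left₀ hx zero_le n.succ_ne_zero).trans_le h
  rw [← WithZero.exp_nsmul, WithZero.exp_lt_exp] at h1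
  simp only [nsmul_eq_mul] at h1
  linarith

theorem KInf.summable_of_pow_le {ι : Type*} {n : ℕ} {t : ι → KInf F} {N : ι → ℕ}
    (h : ∀ i, Valued.v (t i) ^ (n + 1) ≤ WithZero.exp (-(N i : ℤ)))
    (hfin : ∀ M : ℕ, {i | N i ≤ M}.Finite) : Summable t := by
  refine NonarchimedeanAddGroup.summable_of_tendsto_cofinite_zero fun U hU => ?_
  obtain ⟨D, hD⟩ := exists_exp_ball_subset hU
  rw [mem_map, mem_cofinite]
  refine (hfin ((n + 1) * D.toNat)).subset fun i hi => ?_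
  by_contra h1
  refine hi (hD _ (le_exp_of_pow_le (h i) ?_))
  have h2 : (n + 1) * D.toNat < N i := not_le.1 h1
  have h3 : ((n + 1 : ℕ) : ℤ) * D.toNat < N i := by exact_mod_cast h2
  have h4 := Int.self_le_toNat D
  nlinarith

theorem KInf.hasSum_geometric {y : KInf F} (hy : Valued.v y ≤ WithZero.exp (-1)) :
    HasSum (fun k : ℕ => y ^ k) (1 - y)⁻¹ ∧ 1 - y ≠ 0 := by
  have hs : Summable fun k : ℕ => y ^ k := by
    refine KInf.summable_of_pow_le (n := 0) (N := fun k => k) (fun k => ?_) fun M => Set.finite_Iic M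
    rw [map_pow, zero_add, pow_one]
    refine (pow_le_pow_left₀ zero_le hy k).trans ?_
    rw [← WithZero.exp_nsmul]
    simp
  have hne : 1 - y ≠ 0 := by
    intro h
    rw [← sub_eq_zero.1 h, map_one, ← WithZero.exp_zero, WithZero.exp_le_exp] at hy
    omega
  refine ⟨?_, hne⟩
  have h1 : (∑' k : ℕ, y ^ k) = 1 + y * ∑' k : ℕ, y ^ k := by
    conv_lhs => rw [hs.tsum_eq_zero_add]
    rw [pow_zero, ← hs.tsum_mul_left]
    simp only [pow_succ']
  have h2 : (∑' k : ℕ, y ^ k) = (1 - y)⁻¹ := by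
    rw [← mul_eq_one_iff_eq_inv₀ hne]
    linear_combination h1
  rw [← h2]
  exact hs.hasSum

/-- The filtration of the field of values in which `θ` has weight `n + 1`. -/
def valFiltration (F : Type*) [Field F] (n : ℕ) : RingFiltration (KInf F) where
  step e :=
    { carrier := {x | Valued.v x ^ (n + 1) ≤ WithZero.exp e}
      add_mem' := fun {x y} hx hy => by
        change Valued.v (x + y) ^ (n + 1) ≤ _
        rcases le_total (Valued.v x) (Valued.v y) with h | h
        · exact (pow_le_pow_left₀ zero_le ((Valued.v.map_add x y).trans (max_le h le_rfl)) _).trans hy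
        · exact (pow_le_pow_left₀ zero_le ((Valued.v.map_add x y).trans (max_le le_rfl h)) _).trans hx
      zero_mem' := by
        change Valued.v (0 : KInf F) ^ (n + 1) ≤ _
        simp
      neg_mem' := fun {x} hx => by
        change Valued.v (-x) ^ (n + 1) ≤ _
        rwa [Valuation.map_neg] }
  one_mem := by
    change Valued.v (1 : KInf F) ^ (n + 1) ≤ _
    simp
  mul_mem {a b x y} hx hy := by
    change Valued.v (x * y) ^ (n + 1) ≤ _
    rw [map_mul, mul_pow, WithZero.exp_add]
    exact mul_le_mul' hx hy

theorem mem_valFiltration {n : ℕ} {e : ℤ} {x : KInf F} :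
    x ∈ (valFiltration F n).step e ↔ Valued.v x ^ (n + 1) ≤ WithZero.exp e := Iff.rfl

theorem atZ_eq_C (p : F[X]) : atZ F p = HahnSeries.C (algebraMap F[X] (RatFunc F) p) := by
  have h : atZ F = (HahnSeries.C : RatFunc F →+* KInf F).comp (algebraMap F[X] (RatFunc F)) := by
    refine Polynomial.ringHom_ext (fun a => ?_) ?_
    · simp [atZ, constHom, RatFunc.algebraMap_C]
    · simp [atZ]
  rw [h]
  rfl

theorem valuation_atZ_le (p : F[X]) : Valued.v (atZ F p) ≤ 1 := by
  rw [← WithZero.exp_zero, ← neg_zero, LaurentSeries.valuation_le_iff_coeff_lt_eq_zero, atZ_eq_C]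
  intro n hn
  rw [HahnSeries.C_apply, HahnSeries.coeff_single_of_ne hn.ne]

theorem valuation_constHom_le (c : F) : Valued.v (constHom F c) ≤ 1 := by
  have := valuation_atZ_le (C c)
  rwa [atZ, coe_eval₂RingHom, eval₂_C] at this

theorem valuation_atTheta_le {p : F[X]} {d : ℕ} (h : p.degree < (d : WithBot ℕ)) :
    Valued.v (atTheta F p) ≤ WithZero.exp ((d : ℤ) - 1) := by
  rw [← neg_neg ((d : ℤ) - 1), LaurentSeries.valuation_le_iff_coeff_lt_eq_zero]
  intro m hm
  obtain ⟨j, rfl⟩ : ∃ j : ℕ, m = -(j : ℤ) := ⟨(-m).toNat, by omega⟩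
  rw [atTheta_coeff, coeff_eq_zero_of_degree_lt, map_zero]
  exact h.trans_le (by exact_mod_cast (by omega : d ≤ j))

theorem atTheta_X_pow (d : ℕ) : atTheta F (X ^ d) = HahnSeries.single (-(d : ℤ)) (1 : RatFunc F) := by
  rw [map_pow, atTheta, coe_eval₂RingHom, eval₂_X, HahnSeries.single_pow, one_pow]
  simp

theorem valuation_one_sub_single_mul_atTheta {a : F[X]} (ha : a.Monic) :
    Valued.v (1 - HahnSeries.single (a.natDegree : ℤ) (1 : RatFunc F) * atTheta F a) ≤
      WithZero.exp (-1) := by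
  set d := a.natDegree
  have h1 : HahnSeries.single (d : ℤ) (1 : RatFunc F) * atTheta F (X ^ d) = 1 := by
    rw [atTheta_X_pow, HahnSeries.single_mul_single, add_neg_cancel, one_mul]
    rfl
  have h2 : (X ^ d - a).degree < (d : WithBot ℕ) := by
    have h3 : a.degree = d := degree_eq_natDegree ha.ne_zero
    rw [← h3]
    refine (degree_sub_lt_left ?_ (pow_ne_zero _ X_ne_zero) ?_).trans_eq ?_
    · rw [degree_X_pow, h3]
    · rw [ha.leadingCoeff, leadingCoeff_X_pow]
    · rw [degree_X_pow, h3]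
  rw [← h1, ← mul_sub, ← map_sub, map_mul, LaurentSeries.valuation_single_zpow]
  refine (mul_le_mul_right (valuation_atTheta_le h2) _).trans ?_
  rw [← WithZero.exp_add, WithZero.exp_le_exp]
  omega

theorem valuation_atTheta {a : F[X]} (ha : a.Monic) :
    Valued.v (atTheta F a) = WithZero.exp (a.natDegree : ℤ) := by
  have h1 := valuation_one_sub_single_mul_atTheta ha
  have h2 : Valued.v (HahnSeries.single (a.natDegree : ℤ) (1 : RatFunc F) * atTheta F a) = 1 := by
    have h3 : Valued.v (1 - HahnSeries.single (a.natDegree : ℤ) (1 : RatFunc F) * atTheta F a) <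
        Valued.v (1 : KInf F) := by
      rw [Valuation.map_one, ← WithZero.exp_zero]
      exact h1.trans_lt (WithZero.exp_lt_exp.2 (by omega))
    have h4 := Valued.v.map_sub_eq_of_lt_left h3
    rwa [sub_sub_cancel, Valuation.map_one] at h4
  rw [map_mul, LaurentSeries.valuation_single_zpow, WithZero.exp_neg] at h2
  exact (eq_of_inv_mul_eq_one h2).symm

end Nonarchimedean

section Evaluation

theorem PowerSeries.hasSum_mul_of_nonarchimedean {R : Type*} [CommRing R] [UniformSpace R]
    [IsUniformAddGroup R] [NonarchimedeanRing R] {H G : PowerSeries R} {u a b : R}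
    (hH : HasSum (fun N => PowerSeries.coeff N H * u ^ N) a)
    (hG : HasSum (fun N => PowerSeries.coeff N G * u ^ N) b) :
    HasSum (fun N => PowerSeries.coeff N (H * G) * u ^ N) (a * b) := by
  have h := (Finset.HasAntidiagonal.sigmaAntidiagonalEquivProd (A := ℕ)).hasSum_iff.2 (hH.mul_of_nonarchimedean hG)
  refine (h.sigma fun N => hasSum_fintype _).congr_fun fun N => ?_
  rw [PowerSeries.coeff_mul, Finset.sum_mul, ← Finset.sum_coe_sort]
  refine Finset.sum_congr rfl fun p _ => ?_
  have hp := Finset.HasAntidiagonal.mem_antidiagonal.1 p.2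
  have hu : u ^ N = u ^ p.1.1 * u ^ p.1.2 := by rw [← pow_add, hp]
  rw [hu]
  exact mul_mul_mul_comm _ _ _ _

theorem Polynomial.hasSum_coeff_mul_pow {R : Type*} [CommRing R] [TopologicalSpace R] (p : R[X]) (u : R) :
    HasSum (fun N => PowerSeries.coeff N (p : PowerSeries R) * u ^ N) (p.eval u) := by
  rw [eval_eq_sum_range]
  simp only [Polynomial.coeff_coe]
  refine hasSum_sum_of_ne_finset_zero fun N hN => ?_
  rw [Finset.mem_range, not_lt] at hN
  rw [coeff_eq_zero_of_natDegree_lt (by omega), zero_mul]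

end Evaluation

namespace RingFiltration

variable {R : Type*} [CommRing R] (W : RingFiltration R) {n : ℕ} {P : R[X]} {w : ℤ}

theorem coeff_X_pow_modByMonic_mem (hP : P.Monic) (hd : P.natDegree = n + 1)
    (h : ∀ j ≤ n, P.coeff j ∈ W.step (w * ((n : ℤ) + 1 - j))) (m j : ℕ) :
    ((X ^ m : R[X]) %ₘ P).coeff j ∈ W.step (w * ((m : ℤ) - j)) := by
  nontriviality R
  have hlt : ∀ p : R[X], (p %ₘ P).degree < ((n + 1 : ℕ) : WithBot ℕ) := by
    intro p
    rw [← hd, ← degree_eq_natDegree hP.ne_zero]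
    exact degree_modByMonic_lt p hP
  induction m generalizing j with
  | zero =>
    rw [pow_zero, (modByMonic_eq_self_iff hP).2, coeff_one]
    · split_ifs with h0
      · rw [h0]
        simpa using W.one_mem
      · exact zero_mem _
    · rw [degree_one, degree_eq_natDegree hP.ne_zero, hd]
      exact_mod_cast n.succ_pos
  | succ m ih =>
    set c := ((X ^ m : R[X]) %ₘ P) with hc
    have hrec : (X ^ (m + 1) : R[X]) %ₘ P = c * X - C (c.coeff n) * P := by
      refine (div_modByMonic_unique (X ^ m /ₘ P * X + C (c.coeff n)) _ hP ⟨?_, ?_⟩).2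
      · have h1 := modByMonic_add_div (X ^ m : R[X]) P
        rw [pow_succ, mul_add]
        linear_combination (X : R[X]) * h1
      · rw [degree_eq_natDegree hP.ne_zero, hd, degree_lt_iff_coeff_zero]
        intro i hi
        obtain ⟨i, rfl⟩ : ∃ i', i = i' + 1 := ⟨i - 1, by omega⟩
        rw [coeff_sub, coeff_mul_X, coeff_C_mul]
        rcases Nat.lt_or_ge n i with h2 | h2
        · rw [(degree_lt_iff_coeff_zero _ _).1 (hlt _) i h2, coeff_eq_zero_of_natDegree_lt (p := P) (by omega)]
          simp
        · have h3 : i = n := by omega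
          have h4 : P.coeff (n + 1) = 1 := by rw [← hd]; exact hP
          rw [h3, h4, mul_one, sub_self]
    have key : ∀ j : ℕ, (c.coeff n * P.coeff j) ∈ W.step (w * (((m + 1 : ℕ) : ℤ) - j)) := by
      intro j
      rcases Nat.lt_trichotomy j (n + 1) with hj | hj | hj
      · have h5 := W.mul_mem (ih n) (h j (by omega))
        rw [← mul_add] at h5
        convert h5 using 2
        push_cast
        ring
      · have h4 : P.coeff (n + 1) = 1 := by rw [← hd]; exact hP
        rw [hj, h4, mul_one]
        convert ih n using 2
        push_cast
        ring
      · rw [coeff_eq_zero_of_natDegree_lt (by omega : P.natDegree < j), mul_zero]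
        exact zero_mem _
    rw [hrec, coeff_sub, coeff_C_mul]
    refine sub_mem ?_ (key j)
    rcases j with _ | j
    · rw [coeff_mul_X_zero]
      exact zero_mem _
    · rw [coeff_mul_X]
      convert ih j using 2
      push_cast
      ring

theorem remDet_mem (hP : P.Monic) (hd : P.natDegree = n + 1)
    (h : ∀ j ≤ n, P.coeff j ∈ W.step (w * ((n : ℤ) + 1 - j))) (k : Fin n → ℕ) :
    remDet P (schurExp k) ∈ W.step (w * schurWeight k) := by
  have h1 := W.det_mem (Matrix.of fun i j : Fin (n + 1) =>
    ((X ^ schurExp k i : R[X]) %ₘ P).coeff (n - (j : ℕ))) (fun i => w * schurExp k i)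
    (fun j => -(w * ((n : ℤ) - j))) fun i j => by
      have := W.coeff_X_pow_modByMonic_mem hP hd h (schurExp k i) (n - (j : ℕ))
      rw [Matrix.of_apply]
      convert this using 2
      rw [Nat.cast_sub (by omega)]
      ring
  rw [remDet]
  convert h1 using 2
  have h2 : (∑ i : Fin (n + 1), ((n : ℤ) - i)) = ∑ i : Fin (n + 1), ((i : ℕ) : ℤ) := by
    rw [← Equiv.sum_comp Fin.revPerm]
    refine Finset.sum_congr rfl fun i _ => ?_
    rw [Fin.revPerm_apply, Fin.val_rev]
    omega
  have h3 : (∑ i, (schurExp k i : ℤ)) = schurWeight k + ∑ i : Fin (n + 1), ((i : ℕ) : ℤ) := by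
    exact_mod_cast sum_schurExp k
  rw [Finset.sum_neg_distrib, ← Finset.mul_sum, ← Finset.mul_sum, h2, h3]
  ring

theorem remDet_mem_zero (hP : P.Monic) (hd : P.natDegree = n + 1)
    (h : ∀ j, P.coeff j ∈ W.step 0) (k : Fin n → ℕ) : remDet P (schurExp k) ∈ W.step 0 := by
  have := W.remDet_mem (w := 0) hP hd (fun j _ => by simpa using h j) k
  simpa using this

end RingFiltration

section LocalTerm

variable {F : Type*} [Field F] {n : ℕ}

theorem fracTheta_algebraMap (p : F[X]) :
    fracTheta F (algebraMap F[X] (FractionRing F[X]) p) = atTheta F p :=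
  IsFractionRing.lift_algebraMap _ p

theorem atTheta_C (c : F) : atTheta F (C c) = constHom F c := by
  rw [atTheta, coe_eval₂RingHom, eval₂_C]

theorem atZ_C (c : F) : atZ F (C c) = constHom F c := by
  rw [atZ, coe_eval₂RingHom, eval₂_C]

theorem atTheta_ne_zero {a : F[X]} (ha : a ≠ 0) : atTheta F a ≠ 0 := by
  rwa [Ne, map_eq_zero_iff _ atTheta_injective]

theorem mem_valFiltration_of_le_one {x : KInf F} (hx : Valued.v x ≤ 1) :
    x ∈ (valFiltration F n).step 0 := by
  rw [mem_valFiltration, WithZero.exp_zero]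
  exact pow_le_one₀ zero_le hx

theorem atTheta_mem_valFiltration {q : F[X]} {e : ℤ}
    (h : ∀ k, q.coeff k ≠ 0 → ((n : ℤ) + 1) * k ≤ e) : atTheta F q ∈ (valFiltration F n).step e := by
  by_cases hq : q = 0
  · rw [hq, map_zero]
    exact zero_mem _
  rw [mem_valFiltration]
  have h1 : q.degree < ((q.natDegree + 1 : ℕ) : WithBot ℕ) := by
    rw [degree_eq_natDegree hq]
    exact_mod_cast Nat.lt_succ_self _
  refine (pow_le_pow_left₀ zero_le (valuation_atTheta_le h1) _).trans ?_
  rw [← WithZero.exp_nsmul, WithZero.exp_le_exp]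
  have h2 := h q.natDegree (by rwa [coeff_natDegree, leadingCoeff_ne_zero])
  push_cast
  simpa using h2

theorem inv_atTheta_mem_valFiltration {a : F[X]} (ha : a.Monic) :
    (atTheta F a)⁻¹ ∈ (valFiltration F n).step (-(((n : ℤ) + 1) * a.natDegree)) := by
  rw [mem_valFiltration, map_inv₀, valuation_atTheta ha, ← WithZero.exp_neg, ← WithZero.exp_nsmul,
    WithZero.exp_le_exp]
  simp

theorem valuation_inv_atTheta_pow_le {a : F[X]} (ha : a.Monic) (N : ℕ) :
    Valued.v ((atTheta F a ^ N)⁻¹) ≤ WithZero.exp (-(N * a.natDegree : ℤ)) := by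
  rw [map_inv₀, map_pow, valuation_atTheta ha, ← WithZero.exp_nsmul, ← WithZero.exp_neg,
    WithZero.exp_le_exp]
  simp

/-- The constant `((-1) ^ (n + 2) κ) ^ deg f` is inverse to the one in `FrobPolySpec`. -/
theorem chi_eq (φ : GoodDrinfeldModule F (n + 1)) (a : MonicPoly F) :
    ((chi φ a : Fˣ) : F) = (((-1) ^ n * (φ.lead : F)⁻¹) ^ a.1.natDegree)⁻¹ := by
  rw [chi, ← inv_pow, mul_inv, inv_inv, ← inv_pow]
  push_cast
  congr 2
  rw [inv_neg, inv_one]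
  ring

variable [Fintype F]

theorem frobCharpoly_coeff_zero (φ : GoodDrinfeldModule F (n + 1)) (f : MonicIrr F) :
    (frobCharpoly φ f).coeff 0 =
      (-1) ^ (n + 1) * (C (((chi φ ⟨f.1, f.2.1⟩ : Fˣ) : F)⁻¹) * f.1) := by
  rw [(frobCharpoly_spec φ f).1.coeff_zero_eq, chi_eq, inv_inv, C_mul, mul_assoc]
  simp

theorem coeff_map_dualFrobCharpoly (φ : GoodDrinfeldModule F (n + 1)) (f : MonicIrr F) {j : ℕ}
    (hj : j ≤ n + 1) :
    ((dualFrobCharpoly φ f).map (fracTheta F)).coeff j =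
      atTheta F ((frobCharpoly φ f).coeff (n + 1 - j)) / atTheta F ((frobCharpoly φ f).coeff 0) := by
  rw [coeff_map, (frobCharpoly_spec φ f).2, coeff_invPoly (frobCharpoly_spec φ f).1.natDegree hj,
    map_div₀, fracTheta_algebraMap, fracTheta_algebraMap]

theorem coeff_map_dualFrobCharpoly_mem (φ : GoodDrinfeldModule F (n + 1)) (f : MonicIrr F) {j : ℕ}
    (hj : j ≤ n) :
    ((dualFrobCharpoly φ f).map (fracTheta F)).coeff j ∈
      (valFiltration F n).step (-(f.1.natDegree : ℤ) * ((n : ℤ) + 1 - j)) := by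
  rw [coeff_map_dualFrobCharpoly φ f (by omega), frobCharpoly_coeff_zero, div_eq_mul_inv, map_mul,
    map_mul, mul_inv, mul_inv, atTheta_C, ← map_inv₀ (constHom F), inv_inv]
  have h1 : atTheta F ((frobCharpoly φ f).coeff (n + 1 - j)) ∈
      (valFiltration F n).step ((f.1.natDegree : ℤ) * j) := by
    refine atTheta_mem_valFiltration fun k hk => ?_
    have h2 := (frobCharpoly_spec φ f).1.weight _ k hk
    obtain ⟨i, hi⟩ := Nat.exists_eq_add_of_le (show j ≤ n + 1 by omega)
    have h3 : n + 1 - j = i := by omega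
    rw [h3] at h2
    have h4 : ((n + 1 : ℕ) : ℤ) * k + f.1.natDegree * i ≤ ((n + 1 : ℕ) : ℤ) * f.1.natDegree := by
      exact_mod_cast h2
    rw [hi] at h4
    push_cast at h4
    have h5 : (n : ℤ) + 1 = j + i := by exact_mod_cast hi
    rw [h5]
    linarith
  have h2 : (atTheta F ((-1) ^ (n + 1)))⁻¹ ∈ (valFiltration F n).step 0 := by
    refine mem_valFiltration_of_le_one ?_
    rw [map_pow, map_neg, map_one, map_inv₀, map_pow, Valuation.map_neg]
    simp
  have h3 : constHom F ((chi φ ⟨f.1, f.2.1⟩ : Fˣ) : F) ∈ (valFiltration F n).step 0 :=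
    mem_valFiltration_of_le_one (valuation_constHom_le _)
  have h4 := (valFiltration F n).mul_mem h1 ((valFiltration F n).mul_mem h2
    ((valFiltration F n).mul_mem h3 (inv_atTheta_mem_valFiltration f.2.1)))
  convert h4 using 2
  ring

/-- The terms of the local factor of the convolution L-series. -/
def convLocal (φ ψ : GoodDrinfeldModule F (n + 1)) (s : ℕ) (f : MonicIrr F) (k : Fin n → ℕ) : KInf F :=
  remDet ((dualFrobCharpoly φ f).map (fracTheta F)) (schurExp k) *
    remDet ((frobCharpoly ψ f).map (atZ F)) (schurExp k) * (atTheta F f.1 ^ s)⁻¹ ^ schurWeight k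

variable (φ ψ : GoodDrinfeldModule F (n + 1)) (s : ℕ) (f : MonicIrr F)

theorem map_dualFrobCharpoly_monic : ((dualFrobCharpoly φ f).map (fracTheta F)).Monic :=
  (dualFrobCharpoly_monic φ f).map _

theorem natDegree_map_dualFrobCharpoly :
    ((dualFrobCharpoly φ f).map (fracTheta F)).natDegree = n + 1 := by
  rw [(dualFrobCharpoly_monic φ f).natDegree_map, natDegree_dualFrobCharpoly]

theorem map_frobCharpoly_monic : ((frobCharpoly ψ f).map (atZ F)).Monic :=
  (frobCharpoly_spec ψ f).1.monic.map _

theorem natDegree_map_frobCharpoly : ((frobCharpoly ψ f).map (atZ F)).natDegree = n + 1 := by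
  rw [(frobCharpoly_spec ψ f).1.monic.natDegree_map, (frobCharpoly_spec ψ f).1.natDegree]

theorem convLocal_mem (k : Fin n → ℕ) :
    convLocal φ ψ s f k ∈ (valFiltration F n).step (-(f.1.natDegree * schurWeight k : ℕ)) := by
  have h1 := (valFiltration F n).remDet_mem (map_dualFrobCharpoly_monic φ f)
    (natDegree_map_dualFrobCharpoly φ f) (fun j hj => coeff_map_dualFrobCharpoly_mem φ f hj) k
  have h2 := (valFiltration F n).remDet_mem_zero (map_frobCharpoly_monic ψ f)
    (natDegree_map_frobCharpoly ψ f) (fun j => by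
      rw [coeff_map]
      exact mem_valFiltration_of_le_one (valuation_atZ_le _)) k
  have h3 : (atTheta F f.1 ^ s)⁻¹ ^ schurWeight k ∈ (valFiltration F n).step 0 := by
    refine mem_valFiltration_of_le_one ?_
    rw [map_pow]
    refine pow_le_one₀ zero_le ((valuation_inv_atTheta_pow_le f.2.1 s).trans ?_)
    rw [← WithZero.exp_zero, WithZero.exp_le_exp]
    have : (0 : ℤ) ≤ s * f.1.natDegree := by positivity
    omega
  have h4 := (valFiltration F n).mul_mem ((valFiltration F n).mul_mem h1 h2) h3
  rw [convLocal]
  convert h4 using 2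
  push_cast
  ring

theorem convLocal_zero : convLocal φ ψ s f 0 = 1 := by
  have hw : schurWeight (0 : Fin n → ℕ) = 0 := by simp [schurWeight]
  rw [convLocal, remDet_zero_schurExp (map_dualFrobCharpoly_monic φ f)
    (natDegree_map_dualFrobCharpoly φ f), remDet_zero_schurExp (map_frobCharpoly_monic ψ f)
    (natDegree_map_frobCharpoly ψ f), hw, pow_zero, mul_one, mul_one]

theorem coeff_zero_mul_coeff_zero :
    ((dualFrobCharpoly φ f).map (fracTheta F)).coeff 0 * ((frobCharpoly ψ f).map (atZ F)).coeff 0 *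
      (atTheta F f.1 ^ s)⁻¹ ^ (n + 1) = pellarinTerm φ ψ ((n + 1) * s + 1) ⟨f.1, f.2.1⟩ := by
  have h1 : (frobCharpoly φ f).coeff (n + 1) = 1 := by
    have h := (frobCharpoly_spec φ f).1.monic.coeff_natDegree
    rwa [(frobCharpoly_spec φ f).1.natDegree] at h
  have hf := atTheta_ne_zero f.2.1.ne_zero
  rw [coeff_map_dualFrobCharpoly φ f (Nat.zero_le _), Nat.sub_zero, h1, coeff_map,
    frobCharpoly_coeff_zero, frobCharpoly_coeff_zero, pellarinTerm, map_mul, map_mul, map_mul, map_mul,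
    atTheta_C, atZ_C, map_pow, map_pow, map_neg, map_neg, map_one, map_one]
  push_cast
  rw [map_mul, map_inv₀, inv_pow, ← pow_mul, mul_comm s, pow_succ]
  have h2 : constHom F ((chi φ ⟨f.1, f.2.1⟩ : Fˣ) : F) ≠ 0 := by simp
  field_simp
  ring

/-- The evaluation of the Cauchy identity at `f ^ (-s)`. -/
theorem hasSum_convLocal :
    Summable (convLocal φ ψ s f) ∧
    (∑' k, convLocal φ ψ s f k) * (dualEulerPoly φ ψ f).eval ((atTheta F f.1 ^ s)⁻¹) =
      1 - pellarinTerm φ ψ ((n + 1) * s + 1) ⟨f.1, f.2.1⟩ := by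
  set u := (atTheta F f.1 ^ s)⁻¹ with hu
  have hfin : ∀ N : ℕ, {k : Fin n → ℕ | schurWeight k = N}.Finite := fun N =>
    (weightFiber n N).finite_toSet.subset fun k hk => Finset.mem_coe.2 (mem_weightFiber.2 hk)
  have hs : Summable (convLocal φ ψ s f) := by
    refine KInf.summable_of_pow_le (n := n) (N := fun k => f.1.natDegree * schurWeight k)
      (fun k => convLocal_mem φ ψ s f k) fun M => ?_
    refine ((Set.finite_Iic M).biUnion fun N _ => hfin N).subset fun k hk => ?_
    refine Set.mem_biUnion (x := schurWeight k) ?_ rfl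
    exact (Nat.le_mul_of_pos_left _ f.2.2.natDegree_pos).trans hk
  refine ⟨hs, ?_⟩
  have h1 : HasSum (fun N => PowerSeries.coeff N (remSeries n ((dualFrobCharpoly φ f).map (fracTheta F))
      ((frobCharpoly ψ f).map (atZ F))) * u ^ N) (∑' k, convLocal φ ψ s f k) := by
    have h2 := (Equiv.sigmaFiberEquiv (schurWeight (n := n))).hasSum_iff.2 hs.hasSum
    refine h2.sigma fun N => ?_
    let _ : Fintype {k : Fin n → ℕ // schurWeight k = N} :=
      Fintype.subtype (weightFiber n N) fun _ => mem_weightFiber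
    rw [remSeries, PowerSeries.coeff_mk, Finset.sum_mul,
      Finset.sum_subtype _ (p := fun k => schurWeight k = N) fun _ => mem_weightFiber]
    refine (hasSum_fintype _).congr_fun fun k => ?_
    have hk : schurWeight k.1 = N := k.2
    change convLocal φ ψ s f k.1 = _
    rw [convLocal, hk]
  have h2 := PowerSeries.hasSum_mul_of_nonarchimedean h1
    (Polynomial.hasSum_coeff_mul_pow (dualEulerPoly φ ψ f) u)
  rw [dualEulerPoly, remSeries_mul_reverse_polyTensor (map_dualFrobCharpoly_monic φ f)
    (map_frobCharpoly_monic ψ f) (natDegree_map_dualFrobCharpoly φ f)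
    (natDegree_map_frobCharpoly ψ f)] at h2
  have h3 := Polynomial.hasSum_coeff_mul_pow (1 - C (((dualFrobCharpoly φ f).map (fracTheta F)).coeff 0 *
    ((frobCharpoly ψ f).map (atZ F)).coeff 0) * X ^ (n + 1)) u
  rw [Polynomial.coe_sub, Polynomial.coe_mul, Polynomial.coe_pow, Polynomial.coe_X,
    Polynomial.coe_one, Polynomial.coe_C] at h3
  rw [dualEulerPoly, h2.unique h3, ← coeff_zero_mul_coeff_zero φ ψ s f]
  simp [hu]

end LocalTerm

section Pellarin

variable {F : Type*} [Field F] {n : ℕ} (φ ψ : GoodDrinfeldModule F (n + 1)) (N : ℕ)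

theorem pellarinTerm_eq (a : MonicPoly F) :
    pellarinTerm φ ψ N a = constHom F ((φ.lead * ψ.lead⁻¹ : Fˣ) : F) ^ a.1.natDegree * atZ F a.1 *
      (atTheta F a.1 ^ N)⁻¹ := by
  rw [pellarinTerm, div_eq_mul_inv, chi, chi, ← inv_pow, ← mul_pow, Units.val_pow_eq_pow_val, map_pow]
  congr 5
  rw [mul_inv, mul_mul_mul_comm, mul_inv_cancel, one_mul]

theorem pellarinTerm_factorEquiv (c : MonicIrr F →₀ ℕ) :
    pellarinTerm φ ψ N (factorEquiv F c) =
      c.prod fun f k => pellarinTerm φ ψ N ⟨f.1, f.2.1⟩ ^ k := by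
  simp only [pellarinTerm_eq, factorEquiv_apply]
  rw [natDegree_finsuppProd fun _ k => k]
  simp only [Finsupp.prod, Finsupp.sum, map_prod, map_pow, ← Finset.prod_pow, ← Finset.prod_inv_distrib,
    ← Finset.prod_pow_eq_pow_sum, ← Finset.prod_mul_distrib]
  refine Finset.prod_congr rfl fun f _ => ?_
  rw [mul_pow, mul_pow, ← pow_mul, inv_pow, ← pow_mul, ← pow_mul, mul_comm N]

theorem valuation_pellarinTerm_le (a : MonicPoly F) :
    Valued.v (pellarinTerm φ ψ N a) ≤ WithZero.exp (-(N * a.1.natDegree : ℤ)) := by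
  rw [pellarinTerm, div_eq_mul_inv, map_mul, map_mul, ← one_mul (WithZero.exp _)]
  exact mul_le_mul' (mul_le_one' (valuation_constHom_le _) (valuation_atZ_le _))
    (valuation_inv_atTheta_pow_le a.2 N)

theorem hasSum_geometric_pellarinTerm {N : ℕ} (hN : 1 ≤ N) (f : MonicIrr F) :
    HasSum (fun k : ℕ => pellarinTerm φ ψ N ⟨f.1, f.2.1⟩ ^ k)
      (1 - pellarinTerm φ ψ N ⟨f.1, f.2.1⟩)⁻¹ ∧ 1 - pellarinTerm φ ψ N ⟨f.1, f.2.1⟩ ≠ 0 := by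
  refine KInf.hasSum_geometric ((valuation_pellarinTerm_le φ ψ N _).trans ?_)
  rw [WithZero.exp_le_exp]
  have h1 := f.2.2.natDegree_pos
  have h2 : 1 ≤ N * f.1.natDegree := Nat.mul_pos hN h1
  have h3 : (1 : ℤ) ≤ N * f.1.natDegree := by exact_mod_cast h2
  exact neg_le_neg h3

variable [Fintype F]

theorem summable_pellarinTerm {N : ℕ} (hN : 1 ≤ N) : Summable (pellarinTerm φ ψ N) := by
  refine KInf.summable_of_pow_le (n := 0) (N := fun a => a.1.natDegree) (fun a => ?_)
    finite_monicPoly_natDegree_le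
  rw [zero_add, pow_one]
  refine (valuation_pellarinTerm_le φ ψ N a).trans ?_
  rw [WithZero.exp_le_exp]
  have h2 := Nat.le_mul_of_pos_left a.1.natDegree hN
  have h3 : (a.1.natDegree : ℤ) ≤ N * a.1.natDegree := by exact_mod_cast h2
  exact neg_le_neg h3

theorem hasProd_pellarin {N : ℕ} (hN : 1 ≤ N) :
    HasProd (fun f : MonicIrr F => (1 - pellarinTerm φ ψ N ⟨f.1, f.2.1⟩)⁻¹) (LPellarin φ ψ N) := by
  have hs := (factorEquiv F).summable_iff.2 (summable_pellarinTerm φ ψ hN)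
  have he : pellarinTerm φ ψ N ∘ factorEquiv F =
      fun c => c.prod fun f k => pellarinTerm φ ψ N ⟨f.1, f.2.1⟩ ^ k :=
    funext fun c => pellarinTerm_factorEquiv φ ψ N c
  rw [he] at hs
  have h := hasProd_of_summable (fun f => pow_zero _) hs
  have h1 : LPellarin φ ψ N =
      ∑' c : MonicIrr F →₀ ℕ, c.prod fun f k => pellarinTerm φ ψ N ⟨f.1, f.2.1⟩ ^ k := by
    rw [LPellarin, ← (factorEquiv F).tsum_eq]
    exact tsum_congr fun c => pellarinTerm_factorEquiv φ ψ N c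
  rw [h1]
  convert h using 2 with f
  exact (hasSum_geometric_pellarinTerm φ ψ hN f).1.tsum_eq.symm

end Pellarin

section Convolution

variable {F : Type*} [Field F] {n : ℕ}

theorem algebraMap_fractionRing_injective :
    Function.Injective (algebraMap F[X] (FractionRing F[X])) :=
  IsFractionRing.injective F[X] (FractionRing F[X])

theorem sum_natDegree_tupleFactorEquiv (c : MonicIrr F →₀ (Fin n → ℕ)) :
    ∑ i : Fin n, ((i : ℕ) + 1) * (tupleFactorEquiv F n c i).1.natDegree =
      ∑ f ∈ c.support, f.1.natDegree * schurWeight (c f) := by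
  simp only [tupleFactorEquiv_apply]
  have h : ∀ i : Fin n, (c.prod fun f k => f.1 ^ k i).natDegree =
      ∑ f ∈ c.support, f.1.natDegree * c f i := fun i => natDegree_finsuppProd (fun _ k => k i) c
  simp only [h, schurWeight, Finset.mul_sum]
  rw [Finset.sum_comm]
  exact Finset.sum_congr rfl fun f _ => Finset.sum_congr rfl fun i _ => by ring

variable [Fintype F] (φ ψ : GoodDrinfeldModule F (n + 1)) (s : ℕ)

theorem muPrime_zero (f : MonicIrr F) : muPrime φ f (0 : Fin n → ℕ) = 1 := by
  apply algebraMap_fractionRing_injective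
  rw [muPrime_spec, remDet_zero_schurExp (dualFrobCharpoly_monic φ f) (natDegree_dualFrobCharpoly φ f)]
  simp

theorem nuPrime_zero (f : MonicIrr F) : nuPrime ψ f (0 : Fin n → ℕ) = 1 := by
  apply algebraMap_fractionRing_injective
  have hs := (frobCharpoly_spec ψ f).1
  rw [nuPrime_spec, map_remDet _ hs.monic, remDet_zero_schurExp (hs.monic.map _)
    ((hs.monic.natDegree_map _).trans hs.natDegree), map_one]

theorem convLocal_eq (f : MonicIrr F) (k : Fin n → ℕ) :
    convLocal φ ψ s f k = atTheta F (muPrime φ f k) * atZ F (nuPrime ψ f k) /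
      ((∏ i : Fin n, atTheta F f.1 ^ k i) *
        (∏ i : Fin n, (atTheta F f.1 ^ k i) ^ ((i : ℕ) + 1)) ^ s) := by
  have hf := atTheta_ne_zero f.2.1.ne_zero
  have h1 : atTheta F (muPrime φ f k) =
      remDet ((dualFrobCharpoly φ f).map (fracTheta F)) (schurExp k) * atTheta F f.1 ^ (∑ i, k i) := by
    rw [← fracTheta_algebraMap, muPrime_spec, map_mul, map_pow, fracTheta_algebraMap,
      map_remDet _ (dualFrobCharpoly_monic φ f)]
  have h2 : (∏ i : Fin n, (atTheta F f.1 ^ k i) ^ ((i : ℕ) + 1)) = atTheta F f.1 ^ schurWeight k := by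
    rw [schurWeight, ← Finset.prod_pow_eq_pow_sum]
    exact Finset.prod_congr rfl fun i _ => by rw [← pow_mul, mul_comm]
  rw [h1, h2, Finset.prod_pow_eq_pow_sum, nuPrime_spec, map_remDet _ (frobCharpoly_spec ψ f).1.monic,
    convLocal, inv_pow, ← pow_mul, ← pow_mul, mul_comm s]
  field_simp

theorem convTerm_tupleFactorEquiv (c : MonicIrr F →₀ (Fin n → ℕ)) :
    convTerm φ ψ s (tupleFactorEquiv F n c) = c.prod (convLocal φ ψ s) := by
  have h1 : muTheta φ (tupleFactorEquiv F n c) = c.prod (muPrime φ) :=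
    finprod_multiplicity_tupleFactorEquiv (muPrime_zero φ) c
  have h2 : nuTheta ψ (tupleFactorEquiv F n c) = c.prod (nuPrime ψ) :=
    finprod_multiplicity_tupleFactorEquiv (nuPrime_zero ψ) c
  rw [convTerm, h1, h2]
  change _ / ((∏ i : Fin n, atTheta F (tupleFactorEquiv F n c i).1) *
    (∏ i : Fin n, atTheta F (tupleFactorEquiv F n c i).1 ^ ((i : ℕ) + 1)) ^ s) = _
  simp only [tupleFactorEquiv_apply, Finsupp.prod, map_prod, map_pow, convLocal_eq]
  rw [Finset.prod_div_distrib, Finset.prod_mul_distrib, Finset.prod_mul_distrib, Finset.prod_pow,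
    Finset.prod_comm]
  congr 3
  rw [Finset.prod_comm]
  exact Finset.prod_congr rfl fun i _ => (Finset.prod_pow _ _ _).symm

theorem summable_convTerm : Summable (convTerm φ ψ s) := by
  refine KInf.summable_of_pow_le (n := n)
    (N := fun a : Fin n → MonicPoly F => ∑ i : Fin n, ((i : ℕ) + 1) * (a i).1.natDegree)
    (fun a => ?_) finite_tuple_degree_le
  obtain ⟨c, rfl⟩ := (tupleFactorEquiv F n).surjective a
  rw [convTerm_tupleFactorEquiv, sum_natDegree_tupleFactorEquiv]
  have h := (valFiltration F n).prod_mem c.support (fun f => convLocal φ ψ s f (c f)) _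
    fun f _ => convLocal_mem φ ψ s f (c f)
  rw [Finset.sum_neg_distrib, ← Nat.cast_sum] at h
  exact h

theorem hasProd_conv :
    HasProd (fun f : MonicIrr F => ∑' k, convLocal φ ψ s f k) (LConv φ ψ s) := by
  have hs := (tupleFactorEquiv F n).summable_iff.2 (summable_convTerm φ ψ s)
  have he : convTerm φ ψ s ∘ tupleFactorEquiv F n = fun c => c.prod (convLocal φ ψ s) :=
    funext fun c => convTerm_tupleFactorEquiv φ ψ s c
  rw [he] at hs
  have h1 : LConv φ ψ s = ∑' c : MonicIrr F →₀ (Fin n → ℕ), c.prod (convLocal φ ψ s) := by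
    exact ((tupleFactorEquiv F n).tsum_eq (convTerm φ ψ s)).symm.trans
      (tsum_congr fun c => convTerm_tupleFactorEquiv φ ψ s c)
  rw [h1]
  exact hasProd_of_summable (convLocal_zero φ ψ s) hs

theorem eulerFactor_eq (f : MonicIrr F) :
    eulerFactor φ ψ s f = (1 - pellarinTerm φ ψ ((n + 1) * s + 1) ⟨f.1, f.2.1⟩)⁻¹ *
      ∑' k, convLocal φ ψ s f k := by
  have h1 := (hasSum_geometric_pellarinTerm φ ψ (Nat.le_add_left 1 ((n + 1) * s)) f).2
  have h2 := (hasSum_convLocal φ ψ s f).2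
  rw [eulerFactor]
  rw [← h2] at h1 ⊢
  rw [mul_inv, mul_right_comm, inv_mul_cancel₀ (left_ne_zero_of_mul h1), one_mul]

theorem hasProd_eulerFactor :
    HasProd (eulerFactor φ ψ s) (LPellarin φ ψ ((n + 1) * s + 1) * LConv φ ψ s) := by
  have h := (hasProd_pellarin φ ψ (Nat.le_add_left 1 ((n + 1) * s))).mul (hasProd_conv φ ψ s)
  refine h.congr_fun ?_
  exact fun f => eulerFactor_eq φ ψ s f

end Convolution

section TateAlgebra

variable (F : Type*) [Field F]

/-- The ring `F[z]((θ⁻¹))`. -/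
def tateSubring : Subring (KInf F) where
  carrier := tateAlg F
  zero_mem' m := ⟨0, by simp⟩
  one_mem' m := by
    by_cases h : m = 0
    · exact ⟨1, by simp [h]⟩
    · exact ⟨0, by simp [HahnSeries.coeff_one, h]⟩
  add_mem' {x y} hx hy m := by
    obtain ⟨p, hp⟩ := hx m
    obtain ⟨q, hq⟩ := hy m
    exact ⟨p + q, by rw [HahnSeries.coeff_add, hp, hq, map_add]⟩
  neg_mem' {x} hx m := by
    obtain ⟨p, hp⟩ := hx m
    exact ⟨-p, by rw [HahnSeries.coeff_neg, hp, map_neg]⟩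
  mul_mem' {x y} hx hy m := by
    choose p hp using hx
    choose q hq using hy
    refine ⟨∑ ij ∈ Finset.antidiagonal x.isPWO_support y.isPWO_support m, p ij.1 * q ij.2, ?_⟩
    rw [HahnSeries.coeff_mul, map_sum]
    exact Finset.sum_congr rfl fun ij _ => by rw [map_mul, hp, hq]

variable {F}

theorem isClosed_tateSubring : IsClosed (tateSubring F : Set (KInf F)) := by
  let _ : UniformSpace (RatFunc F) := ⊥
  have : DiscreteTopology (RatFunc F) := ⟨rfl⟩
  have h : (tateSubring F : Set (KInf F)) =
      ⋂ m : ℤ, (fun x : KInf F => x.coeff m) ⁻¹' Set.range (algebraMap F[X] (RatFunc F)) := by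
    ext x
    rw [Set.mem_iInter]
    exact forall_congr' fun m => ⟨fun ⟨p, hp⟩ => ⟨p, hp.symm⟩, fun ⟨p, hp⟩ => ⟨p, hp.symm⟩⟩
  rw [h]
  exact isClosed_iInter fun m => (isClosed_discrete _).preimage
    (LaurentSeries.uniformContinuous_coeff m).continuous

theorem single_mem_tateSubring (m : ℤ) (p : F[X]) :
    HahnSeries.single m (algebraMap F[X] (RatFunc F) p) ∈ tateSubring F := by
  intro j
  rw [HahnSeries.coeff_single]
  split_ifs
  · exact ⟨p, rfl⟩
  · exact ⟨0, (map_zero _).symm⟩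

theorem atZ_mem_tateSubring (p : F[X]) : atZ F p ∈ tateSubring F := by
  rw [atZ_eq_C]
  exact single_mem_tateSubring 0 p

theorem constHom_mem_tateSubring (c : F) : constHom F c ∈ tateSubring F := by
  rw [← atZ_C]
  exact atZ_mem_tateSubring _

theorem single_one_mem_tateSubring (m : ℤ) :
    (HahnSeries.single m (1 : RatFunc F) : KInf F) ∈ tateSubring F := by
  have := single_mem_tateSubring (F := F) m 1
  rwa [map_one] at this

theorem atTheta_mem_tateSubring (p : F[X]) : atTheta F p ∈ tateSubring F := by
  rw [atTheta, coe_eval₂RingHom, eval₂_eq_sum_range]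
  exact sum_mem fun i _ => mul_mem (constHom_mem_tateSubring _) (pow_mem (single_one_mem_tateSubring _) i)

theorem inv_atTheta_mem_tateSubring {a : F[X]} (ha : a.Monic) : (atTheta F a)⁻¹ ∈ tateSubring F := by
  set x : KInf F := HahnSeries.single (a.natDegree : ℤ) (1 : RatFunc F) with hx
  have h1 := (KInf.hasSum_geometric (valuation_one_sub_single_mul_atTheta ha)).1
  rw [sub_sub_cancel] at h1
  have hx0 : x ≠ 0 := HahnSeries.single_ne_zero one_ne_zero
  have h2 : (atTheta F a)⁻¹ = x * (x * atTheta F a)⁻¹ := by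
    rw [mul_inv, mul_inv_cancel_left₀ hx0]
  rw [h2, ← h1.tsum_eq]
  refine mul_mem (single_one_mem_tateSubring _) (tsum_mem isClosed_tateSubring fun k => pow_mem ?_ k)
  exact sub_mem (one_mem _) (mul_mem (single_one_mem_tateSubring _) (atTheta_mem_tateSubring a))

variable {n : ℕ} (φ ψ : GoodDrinfeldModule F (n + 1)) (s : ℕ)

theorem LPellarin_mem_tateSubring (N : ℕ) : LPellarin φ ψ N ∈ tateSubring F :=
  tsum_mem isClosed_tateSubring fun a => by
    rw [pellarinTerm, div_eq_mul_inv, ← inv_pow]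
    exact mul_mem (mul_mem (constHom_mem_tateSubring _) (atZ_mem_tateSubring _))
      (pow_mem (inv_atTheta_mem_tateSubring a.2) N)

variable [Fintype F]

theorem LConv_mem_tateSubring : LConv φ ψ s ∈ tateSubring F :=
  tsum_mem isClosed_tateSubring fun a => by
    rw [convTerm, div_eq_mul_inv, mul_inv, ← inv_pow, ← Finset.prod_inv_distrib,
      ← Finset.prod_inv_distrib]
    refine mul_mem (mul_mem (atTheta_mem_tateSubring _) (atZ_mem_tateSubring _))
      (mul_mem (prod_mem fun i _ => inv_atTheta_mem_tateSubring (a i).2)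
        (pow_mem (prod_mem fun i _ => ?_) s))
    rw [← inv_pow]
    exact pow_mem (inv_atTheta_mem_tateSubring (a i).2) _

end TateAlgebra

end

theorem theorem5 {F : Type*} [Field F] [Fintype F] {r : ℕ} (hr : 2 ≤ r)
    (φ ψ : GoodDrinfeldModule F r) (s : ℕ) :
    (Multipliable (eulerFactor φ ψ s) ∧ LTwist φ ψ s ∈ tateAlg F) ∧
    (Summable (pellarinTerm φ ψ (r * s + 1)) ∧ LPellarin φ ψ (r * s + 1) ∈ tateAlg F) ∧
    (Summable (convTerm φ ψ s) ∧ LConv φ ψ s ∈ tateAlg F) ∧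
    LTwist φ ψ s = LPellarin φ ψ (r * s + 1) * LConv φ ψ s := by
  obtain ⟨n, rfl⟩ : ∃ n, r = n + 1 := ⟨r - 1, by omega⟩
  have hprod := hasProd_eulerFactor φ ψ s
  have hP := LPellarin_mem_tateSubring φ ψ ((n + 1) * s + 1)
  have hC := LConv_mem_tateSubring φ ψ s
  have heq : LTwist φ ψ s = LPellarin φ ψ ((n + 1) * s + 1) * LConv φ ψ s := hprod.tprod_eq
  refine ⟨⟨hprod.multipliable, ?_⟩, ⟨summable_pellarinTerm φ ψ (Nat.le_add_left 1 _), hP⟩,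
    ⟨summable_convTerm φ ψ s, hC⟩, heq⟩
  rw [heq]
  exact (tateSubring F).mul_mem hP hC
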